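/- Let $n,m\ge 1$ be integers, put $h=2^{n-1}m$, and let $\gamma$ be a generator of the cyclic group $C_{2^n}$. Let $$\mathcal R_n=\mathbb Z_{(2)}[\gamma^jt_i : 0\le j<2^{n-1},\ i\ge 1],\qquad \mathcal R_n\langle m\rangle=\mathbb Z_{(2)}[\gamma^jt_i : 0\le j<2^{n-1},\ 1\le i\le m],$$ where $\gamma$ acts on $\mathcal R_n$ by $\gamma^jt_i\mapsto\gamma^{j+1}t_i$ for $j<2^{n-1}-1$ and $\gamma^{2^{n-1}-1}t_i\mapsto -t_i$, where $\mathcal R_n\to\mathcal R_n\langle m\rangle$ is the quotient map killing all $\gamma^jt_i$ with $i>m$, and where $\gamma^jt_i$ has degree $2(2^i-1)$. There is a unique $2$-typical commutative formal group law $\mathcal F$ over $\mathcal R_n$ such that $\psi_\gamma(x)=x+\sum^{\mathcal F^\gamma}_{i\ge1}t_ix^{2^i}$ is a strict isomorphism $\mathcal F\to\mathcal F^\gamma:=\gamma^*\mathcal F$, such that $\mathcal F^{\gamma^{2^{n-1}}}(x,y)=-\mathcal F(-x,-y)$, and such that the composite $\mathcal F\to\mathcal F^{\gamma}\to\cdots\to\mathcal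 F^{\gamma^{2^{n-1}}}$ of the strict isomorphisms $(\gamma^i)^*\psi_\gamma$, $0\le i<2^{n-1}$, is $-[-1]_{\mathcal F}(x)$. There are unique elements $v_i\in\mathcal R_n$, $i\ge0$ (with $v_0=2$), such that $[2]_{\mathcal F}(x)=\sum^{\mathcal F}_{i\ge0}v_ix^{2^i}$. Write $\mathcal F$ and $v_i$ also for their images over $\mathcal R_n\langle m\rangle$ and over rings under it, and put $I_r=(2,v_1,\dots,v_{r-1})$. Then there is a homogeneous element $D\in\mathcal R_n\langle m\rangle$ such that: 1. $v_h$ divides $D$ in $\mathcal R_n\langle m\rangle$. 2. $(2,v_1,\dots,v_{h-1})$ is a regular sequence in $D^{-1}\mathcal R_n\langle m\rangle$ (each element is a non-zero-divisor modulo the preceding ones, and the quotient by all of them is non-zero), and $v_h$ is a non-zero-divisor modulo $I_h$, i.e. $(2,v_1,\dots,v_h)$ is a weakly regular sequence. 3. $v_r\in I_r$ in $\mathcal R_n\langle m\rangle$ for all $r>h$. 4. There is a ring isomorphism $D^{-1}\mathcal R_n\langle m\rangle/I_h\cong\mathbb F_2[t_m^{\pm1}]$ that sends $\gamma^jt_m$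 to $t_m$ for all $j$, sends $\gamma^jt_i$ to $0$ for all $j$ and all $i<m$, and sends $v_h$ to $t_m^{(2^h-1)/(2^m-1)}$. 5. The formal group law $\mathcal F$ over $D^{-1}\mathcal R_n\langle m\rangle/I_h$ has height exactly $h$: its $2$-series is $\lambda x^{2^h}+(\text{higher order terms})$ with $\lambda$ a unit of this non-zero ring. -/

import Mathlib

open scoped TensorProduct

namespace NormBP

noncomputable section

/-! ### Generalities on one-dimensional formal group laws

A formal group law is Mathlib's `FormalGroup`; commutativity is `FormalGroup.IsComm`, and
`FormalGroup.map` is the push-forward along a ring homomorphism. -/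

section FormalGroupLaws

variable {S : Type*} [CommRing S]

/-- The formal sum `a +_F b = F(a, b)` of two power series in one variable. -/
def fadd (F : FormalGroup S) (a b : PowerSeries S) : PowerSeries S :=
  F.toPowerSeries.subst ![a, b]

/-- The `2`-series `[2]_F(x) = F(x, x)`. -/
def twoSeries (F : FormalGroup S) : PowerSeries S :=
  fadd F PowerSeries.X PowerSeries.X

/-- The finite formal sum `∑^F_{i < N} a_i x^(2^i)`. -/
def partialFormalSum (F : FormalGroup S) (a : ℕ → S) : ℕ → PowerSeries S
  | 0 => 0
  | N + 1 => fadd F (partialFormalSum F a N) (PowerSeries.monomial (2 ^ N) (a N))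

/-- The infinite formal sum `∑^F_{i ≥ 0} a_i x^(2^i)`. The terms with `i > d` only affect degrees
`≥ 2^(d+1) > d`, so the coefficient of `x^d` may be read off from the terms with `i ≤ d`. -/
def formalSum (F : FormalGroup S) (a : ℕ → S) : PowerSeries S :=
  PowerSeries.mk fun d => PowerSeries.coeff d (partialFormalSum F a (d + 1))

/-- `ψ` is a strict isomorphism `F → G`: it has no constant term, it satisfies
`ψ(F(x, y)) = G(ψ(x), ψ(y))`, and `ψ(x) = x + ⋯`. -/
structure IsStrictIso (F G : FormalGroup S) (ψ : PowerSeries S) : Prop where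
  constantCoeff_eq : PowerSeries.constantCoeff ψ = 0
  coeff_one_eq : PowerSeries.coeff 1 ψ = 1
  map_add : PowerSeries.subst F.toPowerSeries ψ =
    MvPowerSeries.subst
      ![PowerSeries.subst (MvPowerSeries.X 0 : MvPowerSeries (Fin 2) S) ψ,
        PowerSeries.subst (MvPowerSeries.X 1 : MvPowerSeries (Fin 2) S) ψ] G.toPowerSeries

/-- A formal group law over a (torsion free) ring `S` is `2`-typical if over `S ⊗ ℚ` it has a
logarithm, i.e. a strict isomorphism to the additive formal group law, of the form
`∑_{k ≥ 0} ℓ_k x^(2^k)`. -/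
def IsTwoTypical (F : FormalGroup S) : Prop :=
  ∃ L : PowerSeries (S ⊗[ℤ] ℚ),
    IsStrictIso
      (F.map (Algebra.TensorProduct.includeLeft : S →ₐ[ℤ] S ⊗[ℤ] ℚ).toRingHom)
      FormalGroup.𝔾ₐ L ∧
    ∀ d : ℕ, (∀ k : ℕ, d ≠ 2 ^ k) → PowerSeries.coeff d L = 0

/-- `v` is the sequence of Araki elements of `F`: `[2]_F(x) = ∑^F_{i ≥ 0} v_i x^(2^i)`
(so that `v_0 = 2`). -/
def IsAraki (F : FormalGroup S) (v : ℕ → S) : Prop :=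
  twoSeries F = formalSum F v

/-- The ideal `I_r = (2, v_1, …, v_{r-1})`. -/
def chromIdeal (v : ℕ → S) (r : ℕ) : Ideal S :=
  Ideal.span (insert 2 {x | ∃ i : ℕ, 1 ≤ i ∧ i < r ∧ x = v i})

/-- The sequence `(2, v_1, …, v_r)`. -/
def chromSeq (v : ℕ → S) (r : ℕ) : List S :=
  2 :: (List.range r).map fun i => v (i + 1)

/-- A `2`-typical formal group law `H` over `S` has height `h` if there is a unit `u` of `S` with
`[2]_H(x) = u x^(2^h) + (higher order terms)` modulo `(2, v_1, …, v_{h-1})`, where the `v_i` are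
the Araki elements of `H`. -/
def HasHeight (H : FormalGroup S) (h : ℕ) : Prop :=
  ∃ v : ℕ → S, IsAraki H v ∧ ∃ u : Sˣ,
    (∀ d < 2 ^ h, PowerSeries.coeff d (twoSeries H) ∈ chromIdeal v h) ∧
    PowerSeries.coeff (2 ^ h) (twoSeries H) - (u : S) ∈ chromIdeal v h

end FormalGroupLaws

/-! ### The rings `R_n` and `R_n⟨m⟩` -/

instance isPrime_span_two : (Ideal.span {(2 : ℤ)}).IsPrime :=
  (Ideal.span_singleton_prime two_ne_zero).mpr Int.prime_two

/-- The ring `ℤ_(2)`, the integers localized at the prime `2`. -/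
abbrev ZLocTwo : Type := Localization.AtPrime (Ideal.span {(2 : ℤ)})

/-- The ring `R_n = ℤ_(2)[C_{2^n} · t_1, C_{2^n} · t_2, …]`. The variable with index `(j, i)`,
`0 ≤ j < 2^(n-1)`, `i ≥ 0`, is `γ^j t_{i+1}`. -/
abbrev Rn (n : ℕ) : Type := MvPolynomial (Fin (2 ^ (n - 1)) × ℕ) ZLocTwo

/-- The ring `R_n⟨m⟩ = ℤ_(2)[C_{2^n} · t_1, …, C_{2^n} · t_m]`. The variable with index `(j, i)`,
`0 ≤ j < 2^(n-1)`, `0 ≤ i < m`, is `γ^j t_{i+1}`. -/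
abbrev Rnm (n m : ℕ) : Type := MvPolynomial (Fin (2 ^ (n - 1)) × Fin m) ZLocTwo

/-- The action on `R_n` of the generator `γ` of `C_{2^n}`: it sends `γ^j t_i` to `γ^(j+1) t_i` for
`j < 2^(n-1) - 1`, and `γ^(2^(n-1)-1) t_i` to `-t_i`. -/
def gamma (n : ℕ) : Rn n →+* Rn n :=
  (MvPolynomial.aeval fun p : Fin (2 ^ (n - 1)) × ℕ =>
    if hp : (p.1 : ℕ) + 1 < 2 ^ (n - 1) then
      (MvPolynomial.X (⟨(p.1 : ℕ) + 1, hp⟩, p.2) : Rn n)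
    else
      -MvPolynomial.X (⟨0, Nat.two_pow_pos _⟩, p.2) : Rn n →ₐ[ZLocTwo] Rn n).toRingHom

/-- The elements `t_i` of `R_n`, with the convention `t_0 = 1`. -/
def t (n : ℕ) : ℕ → Rn n
  | 0 => 1
  | i + 1 => MvPolynomial.X (⟨0, Nat.two_pow_pos _⟩, i)

/-- The quotient map `R_n → R_n⟨m⟩`, which kills `γ^j t_i` for `i > m`. -/
def truncate (n m : ℕ) : Rn n →+* Rnm n m :=
  (MvPolynomial.aeval fun p : Fin (2 ^ (n - 1)) × ℕ =>
    if hp : p.2 < m then (MvPolynomial.X (p.1, ⟨p.2, hp⟩) : Rnm n m) else 0 :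
      Rn n →ₐ[ZLocTwo] Rnm n m).toRingHom

/-- The grading of `R_n⟨m⟩`: `γ^j t_i` has degree `2(2^i - 1)`. -/
def weight (n m : ℕ) (p : Fin (2 ^ (n - 1)) × Fin m) : ℕ :=
  2 * (2 ^ ((p.2 : ℕ) + 1) - 1)

/-! ### The formal group law over `R_n` -/

/-- The power series `ψ_γ(x) = x + ∑^{F^γ}_{i ≥ 1} t_i x^(2^i)`, where `F^γ = γ^* F`. -/
def psi (n : ℕ) (F : FormalGroup (Rn n)) : PowerSeries (Rn n) :=
  formalSum (F.map (gamma n)) (t n)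

/-- The composite
`F → F^γ → F^(γ^2) → ⋯ → F^(γ^a)` of `ψ_γ, γ^* ψ_γ, …, (γ^(a-1))^* ψ_γ`. -/
def psiComp (n : ℕ) (F : FormalGroup (Rn n)) : ℕ → PowerSeries (Rn n)
  | 0 => PowerSeries.X
  | a + 1 => PowerSeries.subst (psiComp n F a) (PowerSeries.map (gamma n ^ a) (psi n F))

/-- `F` is the `2`-typical formal group law over `R_n` with its canonical `C_{2^n}`-structure, for
which the `t_i` are the coordinates of `ψ_γ`. The element `γ^(2^(n-1))` of order two acts through
the conjugation action, i.e. it takes `F` to `-F(-x, -y)`, and the composite strict isomorphism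
`F → F^(γ^(2^(n-1)))` is `-[-1]_F(x)`, i.e. `-1` times it is the formal inverse of `x`. -/
structure IsCanonical (n : ℕ) (F : FormalGroup (Rn n)) : Prop where
  isComm : F.IsComm
  isTwoTypical : IsTwoTypical F
  isStrictIso : IsStrictIso F (F.map (gamma n)) (psi n F)
  conj : (F.map (gamma n ^ 2 ^ (n - 1))).toPowerSeries =
    -MvPowerSeries.subst ![-MvPowerSeries.X 0, -MvPowerSeries.X 1] F.toPowerSeries
  psiComp_eq : fadd F PowerSeries.X (-psiComp n F (2 ^ (n - 1))) = 0

end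

end NormBP

open NormBP

namespace NormBP

noncomputable section

/-! Write `N = 2^(n-1)`, `h = N m`, and let `φ` be the lift of Frobenius that squares every
variable. The proof is a computation with twisted power series `∑ a_i V^i`, where `V a = φ(a) V`.
Let `ℓ = ∑ ℓ_k V^k` encode the logarithm of `F`, and let `τ_a = ∑ γ^a(t_i) V^i`. That `ψ_γ` is a
strict isomorphism `F → F^γ` says `ℓ = γ(ℓ) τ_0`; iterating gives `ℓ = γ^N(ℓ) T` with `T = τ_{N-1} ⋯
τ_0`. The conjugation condition says `γ^N(ℓ) = 2 - ℓ`. These relations determine `ℓ`, and `ℓ = (2 -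
ℓ) T` yields `u ℓ = 2` with `u = 1 + T⁻¹` integral. This is a functional equation of Hazewinkel
type, so `F` exists over `R_n` (`IsFunctionalEquation.exists_formalGroup`). Reading off the
`2`-series gives `v_r ≡ -u_r ≡ -T_r` modulo `(2, T_1, …, T_{r-1})` (`IsCanonical.araki_add_mem`), so
the `v_r` may be replaced by the explicit `T_r`.

Over `R_n⟨m⟩` each `τ_a` is a polynomial of degree at most `m`, so `T_r = 0` for `r > h`; hence `v_r
∈ I_r` there. For regularity, the top coefficient `T_h` is modulo `2` a product of powers of the
variables `γ^a t_m`. Killing one variable lowers the degree of one factor, and `T_{h-1}` becomes the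
new top coefficient. Induction shows that `2, T_h, …, T_1` is regular
(`isRegularModulo_ker_reduction`), and homogeneity in positive degrees allows the `T_r` to be
reordered.

In the quotient by `I_h` with `v_h` inverted, `2 = 0` and `T = 1 + c V^h` with `c` a unit. Rotating
the factors of `T` cyclically shows that each `τ_a` commutes with `c V^h`, so `x (x^(2^h-1) -
c^(2^k-1)) = 0` for `x = γ^a t_k`. The element `D` is the product of `v_h`, of the second factors
for `k < m`, and of the cofactors of `x - y` in `x^M - y^M` for `x = γ^a t_m`, `y = t_m`, `M = 2^h -
1`. Inverting `D` thus kills `γ^a t_k` for `k < m` and identifies all `γ^a t_m`. Conversely `D`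
becomes a unit in `𝔽_2[t_m^±1]`, where `T = (1 + t_m V^m)^N = 1 + t_m^((2^h-1)/(2^m-1)) V^h`; so the
quotient is this ring and is non-zero. -/

/-- The power series with prescribed coefficients. -/
def ofCoeff {τ K : Type*} (c : (τ →₀ ℕ) → K) : MvPowerSeries τ K := c

theorem coeff_ofCoeff {τ K : Type*} [Semiring K] (c : (τ →₀ ℕ) → K) (e : τ →₀ ℕ) :
    MvPowerSeries.coeff e (ofCoeff c) = c e := rfl

/-! ### Power series supported in exponents `2^k`. -/

section TwoTypicalSeries

variable {τ K : Type*} [CommRing K]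

/-- The power series `∑ ℓ_k x^(2^k)`. -/
def twoTypicalSeries (l : ℕ → K) : PowerSeries K :=
  -- The test `d = 2 ^ Nat.log 2 d` recognizes powers of two; it fails at `d = 0`, since `Nat.log 2
  -- 0 = 0`.
  PowerSeries.mk fun d => if d = 2 ^ Nat.log 2 d then l (Nat.log 2 d) else 0

theorem coeff_twoTypicalSeries_two_pow (l : ℕ → K) (k : ℕ) :
    PowerSeries.coeff (2 ^ k) (twoTypicalSeries l) = l k := by
  simp [twoTypicalSeries]

theorem coeff_twoTypicalSeries_of_ne (l : ℕ → K) {d : ℕ} (h : ∀ k, d ≠ 2 ^ k) :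
    PowerSeries.coeff d (twoTypicalSeries l) = 0 := by
  simp [twoTypicalSeries, h]

theorem coeff_one_twoTypicalSeries (l : ℕ → K) :
    PowerSeries.coeff 1 (twoTypicalSeries l) = l 0 :=
  coeff_twoTypicalSeries_two_pow l 0

theorem constantCoeff_twoTypicalSeries (l : ℕ → K) :
    PowerSeries.constantCoeff (twoTypicalSeries l) = 0 := by
  rw [← PowerSeries.coeff_zero_eq_constantCoeff_apply]
  exact coeff_twoTypicalSeries_of_ne l fun k => (pow_pos two_pos k).ne

theorem eq_twoTypicalSeries {L : PowerSeries K}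
    (h : ∀ d : ℕ, (∀ k : ℕ, d ≠ 2 ^ k) → PowerSeries.coeff d L = 0) :
    L = twoTypicalSeries fun k => PowerSeries.coeff (2 ^ k) L := by
  ext d
  by_cases hd : ∃ k, d = 2 ^ k
  · obtain ⟨k, rfl⟩ := hd
    rw [coeff_twoTypicalSeries_two_pow]
  · push Not at hd
    rw [h d hd, coeff_twoTypicalSeries_of_ne _ hd]

theorem map_twoTypicalSeries {K' : Type*} [CommRing K'] (f : K →+* K') (l : ℕ → K) :
    PowerSeries.map f (twoTypicalSeries l) = twoTypicalSeries fun k => f (l k) := by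
  ext d
  simp only [twoTypicalSeries, PowerSeries.coeff_map, PowerSeries.coeff_mk]
  split_ifs <;> simp

theorem coeff_pow_eq_zero_of_degree_lt {g : MvPowerSeries τ K}
    (hg : MvPowerSeries.constantCoeff g = 0) {e : τ →₀ ℕ} {d : ℕ} (h : e.degree < d) :
    MvPowerSeries.coeff e (g ^ d) = 0 := by
  apply MvPowerSeries.coeff_of_lt_order
  exact lt_of_lt_of_le (by exact_mod_cast h)
    (MvPowerSeries.le_order_pow_of_constantCoeff_eq_zero d hg)

/-- The order of `g^(2^k)` is at least `2^k`, so terms with `k ≥ M` do not reach the degree of `e`.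
All later substitutions into a logarithm are computed through this finite sum. -/
theorem coeff_subst_twoTypicalSeries (l : ℕ → K) {g : MvPowerSeries τ K}
    (hg : MvPowerSeries.constantCoeff g = 0) {e : τ →₀ ℕ} {M : ℕ} (h : e.degree < 2 ^ M) :
    MvPowerSeries.coeff e (PowerSeries.subst g (twoTypicalSeries l)) =
      ∑ k ∈ Finset.range M, l k * MvPowerSeries.coeff e (g ^ 2 ^ k) := by
  rw [PowerSeries.coeff_subst (PowerSeries.HasSubst.of_constantCoeff_zero hg),
    finsum_eq_sum_of_support_subset (s := (Finset.range M).image (2 ^ ·)), Finset.sum_image]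
  · simp [coeff_twoTypicalSeries_two_pow]
  · intro a _ b _ hab
    exact Nat.pow_right_injective le_rfl hab
  · intro d hd
    simp only [Function.mem_support, smul_eq_mul] at hd
    have h1 : ∃ k, d = 2 ^ k := by
      by_contra! hne
      exact hd (by rw [coeff_twoTypicalSeries_of_ne l hne, zero_mul])
    obtain ⟨k, rfl⟩ := h1
    simp only [Finset.coe_image, Set.mem_image, Finset.coe_range, Set.mem_Iio]
    refine ⟨k, ?_, rfl⟩
    by_contra! hk
    refine hd ?_
    rw [coeff_pow_eq_zero_of_degree_lt hg
      (lt_of_lt_of_le h (Nat.pow_le_pow_right two_pos hk)), mul_zero]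

theorem le_order_pow_sub_pow {f g : MvPowerSeries τ K} {n : ℕ∞} (h : n ≤ (f - g).order) (k : ℕ) :
    n ≤ (f ^ k - g ^ k).order := by
  obtain ⟨c, hc⟩ := sub_dvd_pow_sub_pow f g k
  rw [hc]
  exact (h.trans le_self_add).trans MvPowerSeries.le_order_mul

theorem coeff_eq_of_le_order_sub {f g : MvPowerSeries τ K} {n : ℕ∞} (h : n ≤ (f - g).order)
    {e : τ →₀ ℕ} (he : (e.degree : ℕ∞) < n) :
    MvPowerSeries.coeff e f = MvPowerSeries.coeff e g := by
  have := MvPowerSeries.coeff_of_lt_order (lt_of_lt_of_le he h)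
  rwa [map_sub, sub_eq_zero] at this

theorem coeff_subst_twoTypicalSeries_congr (l : ℕ → K) {f g : MvPowerSeries τ K}
    (hf : MvPowerSeries.constantCoeff f = 0) (hg : MvPowerSeries.constantCoeff g = 0)
    {n : ℕ∞} (h : n ≤ (f - g).order) {e : τ →₀ ℕ} (he : (e.degree : ℕ∞) < n) :
    MvPowerSeries.coeff e (PowerSeries.subst f (twoTypicalSeries l)) =
      MvPowerSeries.coeff e (PowerSeries.subst g (twoTypicalSeries l)) := by
  have hM : e.degree < 2 ^ e.degree := Nat.lt_two_pow_self
  rw [coeff_subst_twoTypicalSeries l hf hM, coeff_subst_twoTypicalSeries l hg hM]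
  exact Finset.sum_congr rfl fun k _ => by
    rw [coeff_eq_of_le_order_sub (le_order_pow_sub_pow h _) he]

end TwoTypicalSeries

/-! ### The Frobenius-twisted expansion of power series. -/

section Twist

variable {τ K : Type*} [CommRing K] (s : K →+* K)

/-- The endomorphism `g(x) ↦ (s^i g)(x^(2^i))` of a power series ring. -/
def twist (i : ℕ) : MvPowerSeries τ K →+* MvPowerSeries τ K :=
  (MvPowerSeries.expand (2 ^ i) (pow_ne_zero i two_ne_zero)).toRingHom.comp
    (MvPowerSeries.map (s ^ i))

theorem twist_apply (i : ℕ) (g : MvPowerSeries τ K) :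
    twist s i g = MvPowerSeries.expand (2 ^ i) (pow_ne_zero i two_ne_zero)
      (MvPowerSeries.map (s ^ i) g) := rfl

theorem twist_zero (g : MvPowerSeries τ K) : twist s 0 g = g := by
  rw [twist_apply]
  have : MvPowerSeries.map (s ^ 0) g = g := by
    ext e; simp
  rw [this]
  exact MvPowerSeries.expand_one_apply g

theorem twist_X (i : ℕ) (a : τ) :
    twist s i (MvPowerSeries.X a : MvPowerSeries τ K) = MvPowerSeries.X a ^ 2 ^ i := by
  rw [twist_apply, MvPowerSeries.map_X, MvPowerSeries.expand_X]

theorem constantCoeff_twist (i : ℕ) (g : MvPowerSeries τ K) :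
    MvPowerSeries.constantCoeff (twist s i g) = (s ^ i) (MvPowerSeries.constantCoeff g) := by
  rw [twist_apply, MvPowerSeries.constantCoeff_expand, MvPowerSeries.constantCoeff_map]

theorem le_order_twist (i : ℕ) (g : MvPowerSeries τ K) :
    (2 ^ i : ℕ) • g.order ≤ (twist s i g).order := by
  rw [twist_apply, MvPowerSeries.order_expand]
  exact nsmul_le_nsmul_right (MvPowerSeries.le_order_map _) _

theorem twist_subst (i : ℕ) (l : ℕ → K) {g : MvPowerSeries τ K}
    (hg : MvPowerSeries.constantCoeff g = 0) :
    twist s i (PowerSeries.subst g (twoTypicalSeries l)) =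
      PowerSeries.subst (twist s i g) (twoTypicalSeries fun k => (s ^ i) (l k)) := by
  have hg' := PowerSeries.HasSubst.of_constantCoeff_zero hg
  rw [twist_apply, PowerSeries.map_subst hg', map_twoTypicalSeries, PowerSeries.subst,
    MvPowerSeries.expand_subst]
  · rfl
  · apply PowerSeries.HasSubst.const
    apply PowerSeries.HasSubst.of_constantCoeff_zero
    rw [MvPowerSeries.constantCoeff_map, hg, map_zero]

theorem map_twist {S : Type*} [CommRing S] (i : S →+* K) (s' : S →+* S)
    (h : ∀ x, s (i x) = i (s' x)) (k : ℕ) (g : MvPowerSeries τ S) :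
    MvPowerSeries.map i (twist s' k g) = twist s k (MvPowerSeries.map i g) := by
  rw [twist_apply, twist_apply, MvPowerSeries.map_expand]
  congr 1
  ext e
  simp only [MvPowerSeries.coeff_map]
  induction k generalizing g with
  | zero => simp
  | succ k ih =>
    rw [pow_succ, pow_succ]
    simp only [RingHom.mul_def, RingHom.comp_apply]
    rw [h]
    have := ih (MvPowerSeries.map s' g)
    simpa using this

end Twist

/-! ### Congruences modulo powers of `2`. -/

section Frobenius

variable {τ S : Type*} [CommRing S] (s : S →+* S)

/-- Modulo `2` the map `s` is the Frobenius, and in characteristic two raising a series to the power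
`2^i` is the same as raising its coefficients to that power and expanding the variables. -/
theorem exists_twist_eq (h2 : (2 : S) ∈ nonunits S)
    (hs : ∀ x, s x - x ^ 2 ∈ Ideal.span {(2 : S)}) (i : ℕ) (g : MvPowerSeries τ S) :
    ∃ c : MvPowerSeries τ S, g ^ 2 ^ i - twist s i g = 2 * c := by
  have : CharP (S ⧸ Ideal.span {(2 : S)}) 2 := CharP.quotient S 2 h2
  let q := Ideal.Quotient.mk (Ideal.span {(2 : S)})
  have hq : ∀ i x, q ((s ^ i) x) = iterateFrobenius (S ⧸ Ideal.span {(2 : S)}) 2 i (q x) := by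
    intro i
    induction i with
    | zero => intro x; simp
    | succ i ih =>
      intro x
      rw [pow_succ, RingHom.mul_def, RingHom.comp_apply, ih, iterateFrobenius_def,
        iterateFrobenius_def, Ideal.Quotient.eq.mpr (hs x), map_pow, ← pow_mul, pow_succ']
  have key : MvPowerSeries.map q (g ^ 2 ^ i) = MvPowerSeries.map q (twist s i g) := by
    rw [map_pow, ← MvPowerSeries.map_iterateFrobenius_expand 2 two_ne_zero, twist_apply,
      MvPowerSeries.map_expand, MvPowerSeries.map_expand]
    congr 1
    ext e
    simp only [MvPowerSeries.coeff_map, hq]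
  have hc : ∀ e, ∃ c, MvPowerSeries.coeff e (g ^ 2 ^ i - twist s i g) = 2 * c := by
    intro e
    have := congrArg (MvPowerSeries.coeff e) key
    rw [MvPowerSeries.coeff_map, MvPowerSeries.coeff_map] at this
    rw [map_sub]
    exact (Ideal.mem_span_singleton.mp (Ideal.Quotient.eq.mp this))
  choose c hc using hc
  refine ⟨ofCoeff c, ?_⟩
  ext e
  rw [hc, two_mul, two_mul, map_add, coeff_ofCoeff]

/-- Squaring `b + 2^(k+1) d` gains one more factor `2`. The exponent `k + 1` exceeds by one the
denominator `2^k` of `ℓ_k`, which is what makes the functional equation lemma work. -/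
theorem exists_pow_sub_pow_eq {R : Type*} [CommRing R] {a b c : R} (h : a - b = 2 * c) (k : ℕ) :
    ∃ d, a ^ 2 ^ k - b ^ 2 ^ k = 2 ^ (k + 1) * d := by
  induction k with
  | zero => exact ⟨c, by simpa using h⟩
  | succ k ih =>
    obtain ⟨d, hd⟩ := ih
    refine ⟨d * (b ^ 2 ^ k + 2 ^ k * d), ?_⟩
    have : a ^ 2 ^ k = b ^ 2 ^ k + 2 ^ (k + 1) * d := by rw [← hd]; ring
    rw [pow_succ 2 k, pow_mul, pow_mul, this]
    ring

end Frobenius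

/-! ### Hazewinkel's functional equation lemma at the prime `2`. -/

/-- The data of a functional equation `2 ℓ_k + ∑_{0 < i ≤ k} u_i s^i(ℓ_{k-i}) = 0` for `k ≥ 1`, over
a torsion free ring `S ⊆ K` with a lift `s` of the Frobenius. -/
structure IsFunctionalEquation {S K : Type*} [CommRing S] [CommRing K] (i : S →+* K) (s : S →+* S)
    (sK : K →+* K) (u : ℕ → S) (l : ℕ → K) : Prop where
  injective : Function.Injective i
  isUnit_two : IsUnit (2 : K)
  two_mem_nonunits : (2 : S) ∈ nonunits S
  frobenius : ∀ x, s x - x ^ 2 ∈ Ideal.span {(2 : S)}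
  comm : ∀ x, sK (i x) = i (s x)
  u_zero : u 0 = 2
  l_zero : l 0 = 1
  rel : ∀ k, 1 ≤ k → ∑ p ∈ Finset.HasAntidiagonal.antidiagonal k, i (u p.1) * (sK ^ p.1) (l p.2) = 0

namespace IsFunctionalEquation

variable {τ S K : Type*} [CommRing S] [CommRing K] {i : S →+* K} {s : S →+* S} {sK : K →+* K}
  {u : ℕ → S} {l : ℕ → K} (H : IsFunctionalEquation i s sK u l)

include H

theorem comm_pow (k : ℕ) (x : S) : (sK ^ k) (i x) = i ((s ^ k) x) := by
  induction k generalizing x with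
  | zero => simp
  | succ k ih =>
    rw [pow_succ, pow_succ, RingHom.mul_def, RingHom.mul_def, RingHom.comp_apply,
      RingHom.comp_apply, H.comm, ih]

/-- The functional equation expresses `2 ℓ_k` integrally through twists of the earlier `ℓ_j`, so
each step costs at most one factor `2` in the denominator. -/
theorem exists_two_pow_mul (k : ℕ) : ∃ c : S, 2 ^ k * l k = i c := by
  induction k using Nat.strong_induction_on with
  | _ k ih =>
    rcases Nat.eq_zero_or_pos k with rfl | hk
    · exact ⟨1, by simp [H.l_zero]⟩
    obtain ⟨k, rfl⟩ : ∃ k', k = k' + 1 := ⟨k - 1, by omega⟩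
    have h := H.rel (k + 1) hk
    rw [Finset.Nat.sum_antidiagonal_succ] at h
    simp only [H.u_zero, pow_zero, RingHom.one_def, RingHom.id_apply, map_ofNat] at h
    have hc : ∀ p ∈ Finset.HasAntidiagonal.antidiagonal k, ∃ c : S,
        2 ^ k * (i (u (p.1 + 1)) * (sK ^ (p.1 + 1)) (l p.2)) = i c := by
      intro p hp
      rw [Finset.HasAntidiagonal.mem_antidiagonal] at hp
      obtain ⟨c, hc⟩ := ih p.2 (by omega)
      refine ⟨2 ^ p.1 * u (p.1 + 1) * (s ^ (p.1 + 1)) c, ?_⟩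
      rw [map_mul, ← H.comm_pow, ← hc, ← hp, pow_add]
      simp only [map_mul, map_pow, map_ofNat]
      ring
    choose! c hc using hc
    refine ⟨-∑ p ∈ Finset.HasAntidiagonal.antidiagonal k, c p, ?_⟩
    rw [map_neg, map_sum, ← Finset.sum_congr rfl hc, ← Finset.mul_sum]
    linear_combination 2 ^ k * h

theorem exists_two_pow_mul_twist (j k : ℕ) : ∃ c : S, 2 ^ k * (sK ^ j) (l k) = i c := by
  obtain ⟨c, hc⟩ := H.exists_two_pow_mul k
  refine ⟨(s ^ j) c, ?_⟩
  rw [← H.comm_pow, ← hc, map_mul, map_pow, map_ofNat]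

/-- The functional equation `∑_i u_i (s^i L)(z^(2^i)) = 2 z` of the logarithm. -/
theorem sum_coeff_subst_pow {z : MvPowerSeries τ K} (hz : MvPowerSeries.constantCoeff z = 0)
    {e : τ →₀ ℕ} {M : ℕ} (hM : e.degree < 2 ^ M) :
    ∑ j ∈ Finset.range M, i (u j) * MvPowerSeries.coeff e
      (PowerSeries.subst (z ^ 2 ^ j) (twoTypicalSeries fun k => (sK ^ j) (l k))) =
      2 * MvPowerSeries.coeff e z := by
  have hz0 : ∀ n, M ≤ n → MvPowerSeries.coeff e (z ^ 2 ^ n) = 0 := fun n hn =>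
    coeff_pow_eq_zero_of_degree_lt hz (hM.trans_le (Nat.pow_le_pow_right two_pos hn))
  have h1 : ∀ j ∈ Finset.range M, i (u j) * MvPowerSeries.coeff e
      (PowerSeries.subst (z ^ 2 ^ j) (twoTypicalSeries fun k => (sK ^ j) (l k))) =
      ∑ k ∈ Finset.range (M - j),
        i (u j) * (sK ^ j) (l k) * MvPowerSeries.coeff e (z ^ 2 ^ (j + k)) := by
    intro j hj
    have hzj : MvPowerSeries.constantCoeff (z ^ 2 ^ j) = 0 := by
      rw [map_pow, hz, zero_pow (pow_ne_zero _ two_ne_zero)]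
    rw [coeff_subst_twoTypicalSeries _ hzj hM, Finset.mul_sum]
    symm
    apply Finset.sum_subset_zero_on_sdiff (Finset.range_mono (Nat.sub_le M j))
    · intro k hk
      simp only [Finset.mem_sdiff, Finset.mem_range, not_lt] at hk
      rw [← pow_mul, ← pow_add, hz0 _ (by omega), mul_zero, mul_zero]
    · intro k _
      rw [← pow_mul, ← pow_add, mul_assoc]
  -- The double sum is regrouped by `n = j + k`, the exponent of `z^(2^n)`. By the functional
  -- equation the total coefficient vanishes for `n ≥ 1`, and for `n = 0` it is `2`.
  rw [Finset.sum_congr rfl h1, ← Finset.sum_range_diag_flip M fun j k =>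
    i (u j) * (sK ^ j) (l k) * MvPowerSeries.coeff e (z ^ 2 ^ (j + k))]
  have h2 : ∀ n ∈ Finset.range M, ∑ k ∈ Finset.range (n + 1),
      i (u k) * (sK ^ k) (l (n - k)) * MvPowerSeries.coeff e (z ^ 2 ^ (k + (n - k))) =
      if n = 0 then 2 * MvPowerSeries.coeff e z else 0 := by
    intro n _
    have h3 : ∀ k ∈ Finset.range (n + 1),
        i (u k) * (sK ^ k) (l (n - k)) * MvPowerSeries.coeff e (z ^ 2 ^ (k + (n - k))) =
        i (u k) * (sK ^ k) (l (n - k)) * MvPowerSeries.coeff e (z ^ 2 ^ n) := by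
      intro k hk
      rw [Finset.mem_range] at hk
      rw [Nat.add_sub_cancel' (by omega)]
    rw [Finset.sum_congr rfl h3, ← Finset.sum_mul]
    split_ifs with hn
    · subst hn
      simp [H.u_zero, H.l_zero, map_ofNat]
    · have := H.rel n (by omega)
      rw [Finset.Nat.sum_antidiagonal_eq_sum_range_succ_mk] at this
      rw [this, zero_mul]
  rw [Finset.sum_congr rfl h2, Finset.sum_ite_eq']
  split_ifs with h0
  · rfl
  · have : e.degree = 0 := by
      simp only [Finset.mem_range, not_lt, Nat.le_zero] at h0
      rw [h0] at hM; omega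
    rw [(Finsupp.degree_eq_zero_iff e).mp this, MvPowerSeries.coeff_zero_eq_constantCoeff_apply,
      hz, mul_zero]

/-- The difference `(s^j L)(g^(2^j)) - s^j(L(g))(x^(2^j))` between the two ways of twisting a
logarithm. -/
def _root_.NormBP.twistDefect (sK : K →+* K) (l : ℕ → K) (j : ℕ) (g : MvPowerSeries τ K) :
    MvPowerSeries τ K :=
  PowerSeries.subst (g ^ 2 ^ j) (twoTypicalSeries fun k => (sK ^ j) (l k)) -
    PowerSeries.subst (twist sK j g) (twoTypicalSeries fun k => (sK ^ j) (l k))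

/-- The functional equation at `z = g`, with each `(s^j L)(g^(2^j))` replaced by the twist of `L(g)`
plus the defect. The first sum depends on `g` only through `L(g)`; the second is divisible by `2`
for integral `g`. -/
theorem two_mul_coeff {g : MvPowerSeries τ K} (hg : MvPowerSeries.constantCoeff g = 0)
    {e : τ →₀ ℕ} {M : ℕ} (hM : e.degree < 2 ^ M) :
    2 * MvPowerSeries.coeff e g =
      ∑ j ∈ Finset.range M, i (u j) * MvPowerSeries.coeff e
        (twist sK j (PowerSeries.subst g (twoTypicalSeries l))) +
      ∑ j ∈ Finset.range M, i (u j) * MvPowerSeries.coeff e (twistDefect sK l j g) := by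
  rw [← H.sum_coeff_subst_pow hg hM, ← Finset.sum_add_distrib]
  refine Finset.sum_congr rfl fun j _ => ?_
  rw [twistDefect, twist_subst _ _ _ hg, map_sub]
  ring

/-- The twist of a variable is its `2^j`-th power, so a variable has no defect. -/
theorem sum_coeff_twist_subst_X (a : τ) {e : τ →₀ ℕ} {M : ℕ} (hM : e.degree < 2 ^ M) :
    ∑ j ∈ Finset.range M, i (u j) * MvPowerSeries.coeff e
        (twist sK j (PowerSeries.subst (MvPowerSeries.X a : MvPowerSeries τ K)
          (twoTypicalSeries l))) = 2 * MvPowerSeries.coeff e (MvPowerSeries.X a) := by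
  rw [← H.sum_coeff_subst_pow (MvPowerSeries.constantCoeff_X a) hM]
  refine Finset.sum_congr rfl fun j _ => ?_
  rw [twist_subst _ _ _ (MvPowerSeries.constantCoeff_X a), twist_X]

/-- Since `g^(2^j)` and the twist of `g` agree modulo `2`, their `2^k`-th powers agree modulo
`2^(k+1)`. Multiplication by `ℓ_k`, whose denominator divides `2^k`, leaves one factor `2`. -/
theorem exists_coeff_twistDefect_eq (j : ℕ) {g : MvPowerSeries τ S}
    (hg : MvPowerSeries.constantCoeff g = 0) (e : τ →₀ ℕ) :
    ∃ c : S, MvPowerSeries.coeff e (twistDefect sK l j (MvPowerSeries.map i g)) = 2 * i c := by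
  obtain ⟨c, hc⟩ := exists_twist_eq s H.two_mem_nonunits H.frobenius j g
  have hM : e.degree < 2 ^ e.degree := Nat.lt_two_pow_self
  have h1 : MvPowerSeries.constantCoeff (MvPowerSeries.map i g ^ 2 ^ j) = 0 := by
    rw [map_pow, MvPowerSeries.constantCoeff_map, hg, map_zero,
      zero_pow (pow_ne_zero _ two_ne_zero)]
  have h2 : MvPowerSeries.constantCoeff (twist sK j (MvPowerSeries.map i g)) = 0 := by
    rw [constantCoeff_twist, MvPowerSeries.constantCoeff_map, hg, map_zero, map_zero]
  rw [twistDefect, map_sub, coeff_subst_twoTypicalSeries _ h1 hM,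
    coeff_subst_twoTypicalSeries _ h2 hM, ← Finset.sum_sub_distrib]
  have h3 : ∀ k, ∃ b : S, (sK ^ j) (l k) * MvPowerSeries.coeff e
        ((MvPowerSeries.map i g ^ 2 ^ j) ^ 2 ^ k) -
      (sK ^ j) (l k) * MvPowerSeries.coeff e
        (twist sK j (MvPowerSeries.map i g) ^ 2 ^ k) = 2 * i b := by
    intro k
    obtain ⟨d, hd⟩ := exists_pow_sub_pow_eq hc k
    obtain ⟨b, hb⟩ := H.exists_two_pow_mul_twist j k
    refine ⟨b * MvPowerSeries.coeff e d, ?_⟩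
    rw [← mul_sub, ← map_sub, ← map_twist sK i s H.comm, ← map_pow, ← map_pow, ← map_pow,
      ← map_sub, hd, MvPowerSeries.coeff_map]
    have : (2 : MvPowerSeries τ S) ^ (k + 1) * d = MvPowerSeries.C (2 ^ (k + 1)) * d := by
      simp [map_ofNat]
    rw [this, MvPowerSeries.coeff_C_mul, map_mul, map_mul, ← hb]
    simp only [map_pow, map_ofNat]
    ring
  choose b hb using h3
  refine ⟨∑ k ∈ Finset.range e.degree, b k, ?_⟩
  rw [map_sum, Finset.mul_sum]
  exact Finset.sum_congr rfl fun k _ => hb k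

omit H in
theorem twistDefect_zero (g : MvPowerSeries τ K) : twistDefect sK l 0 g = 0 := by
  simp [twistDefect, twist_zero]

-- For `j ≥ 1` the defect in degree `n` depends only on the part of `g` in degrees below `n`: taking
-- `2^j`-th powers multiplies the difference by a series without constant term, and twisting
-- multiplies its order by `2^j`. This drives the induction on degrees in `exists_map_eq`.
omit H in
theorem coeff_twistDefect_congr {j : ℕ} (hj : j ≠ 0) {f g : MvPowerSeries τ K}
    (hf : MvPowerSeries.constantCoeff f = 0) (hg : MvPowerSeries.constantCoeff g = 0)
    {n : ℕ} (hn : 1 ≤ n) (h : (n : ℕ∞) ≤ (f - g).order) {e : τ →₀ ℕ} (he : e.degree ≤ n) :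
    MvPowerSeries.coeff e (twistDefect sK l j f) =
      MvPowerSeries.coeff e (twistDefect sK l j g) := by
  have hpow : ∀ {f : MvPowerSeries τ K}, MvPowerSeries.constantCoeff f = 0 →
      MvPowerSeries.constantCoeff (f ^ 2 ^ j) = 0 := fun hf => by
    rw [map_pow, hf, zero_pow (pow_ne_zero _ two_ne_zero)]
  have htw : ∀ {f : MvPowerSeries τ K}, MvPowerSeries.constantCoeff f = 0 →
      MvPowerSeries.constantCoeff (twist sK j f) = 0 := fun hf => by
    rw [constantCoeff_twist, hf, map_zero]
  have he' : (e.degree : ℕ∞) < ((n + 1 : ℕ) : ℕ∞) := by exact_mod_cast Nat.lt_succ_of_le he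
  rw [twistDefect, twistDefect, map_sub, map_sub]
  congr 1
  · refine coeff_subst_twoTypicalSeries_congr _ (hpow hf) (hpow hg) (n := (n + 1 : ℕ)) ?_ he'
    rw [← Nat.sub_add_cancel (Nat.one_le_pow j 2 two_pos)]
    obtain ⟨m, hm⟩ : ∃ m, 2 ^ j - 1 = m + 1 := by
      have : 2 ^ 1 ≤ 2 ^ j := Nat.pow_le_pow_right two_pos (by omega)
      exact ⟨2 ^ j - 2, by omega⟩
    have hsplit : f ^ (2 ^ j - 1 + 1) - g ^ (2 ^ j - 1 + 1) =
        (f - g) * f ^ (2 ^ j - 1) + g * (f ^ (2 ^ j - 1) - g ^ (2 ^ j - 1)) := by ring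
    rw [hsplit]
    refine le_trans (le_min ?_ ?_) MvPowerSeries.min_order_le_add
    · refine le_trans ?_ MvPowerSeries.le_order_mul
      push_cast
      refine add_le_add h ?_
      rw [MvPowerSeries.one_le_order_iff_constCoeff_eq_zero, map_pow, hf, hm,
        zero_pow (Nat.succ_ne_zero m)]
    · refine le_trans ?_ MvPowerSeries.le_order_mul
      push_cast
      rw [add_comm]
      exact add_le_add (MvPowerSeries.one_le_order_iff_constCoeff_eq_zero.mpr hg)
        (le_order_pow_sub_pow h _)
  · refine coeff_subst_twoTypicalSeries_congr _ (htw hf) (htw hg) (n := (n + 1 : ℕ)) ?_ he'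
    rw [← map_sub]
    refine le_trans ?_ (le_order_twist sK j _)
    refine le_trans ?_ (nsmul_le_nsmul_right h _)
    rw [nsmul_eq_mul]
    have : 2 ^ 1 ≤ 2 ^ j := Nat.pow_le_pow_right two_pos (by omega)
    have : n + 1 ≤ 2 ^ j * n := by nlinarith
    exact_mod_cast this

omit H in
theorem coeff_twistDefect_of_lt {j : ℕ} {g : MvPowerSeries τ K}
    (hg : MvPowerSeries.constantCoeff g = 0) {e : τ →₀ ℕ} (he : e.degree < 2 ^ j) :
    MvPowerSeries.coeff e (twistDefect sK l j g) = 0 := by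
  have h1 : ((2 ^ j : ℕ) : ℕ∞) ≤ (g ^ 2 ^ j).order :=
    MvPowerSeries.le_order_pow_of_constantCoeff_eq_zero _ hg
  have h2 : ((2 ^ j : ℕ) : ℕ∞) ≤ (twist sK j g).order := by
    refine le_trans ?_ (le_order_twist sK j g)
    rw [nsmul_eq_mul]
    exact le_mul_of_one_le_right (by positivity)
      (MvPowerSeries.one_le_order_iff_constCoeff_eq_zero.mpr hg)
  have h3 : ((2 ^ j : ℕ) : ℕ∞) ≤ (g ^ 2 ^ j - twist sK j g).order := by
    rw [sub_eq_add_neg]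
    refine le_trans (le_min h1 ?_) MvPowerSeries.min_order_le_add
    rwa [MvPowerSeries.order_neg]
  rw [twistDefect, map_sub, sub_eq_zero]
  refine coeff_subst_twoTypicalSeries_congr _ ?_ ?_ h3 (by exact_mod_cast he)
  · rw [map_pow, hg, zero_pow (pow_ne_zero _ two_ne_zero)]
  · rw [constantCoeff_twist, hg, map_zero]

omit H in
theorem coeff_subst_of_degree_eq {f : MvPowerSeries τ K} {n : ℕ} (hn : n ≠ 0)
    (hf : (n : ℕ∞) ≤ f.order) (l : ℕ → K) {e : τ →₀ ℕ} (he : e.degree = n) :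
    MvPowerSeries.coeff e (PowerSeries.subst f (twoTypicalSeries l)) =
      l 0 * MvPowerSeries.coeff e f := by
  have hf0 : MvPowerSeries.constantCoeff f = 0 := by
    rw [← MvPowerSeries.one_le_order_iff_constCoeff_eq_zero]
    exact le_trans (by exact_mod_cast Nat.one_le_iff_ne_zero.mpr hn) hf
  rw [coeff_subst_twoTypicalSeries l hf0
    (lt_of_lt_of_le Nat.lt_two_pow_self (Nat.pow_le_pow_right two_pos (Nat.le_succ e.degree))),
    Finset.sum_range_succ', Finset.sum_eq_zero, zero_add, pow_zero, pow_one]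
  intro k _
  rw [MvPowerSeries.coeff_of_lt_order, mul_zero]
  refine lt_of_lt_of_le ?_ ((nsmul_le_nsmul_right hf _).trans (MvPowerSeries.le_order_pow _))
  rw [nsmul_eq_mul, he]
  have h1 : 2 ^ 1 ≤ 2 ^ (k + 1) := Nat.pow_le_pow_right two_pos (by omega)
  have : n < 2 ^ (k + 1) * n := by
    have := Nat.pos_of_ne_zero hn
    nlinarith
  exact_mod_cast this

/-- Both substituted series have order at least `2^j`, so in degree `2^j` only the linear term of
the logarithm counts. -/
theorem coeff_two_pow_twistDefect (j : ℕ) {g : PowerSeries K}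
    (hg : PowerSeries.constantCoeff g = 0) :
    PowerSeries.coeff (2 ^ j) (twistDefect sK l j g) =
      PowerSeries.coeff 1 g ^ 2 ^ j - (sK ^ j) (PowerSeries.coeff 1 g) := by
  have hdeg : (Finsupp.single () (2 ^ j)).degree = 2 ^ j := by simp
  have h1 : ((2 ^ j : ℕ) : ℕ∞) ≤ MvPowerSeries.order (g ^ 2 ^ j) :=
    MvPowerSeries.le_order_pow_of_constantCoeff_eq_zero _ hg
  have h2 : ((2 ^ j : ℕ) : ℕ∞) ≤ (twist sK j g).order := by
    refine le_trans ?_ (le_order_twist sK j g)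
    rw [nsmul_eq_mul]
    exact le_mul_of_one_le_right (by positivity)
      (MvPowerSeries.one_le_order_iff_constCoeff_eq_zero.mpr hg)
  rw [PowerSeries.coeff, twistDefect, map_sub,
    coeff_subst_of_degree_eq (pow_ne_zero _ two_ne_zero) h1 _ hdeg,
    coeff_subst_of_degree_eq (pow_ne_zero _ two_ne_zero) h2 _ hdeg, H.l_zero, map_one, one_mul,
    one_mul]
  congr 1
  · obtain ⟨c, rfl⟩ := PowerSeries.X_dvd_iff.mpr hg
    have := PowerSeries.coeff_X_pow_mul (c ^ 2 ^ j) (2 ^ j) 0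
    rw [zero_add] at this
    rw [mul_pow]
    refine this.trans ?_
    have := PowerSeries.coeff_succ_X_mul 0 c
    rw [zero_add] at this
    rw [this, PowerSeries.coeff_zero_eq_constantCoeff_apply,
      PowerSeries.coeff_zero_eq_constantCoeff_apply, map_pow]
  · have : (Finsupp.single () (2 ^ j) : Unit →₀ ℕ) = 2 ^ j • Finsupp.single () 1 := by simp
    rw [this, twist_apply, MvPowerSeries.coeff_expand_smul, MvPowerSeries.coeff_map]
    rfl

/-- The functional equation lemma: a power series whose logarithm satisfies the functional equation
up to elements of `2 S` has coefficients in `S`. -/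
theorem exists_map_eq {g : MvPowerSeries τ K} (hg : MvPowerSeries.constantCoeff g = 0)
    (h : ∀ (e : τ →₀ ℕ) (M : ℕ), e.degree < 2 ^ M → ∃ c : S, ∑ j ∈ Finset.range M,
      i (u j) * MvPowerSeries.coeff e (twist sK j (PowerSeries.subst g (twoTypicalSeries l))) =
        2 * i c) :
    ∃ g₀ : MvPowerSeries τ S, MvPowerSeries.map i g₀ = g := by
  classical
  have key : ∀ n, ∀ e : τ →₀ ℕ, e.degree = n → ∃ c : S, MvPowerSeries.coeff e g = i c := by
    intro n
    induction n using Nat.strong_induction_on with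
    | _ n ih =>
      intro e he
      rcases Nat.eq_zero_or_pos n with rfl | hn
      · refine ⟨0, ?_⟩
        rw [(Finsupp.degree_eq_zero_iff e).mp he, MvPowerSeries.coeff_zero_eq_constantCoeff_apply,
          hg, map_zero]
      have ih' : ∀ d : τ →₀ ℕ, ∃ c : S, d.degree < n → MvPowerSeries.coeff d g = i c := by
        intro d
        by_cases hd : d.degree < n
        · obtain ⟨c, hc⟩ := ih _ hd d rfl
          exact ⟨c, fun _ => hc⟩
        · exact ⟨0, fun h => absurd h hd⟩
      choose c hc using ih'
      -- `G` is the integral truncation of `g` below degree `n`. In degree `n` the defects of `g`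
      -- and of `G` agree, so the defect of `g` is `2` times an integral element there.
      let G : MvPowerSeries τ S := ofCoeff fun d => if d.degree < n then c d else 0
      have hcoeff : ∀ d, MvPowerSeries.coeff d G = if d.degree < n then c d else 0 := fun d => rfl
      have hord : (n : ℕ∞) ≤ (g - MvPowerSeries.map i G).order := by
        refine MvPowerSeries.nat_le_order fun d hd => ?_
        rw [map_sub, MvPowerSeries.coeff_map, hcoeff, if_pos hd, hc d hd, sub_self]
      have hG : MvPowerSeries.constantCoeff G = 0 := by
        apply H.injective
        rw [map_zero, ← MvPowerSeries.coeff_zero_eq_constantCoeff_apply, hcoeff,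
          if_pos (by simpa using hn), ← hc 0 (by simpa using hn),
          MvPowerSeries.coeff_zero_eq_constantCoeff_apply, hg]
      have hG' : MvPowerSeries.constantCoeff (MvPowerSeries.map i G) = 0 := by
        rw [MvPowerSeries.constantCoeff_map, hG, map_zero]
      have hM : e.degree < 2 ^ e.degree := Nat.lt_two_pow_self
      have h1 := H.two_mul_coeff hg hM
      obtain ⟨a, ha⟩ := h e _ hM
      have hb : ∀ j, ∃ b : S, MvPowerSeries.coeff e (twistDefect sK l j g) = 2 * i b := by
        intro j
        rcases eq_or_ne j 0 with rfl | hj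
        · exact ⟨0, by simp [twistDefect_zero]⟩
        · rw [coeff_twistDefect_congr hj hg hG' hn hord he.le]
          exact H.exists_coeff_twistDefect_eq j hG e
      choose b hb using hb
      refine ⟨a + ∑ j ∈ Finset.range e.degree, u j * b j, ?_⟩
      apply H.isUnit_two.mul_left_cancel
      rw [h1, ha, map_add, map_sum, mul_add, Finset.mul_sum]
      congr 1
      refine Finset.sum_congr rfl fun j _ => ?_
      rw [hb, map_mul]
      ring
  have key' : ∀ e : τ →₀ ℕ, ∃ c : S, MvPowerSeries.coeff e g = i c := fun e => key _ e rfl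
  choose c hc using key'
  refine ⟨ofCoeff c, ?_⟩
  ext e
  rw [MvPowerSeries.coeff_map, hc, coeff_ofCoeff]

end IsFunctionalEquation

/-! ### Logarithms of formal group laws and strict isomorphisms. -/

section Logarithms

variable {τ : Type*} {S K : Type*} [CommRing S] [CommRing K]

theorem hasSubst_pair {a b : MvPowerSeries τ K} (ha : MvPowerSeries.constantCoeff a = 0)
    (hb : MvPowerSeries.constantCoeff b = 0) : MvPowerSeries.HasSubst ![a, b] :=
  MvPowerSeries.hasSubst_of_constantCoeff_zero fun s => by fin_cases s <;> simpa

theorem constantCoeff_formalGroup_subst (F : FormalGroup K) {a b : MvPowerSeries τ K}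
    (ha : MvPowerSeries.constantCoeff a = 0) (hb : MvPowerSeries.constantCoeff b = 0) :
    MvPowerSeries.constantCoeff (F.toPowerSeries.subst ![a, b]) = 0 :=
  MvPowerSeries.constantCoeff_subst_eq_zero (hasSubst_pair ha hb)
    (fun s => by fin_cases s <;> simpa) F.zero_constantCoeff

theorem map_formalGroup_subst (F : FormalGroup S) (i : S →+* K) {a b : MvPowerSeries τ S}
    (ha : MvPowerSeries.constantCoeff a = 0) (hb : MvPowerSeries.constantCoeff b = 0) :
    MvPowerSeries.map i (F.toPowerSeries.subst ![a, b]) =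
      (F.map i).toPowerSeries.subst ![MvPowerSeries.map i a, MvPowerSeries.map i b] := by
  rw [MvPowerSeries.map_subst (hasSubst_pair ha hb)]
  congr 1
  ext1 s
  fin_cases s <;> rfl

/-- `L(x) = x + ⋯` is a logarithm of `G`. -/
structure IsLog (G : FormalGroup K) (L : PowerSeries K) : Prop where
  constantCoeff_eq : PowerSeries.constantCoeff L = 0
  coeff_one_eq : PowerSeries.coeff 1 L = 1
  map_add : PowerSeries.subst G.toPowerSeries L =
    PowerSeries.subst (MvPowerSeries.X 0 : MvPowerSeries (Fin 2) K) L +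
      PowerSeries.subst (MvPowerSeries.X 1 : MvPowerSeries (Fin 2) K) L

theorem constantCoeff_subst_zero {a : MvPowerSeries τ K} (ha : MvPowerSeries.constantCoeff a = 0)
    {L : PowerSeries K} (hL : PowerSeries.constantCoeff L = 0) :
    MvPowerSeries.constantCoeff (PowerSeries.subst a L) = 0 :=
  PowerSeries.constantCoeff_subst_eq_zero ha _ hL

theorem subst_pair_add {a b : MvPowerSeries τ K} (ha : MvPowerSeries.constantCoeff a = 0)
    (hb : MvPowerSeries.constantCoeff b = 0) :
    MvPowerSeries.subst ![a, b]
      (MvPowerSeries.X 0 + MvPowerSeries.X 1 : MvPowerSeries (Fin 2) K) = a + b := by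
  rw [MvPowerSeries.subst_add (hasSubst_pair ha hb), MvPowerSeries.subst_X (hasSubst_pair ha hb),
    MvPowerSeries.subst_X (hasSubst_pair ha hb)]
  rfl

theorem subst_pair_subst_X {a b : MvPowerSeries τ K} (ha : MvPowerSeries.constantCoeff a = 0)
    (hb : MvPowerSeries.constantCoeff b = 0) (L : PowerSeries K) (k : Fin 2) :
    MvPowerSeries.subst ![a, b]
      (PowerSeries.subst (MvPowerSeries.X k : MvPowerSeries (Fin 2) K) L) =
      PowerSeries.subst (![a, b] k) L := by
  rw [PowerSeries.subst, MvPowerSeries.subst_comp_subst_apply (PowerSeries.HasSubst.X k).const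
    (hasSubst_pair ha hb), PowerSeries.subst]
  congr 1
  ext1 _
  rw [MvPowerSeries.subst_X (hasSubst_pair ha hb)]

theorem subst_formalGroup_subst (G : FormalGroup K) (L : PowerSeries K)
    {a b : MvPowerSeries τ K} (ha : MvPowerSeries.constantCoeff a = 0)
    (hb : MvPowerSeries.constantCoeff b = 0) :
    PowerSeries.subst (G.toPowerSeries.subst ![a, b]) L =
      MvPowerSeries.subst ![a, b] (PowerSeries.subst G.toPowerSeries L) := by
  rw [PowerSeries.subst, PowerSeries.subst, MvPowerSeries.subst_comp_subst_apply
    (PowerSeries.HasSubst.of_constantCoeff_zero G.zero_constantCoeff).const (hasSubst_pair ha hb)]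

theorem IsLog.subst_eq {G : FormalGroup K} {L : PowerSeries K} (h : IsLog G L)
    {a b : MvPowerSeries τ K} (ha : MvPowerSeries.constantCoeff a = 0)
    (hb : MvPowerSeries.constantCoeff b = 0) :
    PowerSeries.subst (G.toPowerSeries.subst ![a, b]) L =
      PowerSeries.subst a L + PowerSeries.subst b L := by
  rw [subst_formalGroup_subst G L ha hb, h.map_add, MvPowerSeries.subst_add (hasSubst_pair ha hb),
    subst_pair_subst_X ha hb, subst_pair_subst_X ha hb]
  rfl

theorem subst_subst_eq {a : MvPowerSeries τ K} (ha : MvPowerSeries.constantCoeff a = 0)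
    {E : PowerSeries K} (hE : PowerSeries.constantCoeff E = 0) (L : PowerSeries K) :
    PowerSeries.subst (PowerSeries.subst a E) L = PowerSeries.subst a (PowerSeries.subst E L) :=
  (PowerSeries.subst_comp_subst_apply (PowerSeries.HasSubst.of_constantCoeff_zero hE)
    (PowerSeries.HasSubst.of_constantCoeff_zero ha) L).symm

/-- A power series `x + ⋯` has a compositional inverse. -/
theorem exists_comp_inverse {L : PowerSeries K} (h0 : PowerSeries.constantCoeff L = 0)
    (h1 : PowerSeries.coeff 1 L = 1) :
    ∃ E : PowerSeries K, PowerSeries.constantCoeff E = 0 ∧ PowerSeries.coeff 1 E = 1 ∧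
      PowerSeries.subst E L = PowerSeries.X ∧ PowerSeries.subst L E = PowerSeries.X := by
  have hu : IsUnit (PowerSeries.coeff 1 L) := h1 ▸ isUnit_one
  refine ⟨PowerSeries.substInvOfIsUnit L hu, PowerSeries.constantCoeff_substInvOfIsUnit L hu, ?_,
    PowerSeries.subst_substInvOfIsUnit_right L h0 hu,
    PowerSeries.subst_substInvOfIsUnit_left L h0 hu⟩
  rw [PowerSeries.coeff_one_substInvOfIsUnit, show hu.unit = 1 from Units.ext h1]
  simp

theorem subst_inverse {L E : PowerSeries K} (h0 : PowerSeries.constantCoeff L = 0)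
    (h : PowerSeries.subst L E = PowerSeries.X) {a : MvPowerSeries τ K}
    (ha : MvPowerSeries.constantCoeff a = 0) :
    PowerSeries.subst (PowerSeries.subst a L) E = a := by
  rw [subst_subst_eq ha h0, h, PowerSeries.subst_X (PowerSeries.HasSubst.of_constantCoeff_zero ha)]

theorem subst_injective {L : PowerSeries K} (h0 : PowerSeries.constantCoeff L = 0)
    (h1 : PowerSeries.coeff 1 L = 1) {a b : MvPowerSeries τ K}
    (ha : MvPowerSeries.constantCoeff a = 0) (hb : MvPowerSeries.constantCoeff b = 0)
    (h : PowerSeries.subst a L = PowerSeries.subst b L) : a = b := by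
  obtain ⟨E, -, -, -, hE⟩ := exists_comp_inverse h0 h1
  rw [← subst_inverse h0 hE ha, h, subst_inverse h0 hE hb]

theorem map_injective {i : S →+* K} (hi : Function.Injective i) :
    Function.Injective (MvPowerSeries.map (σ := τ) i) := by
  intro a b h
  ext e
  apply hi
  rw [← MvPowerSeries.coeff_map, h, MvPowerSeries.coeff_map]

theorem eq_of_isLog {F G : FormalGroup K} {L : PowerSeries K} (hF : IsLog F L)
    (hG : IsLog G L) : F = G := by
  apply FormalGroup.ext
  exact subst_injective hF.constantCoeff_eq hF.coeff_one_eq F.zero_constantCoeff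
    G.zero_constantCoeff (hF.map_add.trans hG.map_add.symm)

theorem formalGroup_map_injective {i : S →+* K} (hi : Function.Injective i) :
    Function.Injective (fun F : FormalGroup S => F.map i) := by
  intro F G h
  apply FormalGroup.ext
  exact map_injective hi (congrArg FormalGroup.toPowerSeries h)

/-- For logarithms `L` and `L'`, the series `A = L' ∘ L⁻¹` is additive and starts with `x`. Over a
`ℚ`-algebra this forces `A = x`. -/
theorem isLog_unique [Algebra ℚ K] {G : FormalGroup K} {L L' : PowerSeries K} (h : IsLog G L)
    (h' : IsLog G L') : L' = L := by
  obtain ⟨E, hE0, hE1, hLE, hEL⟩ := exists_comp_inverse h.constantCoeff_eq h.coeff_one_eq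
  have hX : ∀ k : Fin 2, MvPowerSeries.constantCoeff
      (PowerSeries.subst (MvPowerSeries.X k : MvPowerSeries (Fin 2) K) E) = 0 := fun k =>
    constantCoeff_subst_zero (MvPowerSeries.constantCoeff_X k) hE0
  have hXX : MvPowerSeries.constantCoeff
      (MvPowerSeries.X 0 + MvPowerSeries.X 1 : MvPowerSeries (Fin 2) K) = 0 := by simp
  have hLX : ∀ k : Fin 2, PowerSeries.subst
      (PowerSeries.subst (MvPowerSeries.X k : MvPowerSeries (Fin 2) K) E) L =
      MvPowerSeries.X k := fun k =>
    subst_inverse hE0 hLE (MvPowerSeries.constantCoeff_X k)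
  have hG : G.toPowerSeries.subst
      ![PowerSeries.subst (MvPowerSeries.X 0 : MvPowerSeries (Fin 2) K) E,
        PowerSeries.subst (MvPowerSeries.X 1 : MvPowerSeries (Fin 2) K) E] =
      PowerSeries.subst (MvPowerSeries.X 0 + MvPowerSeries.X 1 : MvPowerSeries (Fin 2) K) E := by
    apply subst_injective h.constantCoeff_eq h.coeff_one_eq
      (constantCoeff_formalGroup_subst G (hX 0) (hX 1)) (constantCoeff_subst_zero hXX hE0)
    rw [h.subst_eq (hX 0) (hX 1), hLX, hLX, subst_inverse hE0 hLE hXX]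
  set A := PowerSeries.subst E L' with hA
  have hadd : PowerSeries.subst (MvPowerSeries.X 0 + MvPowerSeries.X 1 : MvPowerSeries (Fin 2) K) A
      = PowerSeries.subst (MvPowerSeries.X 0 : MvPowerSeries (Fin 2) K) A +
        PowerSeries.subst (MvPowerSeries.X 1 : MvPowerSeries (Fin 2) K) A := by
    rw [hA, ← subst_subst_eq hXX hE0, ← hG, h'.subst_eq (hX 0) (hX 1),
      subst_subst_eq (MvPowerSeries.constantCoeff_X 0) hE0,
      subst_subst_eq (MvPowerSeries.constantCoeff_X 1) hE0]
  have hA0 : PowerSeries.constantCoeff A = 0 := constantCoeff_subst_zero hE0 h'.constantCoeff_eq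
  have hAX : A = PowerSeries.X := by
    ext d
    rcases d with _ | _ | d
    · simpa using hA0
    · rw [hA, PowerSeries.coeff_subst' (PowerSeries.HasSubst.of_constantCoeff_zero hE0),
        finsum_eq_single _ 1]
      · simp [h'.coeff_one_eq, hE1]
      · intro n hn
        obtain ⟨c, rfl⟩ := PowerSeries.X_dvd_iff.mpr hE0
        rcases n with _ | _ | n
        · simp [h'.constantCoeff_eq]
        · exact absurd rfl hn
        · rw [mul_pow, PowerSeries.coeff_X_pow_mul', if_neg (by omega), smul_zero]
    -- Comparing coefficients of `x^(d+1) y` in `A(x + y) = A(x) + A(y)` gives `(d + 2) a_{d+2} =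
    -- 0`.
    · have := congrArg (MvPowerSeries.coeff
        (Finsupp.single 0 (d + 1) + Finsupp.single 1 1 : Fin 2 →₀ ℕ)) hadd
      rw [PowerSeries.coeff_subst_X_zero_add_X_one, map_add, PowerSeries.coeff_subst_single,
        PowerSeries.coeff_subst_single, if_neg, if_neg] at this
      · simp only [Finsupp.add_apply, Finsupp.single_apply] at this
        norm_num at this
        rw [PowerSeries.coeff_X, if_neg (by omega)]
        have hu : IsUnit ((d : K) + 1 + 1) := by
          have := (IsUnit.mk0 ((d : ℚ) + 1 + 1) (by positivity)).map (algebraMap ℚ K)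
          simpa using this
        exact hu.mul_right_eq_zero.mp this
      · intro h
        have := DFunLike.congr_fun h 0
        simp at this
      · intro h
        have := DFunLike.congr_fun h 1
        simp at this
  have : PowerSeries.subst L A = L' := by
    rw [hA, ← subst_subst_eq h.constantCoeff_eq hE0, hEL, PowerSeries.X_subst]
  rw [← this, hAX, PowerSeries.subst_X (PowerSeries.HasSubst.of_constantCoeff_zero'
    h.constantCoeff_eq)]

theorem IsLog.map {G : FormalGroup S} {L : PowerSeries S} (h : IsLog G L) (j : S →+* K) :
    IsLog (G.map j) (PowerSeries.map j L) where
  constantCoeff_eq := by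
    rw [← PowerSeries.coeff_zero_eq_constantCoeff_apply, PowerSeries.coeff_map,
      PowerSeries.coeff_zero_eq_constantCoeff_apply, h.constantCoeff_eq, map_zero]
  coeff_one_eq := by rw [PowerSeries.coeff_map, h.coeff_one_eq, map_one]
  map_add := by
    have := congrArg (MvPowerSeries.map j) h.map_add
    rw [_root_.map_add, PowerSeries.map_subst (PowerSeries.HasSubst.of_constantCoeff_zero
      G.zero_constantCoeff), PowerSeries.map_subst (PowerSeries.HasSubst.X 0),
      PowerSeries.map_subst (PowerSeries.HasSubst.X 1), MvPowerSeries.map_X,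
      MvPowerSeries.map_X] at this
    exact this

theorem isStrictIso_additive_iff {G : FormalGroup K} {L : PowerSeries K} :
    IsStrictIso G FormalGroup.𝔾ₐ L ↔ IsLog G L := by
  have : ∀ L : PowerSeries K, PowerSeries.constantCoeff L = 0 → MvPowerSeries.subst
      ![PowerSeries.subst (MvPowerSeries.X 0 : MvPowerSeries (Fin 2) K) L,
        PowerSeries.subst (MvPowerSeries.X 1 : MvPowerSeries (Fin 2) K) L]
      (FormalGroup.𝔾ₐ (R := K)).toPowerSeries =
      PowerSeries.subst (MvPowerSeries.X 0 : MvPowerSeries (Fin 2) K) L +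
      PowerSeries.subst (MvPowerSeries.X 1 : MvPowerSeries (Fin 2) K) L := fun L hL =>
    subst_pair_add (constantCoeff_subst_zero (MvPowerSeries.constantCoeff_X 0) hL)
      (constantCoeff_subst_zero (MvPowerSeries.constantCoeff_X 1) hL)
  exact ⟨fun h => ⟨h.1, h.2, h.3.trans (this L h.1)⟩, fun h => ⟨h.1, h.2, h.3.trans (this L h.1).symm⟩⟩

theorem IsStrictIso.map {F G : FormalGroup S} {ψ : PowerSeries S} (h : IsStrictIso F G ψ)
    (j : S →+* K) : IsStrictIso (F.map j) (G.map j) (PowerSeries.map j ψ) where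
  constantCoeff_eq := by
    rw [← PowerSeries.coeff_zero_eq_constantCoeff_apply, PowerSeries.coeff_map,
      PowerSeries.coeff_zero_eq_constantCoeff_apply, h.constantCoeff_eq, map_zero]
  coeff_one_eq := by rw [PowerSeries.coeff_map, h.coeff_one_eq, map_one]
  map_add := by
    have := congrArg (MvPowerSeries.map j) h.map_add
    rw [PowerSeries.map_subst (PowerSeries.HasSubst.of_constantCoeff_zero
      F.zero_constantCoeff), map_formalGroup_subst G j
        (constantCoeff_subst_zero (MvPowerSeries.constantCoeff_X 0) h.constantCoeff_eq)
        (constantCoeff_subst_zero (MvPowerSeries.constantCoeff_X 1) h.constantCoeff_eq),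
      PowerSeries.map_subst (PowerSeries.HasSubst.X 0),
      PowerSeries.map_subst (PowerSeries.HasSubst.X 1), MvPowerSeries.map_X,
      MvPowerSeries.map_X] at this
    exact this

/-- A strict isomorphism pulls back logarithms. -/
theorem IsStrictIso.isLog_subst {F G : FormalGroup K} {ψ L : PowerSeries K}
    (h : IsStrictIso F G ψ) (hL : IsLog G L) : IsLog F (PowerSeries.subst ψ L) where
  constantCoeff_eq := constantCoeff_subst_zero h.constantCoeff_eq hL.constantCoeff_eq
  coeff_one_eq := by
    rw [PowerSeries.coeff_subst' (PowerSeries.HasSubst.of_constantCoeff_zero h.constantCoeff_eq),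
        finsum_eq_single _ 1]
    · simp [h.coeff_one_eq, hL.coeff_one_eq]
    · intro n hn
      obtain ⟨c, rfl⟩ := PowerSeries.X_dvd_iff.mpr h.constantCoeff_eq
      rcases n with _ | _ | n
      · simp [hL.constantCoeff_eq]
      · exact absurd rfl hn
      · rw [mul_pow, PowerSeries.coeff_X_pow_mul', if_neg (by omega), smul_zero]
  map_add := by
    rw [← subst_subst_eq F.zero_constantCoeff h.constantCoeff_eq, h.map_add, hL.subst_eq
        (constantCoeff_subst_zero (MvPowerSeries.constantCoeff_X 0) h.constantCoeff_eq)
        (constantCoeff_subst_zero (MvPowerSeries.constantCoeff_X 1) h.constantCoeff_eq),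
      subst_subst_eq (MvPowerSeries.constantCoeff_X 0) h.constantCoeff_eq,
      subst_subst_eq (MvPowerSeries.constantCoeff_X 1) h.constantCoeff_eq]

/-- Logarithms are injective under substitution, so additivity of `ψ` may be checked after applying
`L'`, where both sides become `L(x) + L(y)`. -/
theorem isStrictIso_of_isLog {F G : FormalGroup K} {ψ L L' : PowerSeries K}
    (h0 : PowerSeries.constantCoeff ψ = 0) (h1 : PowerSeries.coeff 1 ψ = 1)
    (hF : IsLog F L) (hG : IsLog G L') (h : PowerSeries.subst ψ L' = L) :
    IsStrictIso F G ψ where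
  constantCoeff_eq := h0
  coeff_one_eq := h1
  map_add := by
    have hX := fun k : Fin 2 => constantCoeff_subst_zero
      (MvPowerSeries.constantCoeff_X (R := K) k) h0
    apply subst_injective hG.constantCoeff_eq hG.coeff_one_eq
      (constantCoeff_subst_zero F.zero_constantCoeff h0)
      (constantCoeff_formalGroup_subst G (hX 0) (hX 1))
    rw [subst_subst_eq F.zero_constantCoeff h0, h, hF.map_add, hG.subst_eq (hX 0) (hX 1),
      subst_subst_eq (MvPowerSeries.constantCoeff_X 0) h0,
      subst_subst_eq (MvPowerSeries.constantCoeff_X 1) h0, h]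

theorem IsStrictIso.of_map {F G : FormalGroup S} {ψ : PowerSeries S} {j : S →+* K}
    (hj : Function.Injective j) (h : IsStrictIso (F.map j) (G.map j) (PowerSeries.map j ψ)) :
    IsStrictIso F G ψ := by
  have h0 : PowerSeries.constantCoeff ψ = 0 := by
    apply hj
    rw [map_zero, ← h.constantCoeff_eq, ← PowerSeries.coeff_zero_eq_constantCoeff_apply,
      ← PowerSeries.coeff_zero_eq_constantCoeff_apply, PowerSeries.coeff_map]
  refine ⟨h0, ?_, ?_⟩
  · apply hj
    rw [map_one, ← h.coeff_one_eq, PowerSeries.coeff_map]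
  · apply map_injective hj
    have := h.map_add
    rw [PowerSeries.map_subst (PowerSeries.HasSubst.of_constantCoeff_zero
      F.zero_constantCoeff), map_formalGroup_subst G j
        (constantCoeff_subst_zero (MvPowerSeries.constantCoeff_X 0) h0)
        (constantCoeff_subst_zero (MvPowerSeries.constantCoeff_X 1) h0),
      PowerSeries.map_subst (PowerSeries.HasSubst.X 0),
      PowerSeries.map_subst (PowerSeries.HasSubst.X 1), MvPowerSeries.map_X,
      MvPowerSeries.map_X]
    exact this

theorem subst_neg_subst_neg (L : PowerSeries K) {a : MvPowerSeries τ K}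
    (ha : MvPowerSeries.constantCoeff a = 0) :
    PowerSeries.subst a (-PowerSeries.subst (-PowerSeries.X : PowerSeries K) L) =
      -PowerSeries.subst (-a) L := by
  have hX0 : PowerSeries.constantCoeff (-PowerSeries.X : PowerSeries K) = 0 := by simp
  have ha' := PowerSeries.HasSubst.of_constantCoeff_zero ha
  rw [← PowerSeries.coe_substAlgHom ha', map_neg, PowerSeries.coe_substAlgHom ha',
    ← subst_subst_eq ha hX0, ← PowerSeries.coe_substAlgHom ha', map_neg,
    PowerSeries.coe_substAlgHom ha', PowerSeries.subst_X ha']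

/-- The conjugate `-F(-x, -y)` of a formal group law with logarithm `L` has logarithm
`-L(-x)`. -/
theorem isLog_conj {F G : FormalGroup K} {L : PowerSeries K} (hL : IsLog F L)
    (h : G.toPowerSeries = -MvPowerSeries.subst ![-MvPowerSeries.X 0, -MvPowerSeries.X 1]
      F.toPowerSeries) :
    IsLog G (-PowerSeries.subst (-PowerSeries.X : PowerSeries K) L) := by
  have hX0 : PowerSeries.constantCoeff (-PowerSeries.X : PowerSeries K) = 0 := by simp
  have hX := fun k : Fin 2 => show MvPowerSeries.constantCoeff
    (-MvPowerSeries.X k : MvPowerSeries (Fin 2) K) = 0 by simp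
  refine ⟨?_, ?_, ?_⟩
  · rw [map_neg, neg_eq_zero]
    exact constantCoeff_subst_zero hX0 hL.constantCoeff_eq
  · rw [map_neg, PowerSeries.coeff_subst' (PowerSeries.HasSubst.of_constantCoeff_zero hX0),
      finsum_eq_single _ 1]
    · simp [hL.coeff_one_eq]
    · intro n hn
      rw [neg_pow, ← map_one (PowerSeries.C (R := K)), ← map_neg, ← map_pow,
        PowerSeries.coeff_C_mul, PowerSeries.coeff_X_pow, if_neg (Ne.symm hn), mul_zero, smul_zero]
  · rw [subst_neg_subst_neg L G.zero_constantCoeff,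
      subst_neg_subst_neg L (MvPowerSeries.constantCoeff_X 0),
      subst_neg_subst_neg L (MvPowerSeries.constantCoeff_X 1), h, neg_neg,
      hL.subst_eq (hX 0) (hX 1), neg_add]

/-- A formal group law with logarithm `-L(-x)` is the conjugate `-F(-x, -y)` of the formal group
law with logarithm `L`. -/
theorem conj_of_isLog {F G : FormalGroup K} {L : PowerSeries K} (hL : IsLog F L)
    (h : IsLog G (-PowerSeries.subst (-PowerSeries.X : PowerSeries K) L)) :
    G.toPowerSeries = -MvPowerSeries.subst ![-MvPowerSeries.X 0, -MvPowerSeries.X 1]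
      F.toPowerSeries := by
  have hX := fun k : Fin 2 => show MvPowerSeries.constantCoeff
    (-MvPowerSeries.X k : MvPowerSeries (Fin 2) K) = 0 by simp
  have h0 : MvPowerSeries.constantCoeff (-MvPowerSeries.subst
      ![-MvPowerSeries.X 0, -MvPowerSeries.X 1] F.toPowerSeries :
      MvPowerSeries (Fin 2) K) = 0 := by
    rw [map_neg, constantCoeff_formalGroup_subst F (hX 0) (hX 1), neg_zero]
  refine subst_injective h.constantCoeff_eq h.coeff_one_eq G.zero_constantCoeff h0 ?_
  rw [h.map_add, subst_neg_subst_neg L h0, neg_neg, hL.subst_eq (hX 0) (hX 1), neg_add,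
    subst_neg_subst_neg L (MvPowerSeries.constantCoeff_X 0),
    subst_neg_subst_neg L (MvPowerSeries.constantCoeff_X 1)]

end Logarithms

/-! ### The formal group law attached to a functional equation. -/

section Existence

variable {S K : Type*} [CommRing S] [CommRing K] {i : S →+* K} {s : S →+* S} {sK : K →+* K}
  {u : ℕ → S} {l : ℕ → K}

/-- The functional equation lemma produces a commutative formal group law over `S` with
logarithm `∑ ℓ_k x^(2^k)`. -/
theorem IsFunctionalEquation.exists_formalGroup (H : IsFunctionalEquation i s sK u l) :
    ∃ F : FormalGroup S, F.IsComm ∧ IsLog (F.map i) (twoTypicalSeries l) := by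
  set L := twoTypicalSeries l with hL
  have hL0 : PowerSeries.constantCoeff L = 0 := constantCoeff_twoTypicalSeries l
  have hL1 : PowerSeries.coeff 1 L = 1 := by rw [hL, coeff_one_twoTypicalSeries, H.l_zero]
  obtain ⟨E, hE0, hE1, hLE, hEL⟩ := exists_comp_inverse hL0 hL1
  have hLX : ∀ k : Fin 2, MvPowerSeries.constantCoeff
      (PowerSeries.subst (MvPowerSeries.X k : MvPowerSeries (Fin 2) K) L) = 0 := fun k =>
    constantCoeff_subst_zero (MvPowerSeries.constantCoeff_X k) hL0
  set f : MvPowerSeries (Fin 2) K :=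
    PowerSeries.subst (MvPowerSeries.X 0 : MvPowerSeries (Fin 2) K) L +
      PowerSeries.subst (MvPowerSeries.X 1 : MvPowerSeries (Fin 2) K) L with hf
  have hf0 : MvPowerSeries.constantCoeff f = 0 := by rw [hf, map_add, hLX, hLX, add_zero]
  -- The candidate is `L⁻¹(L(x) + L(y))`. Its logarithm is a sum of logarithms of variables, for
  -- which the functional equation holds exactly, so it is integral.
  set g := PowerSeries.subst f E with hg
  have hg0 : MvPowerSeries.constantCoeff g = 0 := constantCoeff_subst_zero hf0 hE0
  have hgL : PowerSeries.subst g L = f := subst_inverse hE0 hLE hf0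
  obtain ⟨g₀, hg₀⟩ := H.exists_map_eq hg0 (by
    intro e M hM
    rw [hgL]
    refine ⟨MvPowerSeries.coeff e (MvPowerSeries.X 0 + MvPowerSeries.X 1), ?_⟩
    simp only [hf, map_add, mul_add, Finset.sum_add_distrib]
    rw [H.sum_coeff_twist_subst_X 0 hM, H.sum_coeff_twist_subst_X 1 hM]
    rw [← MvPowerSeries.coeff_map, ← MvPowerSeries.coeff_map, MvPowerSeries.map_X,
      MvPowerSeries.map_X])
  have hg₀0 : MvPowerSeries.constantCoeff g₀ = 0 := by
    apply H.injective
    rw [← MvPowerSeries.constantCoeff_map, hg₀, hg0, map_zero]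
  have hpair : ∀ {τ : Type} {a b : MvPowerSeries τ K}, MvPowerSeries.constantCoeff a = 0 →
      MvPowerSeries.constantCoeff b = 0 →
      MvPowerSeries.constantCoeff (MvPowerSeries.subst ![a, b] g) = 0 ∧
      PowerSeries.subst (MvPowerSeries.subst ![a, b] g) L =
        PowerSeries.subst a L + PowerSeries.subst b L := by
    intro τ a b ha hb
    refine ⟨MvPowerSeries.constantCoeff_subst_eq_zero (hasSubst_pair ha hb)
      (fun s => by fin_cases s <;> simpa) hg0, ?_⟩
    have : PowerSeries.subst (MvPowerSeries.subst ![a, b] g) L =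
        MvPowerSeries.subst ![a, b] (PowerSeries.subst g L) := by
      rw [PowerSeries.subst, PowerSeries.subst, MvPowerSeries.subst_comp_subst_apply
        (PowerSeries.HasSubst.of_constantCoeff_zero hg0).const (hasSubst_pair ha hb)]
    rw [this, hgL, hf, MvPowerSeries.subst_add (hasSubst_pair ha hb), subst_pair_subst_X ha hb,
      subst_pair_subst_X ha hb]
    rfl
  have hpair₀ : ∀ {τ : Type} {a b : MvPowerSeries τ S}, MvPowerSeries.constantCoeff a = 0 →
      MvPowerSeries.constantCoeff b = 0 →
      MvPowerSeries.constantCoeff (MvPowerSeries.subst ![a, b] g₀) = 0 ∧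
      PowerSeries.subst (MvPowerSeries.map i (MvPowerSeries.subst ![a, b] g₀)) L =
        PowerSeries.subst (MvPowerSeries.map i a) L +
          PowerSeries.subst (MvPowerSeries.map i b) L := by
    intro τ a b ha hb
    refine ⟨MvPowerSeries.constantCoeff_subst_eq_zero (hasSubst_pair ha hb)
      (fun s => by fin_cases s <;> simpa) hg₀0, ?_⟩
    rw [MvPowerSeries.map_subst (hasSubst_pair ha hb), hg₀]
    have hfun : (fun k => MvPowerSeries.map i ((![a, b] : Fin 2 → MvPowerSeries τ S) k)) =
        ![MvPowerSeries.map i a, MvPowerSeries.map i b] := by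
      ext1 k; fin_cases k <;> rfl
    rw [hfun, (hpair (by rw [MvPowerSeries.constantCoeff_map, ha, map_zero])
      (by rw [MvPowerSeries.constantCoeff_map, hb, map_zero])).2]
  -- The axioms of a formal group law are tested in `K` after applying the logarithm, where they
  -- reduce to those of addition.
  have heq : ∀ {τ : Type} {a b : MvPowerSeries τ S}, MvPowerSeries.constantCoeff a = 0 →
      MvPowerSeries.constantCoeff b = 0 →
      PowerSeries.subst (MvPowerSeries.map i a) L = PowerSeries.subst (MvPowerSeries.map i b) L →
      a = b := by
    intro τ a b ha hb h
    apply map_injective H.injective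
    exact subst_injective hL0 hL1 (by rw [MvPowerSeries.constantCoeff_map, ha, map_zero])
      (by rw [MvPowerSeries.constantCoeff_map, hb, map_zero]) h
  have hlin : ∀ k : Fin 2, MvPowerSeries.coeff (Finsupp.single k 1) g₀ = 1 := by
    intro k
    apply H.injective
    have h1 := congrArg (MvPowerSeries.coeff (Finsupp.single k 1)) hgL
    have hdeg : (Finsupp.single k 1 : Fin 2 →₀ ℕ).degree = 1 := by simp
    rw [IsFunctionalEquation.coeff_subst_of_degree_eq one_ne_zero
      (by rw [Nat.cast_one]; exact MvPowerSeries.one_le_order_iff_constCoeff_eq_zero.mpr hg0) _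
      hdeg, H.l_zero, one_mul] at h1
    rw [← MvPowerSeries.coeff_map, hg₀, h1, map_one, hf, map_add, PowerSeries.coeff_subst_single,
      PowerSeries.coeff_subst_single]
    fin_cases k <;> simp [hL1]
  refine ⟨⟨g₀, hg₀0, hlin 0, hlin 1, ?_⟩, ⟨?_⟩, ?_⟩
  · have hX := fun k : Fin 3 => MvPowerSeries.constantCoeff_X (R := S) k
    have h01 := hpair₀ (hX 0) (hX 1)
    have h12 := hpair₀ (hX 1) (hX 2)
    refine heq (hpair₀ h01.1 (hX 2)).1 (hpair₀ (hX 0) h12.1).1 ?_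
    rw [(hpair₀ h01.1 (hX 2)).2, (hpair₀ (hX 0) h12.1).2, h01.2, h12.2, add_assoc]
  · have hX := fun k : Fin 2 => MvPowerSeries.constantCoeff_X (R := S) k
    refine heq hg₀0 (hpair₀ (hX 1) (hX 0)).1 ?_
    rw [(hpair₀ (hX 1) (hX 0)).2, hg₀, hgL, hf, MvPowerSeries.map_X, MvPowerSeries.map_X, add_comm]
  · refine ⟨hL0, hL1, ?_⟩
    change PowerSeries.subst (MvPowerSeries.map i g₀) L = _
    rw [hg₀, hgL]

end Existence

/-! ### Formal sums and their logarithms. -/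

section FormalSums

variable {S K : Type*} [CommRing S] [CommRing K]

theorem constantCoeff_fadd (F : FormalGroup S) {a b : PowerSeries S}
    (ha : PowerSeries.constantCoeff a = 0) (hb : PowerSeries.constantCoeff b = 0) :
    PowerSeries.constantCoeff (fadd F a b) = 0 :=
  constantCoeff_formalGroup_subst F ha hb

theorem constantCoeff_map_zero {a : PowerSeries S} (ha : PowerSeries.constantCoeff a = 0)
    (i : S →+* K) : PowerSeries.constantCoeff (PowerSeries.map i a) = 0 := by
  rw [← PowerSeries.coeff_zero_eq_constantCoeff_apply, PowerSeries.coeff_map,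
    PowerSeries.coeff_zero_eq_constantCoeff_apply, ha, map_zero]

theorem map_fadd (F : FormalGroup S) (i : S →+* K) {a b : PowerSeries S}
    (ha : PowerSeries.constantCoeff a = 0) (hb : PowerSeries.constantCoeff b = 0) :
    PowerSeries.map i (fadd F a b) = fadd (F.map i) (PowerSeries.map i a) (PowerSeries.map i b) :=
  map_formalGroup_subst F i ha hb

theorem constantCoeff_monomial_two_pow (N : ℕ) (c : S) :
    PowerSeries.constantCoeff (PowerSeries.monomial (2 ^ N) c) = 0 := by
  rw [← PowerSeries.coeff_zero_eq_constantCoeff_apply, PowerSeries.coeff_monomial,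
    if_neg (pow_pos two_pos N).ne]

theorem constantCoeff_partialFormalSum (F : FormalGroup S) (a : ℕ → S) (N : ℕ) :
    PowerSeries.constantCoeff (partialFormalSum F a N) = 0 := by
  induction N with
  | zero => simp [partialFormalSum]
  | succ N ih => exact constantCoeff_fadd F ih (constantCoeff_monomial_two_pow N _)

theorem map_monomial (i : S →+* K) (N : ℕ) (c : S) :
    PowerSeries.map i (PowerSeries.monomial N c) = PowerSeries.monomial N (i c) := by
  ext d
  rw [PowerSeries.coeff_map, PowerSeries.coeff_monomial, PowerSeries.coeff_monomial]
  split_ifs <;> simp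

theorem map_partialFormalSum (F : FormalGroup S) (i : S →+* K) (a : ℕ → S) (N : ℕ) :
    PowerSeries.map i (partialFormalSum F a N) =
      partialFormalSum (F.map i) (fun k => i (a k)) N := by
  induction N with
  | zero => simp [partialFormalSum]
  | succ N ih =>
    rw [partialFormalSum, map_fadd _ _ (constantCoeff_partialFormalSum F a N)
      (constantCoeff_monomial_two_pow N _), ih, map_monomial]
    rfl

theorem map_formalSum (F : FormalGroup S) (i : S →+* K) (a : ℕ → S) :
    PowerSeries.map i (formalSum F a) = formalSum (F.map i) (fun k => i (a k)) := by
  ext d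
  rw [PowerSeries.coeff_map, formalSum, formalSum, PowerSeries.coeff_mk, PowerSeries.coeff_mk,
    ← map_partialFormalSum, PowerSeries.coeff_map]

theorem map_twoSeries (F : FormalGroup S) (i : S →+* K) :
    PowerSeries.map i (twoSeries F) = twoSeries (F.map i) := by
  rw [twoSeries, map_fadd _ _ PowerSeries.constantCoeff_X PowerSeries.constantCoeff_X,
    PowerSeries.map_X]
  rfl

theorem IsAraki.map {F : FormalGroup S} {v : ℕ → S} (h : IsAraki F v) (i : S →+* K) :
    IsAraki (F.map i) (fun k => i (v k)) := by
  rw [IsAraki, ← map_twoSeries, h, map_formalSum]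

theorem fadd_zero_left (F : FormalGroup S) {a : PowerSeries S}
    (ha : PowerSeries.constantCoeff a = 0) : fadd F 0 a = a :=
  F.zero_add (PowerSeries.HasSubst.of_constantCoeff_zero' ha)

theorem fadd_zero_right (F : FormalGroup S) {a : PowerSeries S}
    (ha : PowerSeries.constantCoeff a = 0) : fadd F a 0 = a :=
  F.add_zero (PowerSeries.HasSubst.of_constantCoeff_zero' ha)

/-- Formal addition of a series of order `≥ n` only changes coefficients in degrees `≥ n`. -/
theorem coeff_fadd_of_lt (F : FormalGroup S) {a b : PowerSeries S}
    (ha : PowerSeries.constantCoeff a = 0) {n : ℕ} (hn : n ≠ 0)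
    (hb : PowerSeries.X ^ n ∣ b) {d : ℕ} (hd : d < n) :
    PowerSeries.coeff d (fadd F a b) = PowerSeries.coeff d a := by
  have hb0 : PowerSeries.constantCoeff b = 0 := by
    rw [← PowerSeries.coeff_zero_eq_constantCoeff_apply]
    exact PowerSeries.X_pow_dvd_iff.mp hb 0 (Nat.pos_of_ne_zero hn)
  conv_rhs => rw [← fadd_zero_right F ha]
  rw [fadd, fadd, PowerSeries.coeff, MvPowerSeries.coeff_subst (hasSubst_pair ha hb0),
    MvPowerSeries.coeff_subst (hasSubst_pair ha (map_zero _))]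
  refine finsum_congr fun e => ?_
  congr 1
  rw [Finsupp.prod_fintype _ _ (by simp), Finsupp.prod_fintype _ _ (by simp), Fin.prod_univ_two,
    Fin.prod_univ_two]
  simp only [Matrix.cons_val_zero, Matrix.cons_val_one]
  rcases Nat.eq_zero_or_pos (e 1) with h | h
  · rw [h, pow_zero, pow_zero]
  · rw [zero_pow h.ne', mul_zero, LinearMap.map_zero]
    have : PowerSeries.X ^ n ∣ a ^ e 0 * b ^ e 1 :=
      Dvd.dvd.mul_left (hb.trans (dvd_pow_self b h.ne')) _
    exact PowerSeries.X_pow_dvd_iff.mp this d hd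

theorem X_pow_dvd_monomial (n : ℕ) (c : S) : PowerSeries.X ^ n ∣ PowerSeries.monomial n c := by
  rw [PowerSeries.X_pow_dvd_iff]
  intro m hm
  rw [PowerSeries.coeff_monomial, if_neg hm.ne]

theorem coeff_partialFormalSum (F : FormalGroup S) (a : ℕ → S) {d N : ℕ} (h : d < 2 ^ N) (M : ℕ) :
    PowerSeries.coeff d (partialFormalSum F a (N + M)) =
      PowerSeries.coeff d (partialFormalSum F a N) := by
  induction M with
  | zero => rfl
  | succ M ih =>
    rw [← Nat.add_assoc, partialFormalSum, coeff_fadd_of_lt F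
      (constantCoeff_partialFormalSum F a _) (pow_ne_zero _ two_ne_zero) (X_pow_dvd_monomial _ _)
      (h.trans_le (Nat.pow_le_pow_right two_pos (Nat.le_add_right N M))), ih]

theorem coeff_formalSum (F : FormalGroup S) (a : ℕ → S) {d N : ℕ} (h : d < 2 ^ N) :
    PowerSeries.coeff d (formalSum F a) = PowerSeries.coeff d (partialFormalSum F a N) := by
  have h1 : d < 2 ^ (d + 1) :=
    Nat.lt_two_pow_self.trans (Nat.pow_lt_pow_right (by norm_num) (Nat.lt_succ_self d))
  rw [formalSum, PowerSeries.coeff_mk, ← coeff_partialFormalSum F a h1 N,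
    ← coeff_partialFormalSum F a h (d + 1), Nat.add_comm N]

theorem constantCoeff_formalSum (F : FormalGroup S) (a : ℕ → S) :
    PowerSeries.constantCoeff (formalSum F a) = 0 := by
  rw [← PowerSeries.coeff_zero_eq_constantCoeff_apply, coeff_formalSum F a (N := 0) (by simp),
    partialFormalSum, map_zero]

theorem partialFormalSum_eq_zero (F : FormalGroup S) {a : ℕ → S} {r : ℕ}
    (h : ∀ k < r, a k = 0) : partialFormalSum F a r = 0 := by
  induction r with
  | zero => rfl
  | succ r ih =>
    rw [partialFormalSum, ih fun k hk => h k (hk.trans (Nat.lt_succ_self r)), h r (Nat.lt_succ_self r),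
      map_zero, fadd_zero_left F (map_zero _)]

/-- If the first `r` coordinates of a formal sum vanish, then its leading term is `a_r x^(2^r)`. -/
theorem coeff_formalSum_of_eq_zero (F : FormalGroup S) {a : ℕ → S} {r : ℕ}
    (h : ∀ k < r, a k = 0) :
    (∀ d < 2 ^ r, PowerSeries.coeff d (formalSum F a) = 0) ∧
      PowerSeries.coeff (2 ^ r) (formalSum F a) = a r := by
  have h0 := partialFormalSum_eq_zero F h
  refine ⟨fun d hd => ?_, ?_⟩
  · rw [coeff_formalSum F a hd, h0, map_zero]
  · rw [coeff_formalSum F a (Nat.pow_lt_pow_right (by norm_num) (Nat.lt_succ_self r)),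
      partialFormalSum, h0, fadd_zero_left F (constantCoeff_monomial_two_pow _ _),
      PowerSeries.coeff_monomial, if_pos rfl]

theorem coeff_one_formalSum (F : FormalGroup S) (a : ℕ → S) :
    PowerSeries.coeff 1 (formalSum F a) = a 0 :=
  (coeff_formalSum_of_eq_zero F (a := a) (r := 0) fun _ h => absurd h (Nat.not_lt_zero _)).2

variable {F : FormalGroup S} {i : S →+* K} {l : ℕ → K}

theorem IsLog.subst_map_fadd {L : PowerSeries K} (h : IsLog (F.map i) L) {a b : PowerSeries S}
    (ha : PowerSeries.constantCoeff a = 0) (hb : PowerSeries.constantCoeff b = 0) :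
    PowerSeries.subst (PowerSeries.map i (fadd F a b)) L =
      PowerSeries.subst (PowerSeries.map i a) L + PowerSeries.subst (PowerSeries.map i b) L := by
  rw [map_fadd F i ha hb]
  exact h.subst_eq (constantCoeff_map_zero ha i) (constantCoeff_map_zero hb i)

theorem coeff_subst_twoTypicalSeries_uni (l : ℕ → K) {g : PowerSeries K}
    (hg : PowerSeries.constantCoeff g = 0) {d : ℕ} {M : ℕ} (h : d < 2 ^ M) :
    PowerSeries.coeff d (PowerSeries.subst g (twoTypicalSeries l)) =
      ∑ k ∈ Finset.range M, l k * PowerSeries.coeff d (g ^ 2 ^ k) :=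
  coeff_subst_twoTypicalSeries l hg (by simpa using h)

theorem coeff_subst_monomial (l : ℕ → K) (c : K) (k d : ℕ) :
    PowerSeries.coeff d (PowerSeries.subst (PowerSeries.monomial (2 ^ k) c) (twoTypicalSeries l)) =
      ∑ j ∈ Finset.range (d + 1), if d = 2 ^ (k + j) then l j * c ^ 2 ^ j else 0 := by
  have h1 : d < 2 ^ (d + 1) :=
    Nat.lt_two_pow_self.trans (Nat.pow_lt_pow_right (by norm_num) (Nat.lt_succ_self d))
  rw [coeff_subst_twoTypicalSeries_uni l (constantCoeff_monomial_two_pow k c) h1]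
  refine Finset.sum_congr rfl fun j _ => ?_
  rw [PowerSeries.monomial_pow, PowerSeries.coeff_monomial, ← pow_add, Nat.add_comm j k, mul_ite, mul_zero]

theorem IsLog.subst_partialFormalSum (h : IsLog (F.map i) (twoTypicalSeries l)) (a : ℕ → S)
    (N : ℕ) :
    PowerSeries.subst (PowerSeries.map i (partialFormalSum F a N)) (twoTypicalSeries l) =
      ∑ k ∈ Finset.range N,
        PowerSeries.subst (PowerSeries.monomial (2 ^ k) (i (a k))) (twoTypicalSeries l) := by
  induction N with
  | zero =>
    rw [partialFormalSum, map_zero, Finset.sum_range_zero]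
    exact PowerSeries.subst_zero_of_constantCoeff_zero (constantCoeff_twoTypicalSeries l)
  | succ N ih =>
    rw [partialFormalSum, h.subst_map_fadd (constantCoeff_partialFormalSum F a N)
      (constantCoeff_monomial_two_pow N _), ih, Finset.sum_range_succ, map_monomial]

/-- The logarithm of the formal sum `∑^F a_i x^(2^i)`. -/
theorem IsLog.subst_formalSum (h : IsLog (F.map i) (twoTypicalSeries l)) (a : ℕ → S) :
    PowerSeries.subst (PowerSeries.map i (formalSum F a)) (twoTypicalSeries l) =
      twoTypicalSeries fun k => ∑ p ∈ Finset.HasAntidiagonal.antidiagonal k,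
        l p.1 * i (a p.2) ^ 2 ^ p.1 := by
  ext d
  have h1 : d < 2 ^ (d + 1) :=
    Nat.lt_two_pow_self.trans (Nat.pow_lt_pow_right (by norm_num) (Nat.lt_succ_self d))
  have hcongr : PowerSeries.coeff d
      (PowerSeries.subst (PowerSeries.map i (formalSum F a)) (twoTypicalSeries l)) =
      PowerSeries.coeff d (PowerSeries.subst
        (PowerSeries.map i (partialFormalSum F a (d + 1))) (twoTypicalSeries l)) := by
    refine coeff_subst_twoTypicalSeries_congr l
      (constantCoeff_map_zero (constantCoeff_formalSum F a) i)
      (constantCoeff_map_zero (constantCoeff_partialFormalSum F a _) i) (n := (2 ^ (d + 1) : ℕ)) ?_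
      (by simpa using (by exact_mod_cast h1 : ((d : ℕ) : ℕ∞) < ((2 ^ (d + 1) : ℕ) : ℕ∞)))
    refine MvPowerSeries.nat_le_order fun e he => ?_
    have he' : e = Finsupp.single () (e ()) := Finsupp.unique_ext (by simp)
    have hd : e () < 2 ^ (d + 1) := by rw [he'] at he; simpa using he
    rw [he']
    change PowerSeries.coeff (e ()) _ = 0
    rw [← map_sub, PowerSeries.coeff_map, map_sub, coeff_formalSum F a hd, sub_self, map_zero]
  rw [hcongr, h.subst_partialFormalSum, map_sum]
  simp only [coeff_subst_monomial]
  by_cases hd : ∃ s, d = 2 ^ s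
  · obtain ⟨s, rfl⟩ := hd
    rw [coeff_twoTypicalSeries_two_pow, Finset.sum_comm, ← Finset.sum_product',
      ← Finset.sum_filter]
    refine Finset.sum_congr ?_ fun _ _ => rfl
    ext p
    simp only [Finset.HasAntidiagonal.mem_antidiagonal, Finset.mem_filter, Finset.mem_product,
      Finset.mem_range]
    have hs : s < 2 ^ s := Nat.lt_two_pow_self
    constructor
    · rintro ⟨-, hp⟩
      have := Nat.pow_right_injective le_rfl hp
      omega
    · intro hp
      refine ⟨⟨by omega, by omega⟩, by rw [Nat.add_comm, hp]⟩
  · push Not at hd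
    rw [coeff_twoTypicalSeries_of_ne _ hd]
    exact Finset.sum_eq_zero fun k _ => Finset.sum_eq_zero fun j _ => if_neg (hd _)

theorem twoTypicalSeries_injective {l l' : ℕ → K} (h : twoTypicalSeries l = twoTypicalSeries l') :
    l = l' := by
  funext k
  rw [← coeff_twoTypicalSeries_two_pow l k, h, coeff_twoTypicalSeries_two_pow]

theorem IsLog.subst_twoSeries {L : PowerSeries K} (h : IsLog (F.map i) L) :
    PowerSeries.subst (PowerSeries.map i (twoSeries F)) L = L + L := by
  rw [twoSeries, h.subst_map_fadd PowerSeries.constantCoeff_X PowerSeries.constantCoeff_X,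
    PowerSeries.map_X, PowerSeries.X_subst]

theorem constantCoeff_twoSeries (F : FormalGroup S) :
    PowerSeries.constantCoeff (twoSeries F) = 0 :=
  constantCoeff_fadd F PowerSeries.constantCoeff_X PowerSeries.constantCoeff_X

theorem twoTypicalSeries_add (l l' : ℕ → K) :
    twoTypicalSeries l + twoTypicalSeries l' = twoTypicalSeries fun k => l k + l' k := by
  ext d
  simp only [twoTypicalSeries, map_add, PowerSeries.coeff_mk]
  split_ifs <;> simp

/-- The Araki relations `2 ℓ_k = ∑_{i + j = k} ℓ_i v_j^(2^i)`. -/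
theorem isAraki_iff (hi : Function.Injective i) (h : IsLog (F.map i) (twoTypicalSeries l))
    (v : ℕ → S) :
    IsAraki F v ↔ ∀ k, 2 * l k = ∑ p ∈ Finset.HasAntidiagonal.antidiagonal k,
      l p.1 * i (v p.2) ^ 2 ^ p.1 := by
  have h1 : IsAraki F v ↔ twoTypicalSeries (fun k => l k + l k) =
      twoTypicalSeries fun k => ∑ p ∈ Finset.HasAntidiagonal.antidiagonal k,
        l p.1 * i (v p.2) ^ 2 ^ p.1 := by
    rw [← twoTypicalSeries_add, ← h.subst_twoSeries, ← h.subst_formalSum]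
    refine ⟨fun h => by rw [IsAraki] at h; rw [h], fun h' => ?_⟩
    apply map_injective hi
    exact subst_injective h.constantCoeff_eq h.coeff_one_eq
      (constantCoeff_map_zero (constantCoeff_twoSeries F) i)
      (constantCoeff_map_zero (constantCoeff_formalSum F v) i) h'
  rw [h1]
  simp only [two_mul]
  exact ⟨fun h k => congrFun (twoTypicalSeries_injective h) k, fun h => by rw [funext h]⟩

end FormalSums

/-! ### Existence, uniqueness and integrality of the Araki elements. -/

section Araki

variable {S K : Type*} [CommRing S] [CommRing K]

theorem X_pow_succ_dvd_pow_sub_pow {a b : PowerSeries K}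
    (ha : PowerSeries.constantCoeff a = 0) (hb : PowerSeries.constantCoeff b = 0) {n : ℕ}
    (h : PowerSeries.X ^ n ∣ a - b) (q : ℕ) :
    PowerSeries.X ^ (n + 1) ∣ a ^ (q + 2) - b ^ (q + 2) := by
  have hsplit : a ^ (q + 2) - b ^ (q + 2) =
      (a - b) * (a * a ^ q) + (a ^ (q + 1) - b ^ (q + 1)) * b := by ring
  rw [hsplit, pow_succ]
  refine dvd_add ?_ ?_
  · exact mul_dvd_mul h (Dvd.dvd.mul_right (PowerSeries.X_dvd_iff.mpr ha) _)
  · exact mul_dvd_mul (h.trans (sub_dvd_pow_sub_pow a b _)) (PowerSeries.X_dvd_iff.mpr hb)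

/-- The non-linear terms of `L` are multiples of `a^(2^k)` with `k ≥ 1`, whose coefficient in degree
`n` involves only coefficients of `a` below `n`. Hence the first discrepancy between two series
passes through `L` unchanged. -/
theorem coeff_sub_coeff_of_subst {l : ℕ → K} (h0 : l 0 = 1) {a b : PowerSeries K}
    (ha : PowerSeries.constantCoeff a = 0) (hb : PowerSeries.constantCoeff b = 0) {n : ℕ}
    (h : ∀ d < n, PowerSeries.coeff d (PowerSeries.subst a (twoTypicalSeries l)) =
      PowerSeries.coeff d (PowerSeries.subst b (twoTypicalSeries l))) :
    PowerSeries.coeff n a - PowerSeries.coeff n b =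
      PowerSeries.coeff n (PowerSeries.subst a (twoTypicalSeries l)) -
      PowerSeries.coeff n (PowerSeries.subst b (twoTypicalSeries l)) := by
  induction n using Nat.strong_induction_on with
  | _ n ih =>
    have hdvd : PowerSeries.X ^ n ∣ a - b := by
      rw [PowerSeries.X_pow_dvd_iff]
      intro m hm
      rw [map_sub, ih m hm fun d hd => h d (hd.trans hm), h m hm, sub_self]
    have hn : n < 2 ^ (n + 1) :=
      Nat.lt_two_pow_self.trans (Nat.pow_lt_pow_right (by norm_num) (Nat.lt_succ_self n))
    rw [coeff_subst_twoTypicalSeries_uni l ha hn, coeff_subst_twoTypicalSeries_uni l hb hn,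
      ← Finset.sum_sub_distrib, Finset.sum_range_succ', Finset.sum_eq_zero, h0]
    · simp
    · intro k _
      obtain ⟨q, hq⟩ : ∃ q, 2 ^ (k + 1) = q + 2 := by
        have : 2 ^ 1 ≤ 2 ^ (k + 1) := Nat.pow_le_pow_right two_pos (by omega)
        exact ⟨2 ^ (k + 1) - 2, by omega⟩
      rw [← mul_sub, ← map_sub, hq, PowerSeries.X_pow_dvd_iff.mp
        (X_pow_succ_dvd_pow_sub_pow ha hb hdvd q) n (Nat.lt_succ_self n), mul_zero]

/-- The sequence defined by the Araki relations from the coefficients of a logarithm. -/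
def arakiSeq (l : ℕ → K) : ℕ → K
  | n => 2 * l n - ∑ j : Fin n, l (n - j) * arakiSeq l j ^ 2 ^ (n - (j : ℕ))
decreasing_by exact j.2

theorem arakiSeq_eq (l : ℕ → K) (n : ℕ) :
    arakiSeq l n = 2 * l n - ∑ j ∈ Finset.range n, l (n - j) * arakiSeq l j ^ 2 ^ (n - j) := by
  rw [arakiSeq, ← Fin.sum_univ_eq_sum_range (fun j => l (n - j) * arakiSeq l j ^ 2 ^ (n - j)) n]

theorem sum_antidiagonal_eq_range (l V : ℕ → K) (k : ℕ) (h0 : l 0 = 1) :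
    ∑ p ∈ Finset.HasAntidiagonal.antidiagonal k, l p.1 * V p.2 ^ 2 ^ p.1 =
      ∑ j ∈ Finset.range k, l (k - j) * V j ^ 2 ^ (k - j) + V k := by
  rw [← Finset.Nat.sum_antidiagonal_swap, Finset.Nat.sum_antidiagonal_eq_sum_range_succ_mk,
    Finset.sum_range_succ]
  simp [h0]

theorem araki_relation_iff (l V : ℕ → K) (h0 : l 0 = 1) :
    (∀ k, 2 * l k = ∑ p ∈ Finset.HasAntidiagonal.antidiagonal k, l p.1 * V p.2 ^ 2 ^ p.1) ↔
      V = arakiSeq l := by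
  simp only [sum_antidiagonal_eq_range l V _ h0]
  constructor
  · intro h
    funext k
    induction k using Nat.strong_induction_on with
    | _ k ih =>
      have hs : ∑ j ∈ Finset.range k, l (k - j) * arakiSeq l j ^ 2 ^ (k - j) =
          ∑ j ∈ Finset.range k, l (k - j) * V j ^ 2 ^ (k - j) :=
        Finset.sum_congr rfl fun j hj => by rw [← ih j (Finset.mem_range.mp hj)]
      rw [arakiSeq_eq, h k, hs]
      ring
  · rintro rfl k
    linear_combination -(arakiSeq_eq l k)

variable {F : FormalGroup S} {i : S →+* K} {l : ℕ → K}

/-- The sequence defined by the Araki relations is integral. -/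
theorem exists_arakiSeq_eq (h : IsLog (F.map i) (twoTypicalSeries l)) (n : ℕ) :
    ∃ c : S, arakiSeq l n = i c := by
  have h0 : l 0 = 1 := (coeff_one_twoTypicalSeries l).symm.trans h.coeff_one_eq
  induction n using Nat.strong_induction_on with
  | _ n ih =>
    have ih' : ∀ k, ∃ c : S, k < n → arakiSeq l k = i c := fun k => by
      by_cases hk : k < n
      · obtain ⟨c, hc⟩ := ih k hk
        exact ⟨c, fun _ => hc⟩
      · exact ⟨0, fun h => absurd h hk⟩
    choose c hc using ih'
    -- The formal sum of the elements already known to be integral agrees with the `2`-series below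
    -- degree `2^n`. Their discrepancy in degree `2^n` is the `n`-th Araki element, which is thus a
    -- difference of two integral coefficients.
    let c' : ℕ → S := fun k => if k < n then c k else 0
    have hc' : ∀ k, i (c' k) = if k < n then arakiSeq l k else 0 := by
      intro k
      by_cases hk : k < n
      · simp only [c', if_pos hk, hc k hk]
      · simp only [c', if_neg hk, map_zero]
    have hlog := h.subst_formalSum c'
    have hl2 : twoTypicalSeries l + twoTypicalSeries l = twoTypicalSeries fun k => 2 * l k := by
      rw [twoTypicalSeries_add]
      simp only [two_mul]
    have hrel := (araki_relation_iff l (arakiSeq l) h0).mpr rfl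
    have hsum : ∀ k < n, 2 * l k = ∑ p ∈ Finset.HasAntidiagonal.antidiagonal k,
        l p.1 * i (c' p.2) ^ 2 ^ p.1 := by
      intro k hk
      rw [hrel k]
      refine Finset.sum_congr rfl fun p hp => ?_
      have := Finset.HasAntidiagonal.mem_antidiagonal.mp hp
      rw [hc', if_pos (by omega)]
    have key := coeff_sub_coeff_of_subst h0
      (constantCoeff_map_zero (constantCoeff_twoSeries F) i)
      (constantCoeff_map_zero (constantCoeff_formalSum F c') i) (n := 2 ^ n) (by
        intro d hd
        rw [h.subst_twoSeries, hlog, hl2]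
        by_cases hd2 : ∃ s, d = 2 ^ s
        · obtain ⟨s, rfl⟩ := hd2
          have hs : s < n := (Nat.pow_lt_pow_iff_right (by norm_num)).mp hd
          rw [coeff_twoTypicalSeries_two_pow, coeff_twoTypicalSeries_two_pow, hsum s hs]
        · push Not at hd2
          rw [coeff_twoTypicalSeries_of_ne _ hd2, coeff_twoTypicalSeries_of_ne _ hd2])
    rw [h.subst_twoSeries, hlog, hl2, coeff_twoTypicalSeries_two_pow,
      coeff_twoTypicalSeries_two_pow, hrel n, sum_antidiagonal_eq_range l (arakiSeq l) n h0,
      sum_antidiagonal_eq_range l (fun k => i (c' k)) n h0, PowerSeries.coeff_map,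
      PowerSeries.coeff_map, ← map_sub] at key
    refine ⟨_, Eq.trans ?_ key.symm⟩
    have hs : ∑ j ∈ Finset.range n, l (n - j) * i (c' j) ^ 2 ^ (n - j) =
        ∑ j ∈ Finset.range n, l (n - j) * arakiSeq l j ^ 2 ^ (n - j) :=
      Finset.sum_congr rfl fun j hj => by rw [hc' j, if_pos (Finset.mem_range.mp hj)]
    rw [hs, hc' n, if_neg (lt_irrefl n)]
    ring

theorem existsUnique_isAraki (hi : Function.Injective i)
    (h : IsLog (F.map i) (twoTypicalSeries l)) : ∃! v : ℕ → S, IsAraki F v := by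
  have h0 : l 0 = 1 := (coeff_one_twoTypicalSeries l).symm.trans h.coeff_one_eq
  choose v hv using exists_arakiSeq_eq h
  refine ⟨v, ?_, ?_⟩
  · refine (isAraki_iff hi h v).mpr ?_
    exact (araki_relation_iff l (fun k => i (v k)) h0).mpr (funext fun k => (hv k).symm)
  · intro w hw
    have := (araki_relation_iff l (fun k => i (w k)) h0).mp ((isAraki_iff hi h w).mp hw)
    funext k
    apply hi
    rw [← hv, ← congrFun this k]

end Araki

/-! ### The ideals `I_r` and the leading terms of the `2`-series. -/

section ChromaticIdeals

variable {S : Type*} [CommRing S]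

theorem two_mem_chromIdeal (v : ℕ → S) (r : ℕ) : (2 : S) ∈ chromIdeal v r :=
  Ideal.subset_span (Set.mem_insert _ _)

theorem mem_chromIdeal {v : ℕ → S} {r k : ℕ} (h1 : 1 ≤ k) (h : k < r) : v k ∈ chromIdeal v r :=
  Ideal.subset_span (Set.mem_insert_of_mem _ ⟨k, h1, h, rfl⟩)

theorem chromIdeal_le {v : ℕ → S} {r : ℕ} {J : Ideal S} (h2 : (2 : S) ∈ J)
    (h : ∀ k, 1 ≤ k → k < r → v k ∈ J) : chromIdeal v r ≤ J := by
  rw [chromIdeal, Ideal.span_le]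
  rintro x (rfl | ⟨k, h1, hk, rfl⟩)
  · exact h2
  · exact h k h1 hk

theorem chromIdeal_mono (v : ℕ → S) {r r' : ℕ} (h : r ≤ r') : chromIdeal v r ≤ chromIdeal v r' :=
  chromIdeal_le (two_mem_chromIdeal v r') fun _ h1 hk => mem_chromIdeal h1 (hk.trans_le h)

theorem map_chromIdeal {S' : Type*} [CommRing S'] (f : S →+* S') (v : ℕ → S) (r : ℕ) :
    (chromIdeal v r).map f = chromIdeal (fun k => f (v k)) r := by
  apply le_antisymm
  · rw [Ideal.map_le_iff_le_comap]
    refine chromIdeal_le ?_ fun k h1 hk => mem_chromIdeal (v := fun k => f (v k)) h1 hk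
    rw [Ideal.mem_comap, map_ofNat]
    exact two_mem_chromIdeal _ _
  · refine chromIdeal_le ?_ fun k h1 hk => Ideal.mem_map_of_mem f (mem_chromIdeal h1 hk)
    rw [← map_ofNat f 2]
    exact Ideal.mem_map_of_mem f (two_mem_chromIdeal _ _)

/-- Sequences that agree up to units modulo the preceding elements generate the same ideals. -/
theorem chromIdeal_eq_of_sub_mem {a b : ℕ → S} {r : ℕ}
    (h : ∀ k, 1 ≤ k → k < r → ∃ c : Sˣ, a k - c * b k ∈ chromIdeal b k) :
    chromIdeal a r = chromIdeal b r := by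
  induction r with
  | zero =>
    exact le_antisymm (chromIdeal_le (two_mem_chromIdeal _ _) fun _ _ h => absurd h (Nat.not_lt_zero _))
      (chromIdeal_le (two_mem_chromIdeal _ _) fun _ _ h => absurd h (Nat.not_lt_zero _))
  | succ r ih =>
    have ih := ih fun k h1 hk => h k h1 (hk.trans (Nat.lt_succ_self r))
    apply le_antisymm
    · refine chromIdeal_le (two_mem_chromIdeal _ _) fun k h1 hk => ?_
      obtain ⟨c, hc⟩ := h k h1 hk
      have := (chromIdeal b (r + 1)).add_mem (chromIdeal_mono b hk.le hc)
        ((chromIdeal b (r + 1)).mul_mem_left c (mem_chromIdeal h1 hk))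
      rwa [sub_add_cancel] at this
    · refine chromIdeal_le (two_mem_chromIdeal _ _) fun k h1 hk => ?_
      obtain ⟨c, hc⟩ := h k h1 hk
      have hc' : a k - c * b k ∈ chromIdeal a (r + 1) :=
        chromIdeal_mono a (Nat.le_succ r) (ih ▸ chromIdeal_mono b (Nat.le_of_lt_succ hk) hc)
      have := (chromIdeal a (r + 1)).mul_mem_left (↑c⁻¹ : S)
        ((chromIdeal a (r + 1)).sub_mem (mem_chromIdeal (v := a) h1 hk) hc')
      rwa [sub_sub_cancel, Units.inv_mul_cancel_left] at this

variable {K : Type*} [CommRing K] {i : S →+* K} {s : S →+* S} {sK : K →+* K}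
  {u : ℕ → S} {l : ℕ → K}

/-- The coefficients of the `2`-series in terms of the functional equation. -/
theorem IsFunctionalEquation.exists_coeff_twoSeries_eq (H : IsFunctionalEquation i s sK u l)
    {F : FormalGroup S} (h : IsLog (F.map i) (twoTypicalSeries l)) :
    ∃ b : ℕ → ℕ → S, (∀ d M, d < 2 ^ M → PowerSeries.coeff d (twoSeries F) =
        2 * PowerSeries.coeff d (PowerSeries.X : PowerSeries S) +
          ∑ j ∈ Finset.range M, u j * b j d) ∧
      (∀ j d, d < 2 ^ j → b j d = 0) ∧ (∀ d, b 0 d = 0) ∧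
      ∀ j, 2 * i (b j (2 ^ j)) = i (PowerSeries.coeff 1 (twoSeries F)) ^ 2 ^ j -
        i ((s ^ j) (PowerSeries.coeff 1 (twoSeries F))) := by
  have h0 := constantCoeff_twoSeries F
  have h0' := constantCoeff_map_zero h0 i
  have hex := fun j d => H.exists_coeff_twistDefect_eq j h0 (Finsupp.single () d)
  choose b hb using hex
  have hzero : ∀ {j d}, PowerSeries.coeff d
      (twistDefect sK l j (PowerSeries.map i (twoSeries F))) = 0 → b j d = 0 := by
    intro j d h
    apply H.injective
    rw [map_zero]
    exact H.isUnit_two.mul_right_eq_zero.mp ((hb j d).symm.trans h)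
  refine ⟨b, ?_, ?_, ?_, ?_⟩
  · intro d M hM
    have hd : (Finsupp.single () d : Unit →₀ ℕ).degree < 2 ^ M := by simpa using hM
    -- The logarithm of the `2`-series is `2 L`, so the part of `two_mul_coeff` without defects is
    -- twice the value for a variable, namely `4 x`. Cancelling `2` leaves `2 x` plus half of the
    -- defects.
    have h1 := H.two_mul_coeff h0' hd
    have h2 := H.sum_coeff_twist_subst_X () hd
    apply H.injective
    apply H.isUnit_two.mul_left_cancel
    have h3 : PowerSeries.subst (MvPowerSeries.X () : MvPowerSeries Unit K) (twoTypicalSeries l) =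
      twoTypicalSeries l := PowerSeries.X_subst _
    rw [h.subst_twoSeries] at h1
    rw [h3] at h2
    simp only [map_add, mul_add, Finset.sum_add_distrib] at h1
    erw [h2] at h1
    rw [map_add, map_sum, mul_add, Finset.mul_sum, map_mul, map_ofNat, ← PowerSeries.coeff_map,
      ← PowerSeries.coeff_map, PowerSeries.map_X]
    refine h1.trans ?_
    rw [← two_mul]
    congr 1
    refine Finset.sum_congr rfl fun j _ => ?_
    erw [hb]
    rw [map_mul]
    ring
  · intro j d hd
    exact hzero (coeff_twistDefect_of_lt h0' (by simpa using hd))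
  · intro d
    apply hzero
    rw [twistDefect_zero, map_zero]
  · intro j
    have := H.coeff_two_pow_twistDefect j h0'
    rw [PowerSeries.coeff_map, H.comm_pow] at this
    exact (hb j (2 ^ j)).symm.trans this

/-- The defect of index `r` contributes `u_r (2^(2^r) - 2)/2 = u_r (2^(2^r - 1) - 1)`, which is
`-u_r` modulo `2` since `r ≥ 1`. The smaller indices contribute multiples of `2, u_1, …, u_{r-1}`,
and the larger ones nothing in this degree. -/
theorem IsFunctionalEquation.coeff_twoSeries_mem (H : IsFunctionalEquation i s sK u l)
    {F : FormalGroup S} (h : IsLog (F.map i) (twoTypicalSeries l)) {r : ℕ} (hr : 1 ≤ r) :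
    PowerSeries.coeff (2 ^ r) (twoSeries F) + u r ∈ chromIdeal u r := by
  obtain ⟨b, hb, hb1, hb2, hb3⟩ := H.exists_coeff_twoSeries_eq h
  have h1 : PowerSeries.coeff 1 (twoSeries F) = 2 := by
    rw [hb 1 1 (by norm_num), Finset.sum_range_one, hb2, PowerSeries.coeff_one_X]
    ring
  have hbr : b r (2 ^ r) = 2 ^ (2 ^ r - 1) - 1 := by
    apply H.injective
    apply H.isUnit_two.mul_left_cancel
    rw [hb3, h1]
    have : 2 ^ r = (2 ^ r - 1) + 1 := (Nat.sub_add_cancel (Nat.one_le_pow r 2 two_pos)).symm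
    nth_rw 1 [this]
    simp only [map_ofNat, map_sub, map_pow, map_one, pow_succ]
    ring
  rw [hb (2 ^ r) (r + 1) (Nat.pow_lt_pow_right (by norm_num) (Nat.lt_succ_self r)),
    Finset.sum_range_succ, hbr]
  have hsum : ∑ j ∈ Finset.range r, u j * b j (2 ^ r) ∈ chromIdeal u r := by
    refine Ideal.sum_mem _ fun j hj => Ideal.mul_mem_right _ _ ?_
    rcases Nat.eq_zero_or_pos j with rfl | hj0
    · rw [H.u_zero]; exact two_mem_chromIdeal _ _
    · exact mem_chromIdeal hj0 (Finset.mem_range.mp hj)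
  have hpow : (2 : S) ^ (2 ^ r - 1) ∈ chromIdeal u r := by
    refine Ideal.pow_mem_of_mem _ (two_mem_chromIdeal _ _) _ ?_
    have : 2 ^ 1 ≤ 2 ^ r := Nat.pow_le_pow_right two_pos hr
    omega
  have hX := Ideal.mul_mem_right (PowerSeries.coeff (2 ^ r) (PowerSeries.X : PowerSeries S))
    _ (two_mem_chromIdeal u r)
  have := Ideal.add_mem _ (Ideal.add_mem _ hX hsum) (Ideal.mul_mem_left _ (u r) hpow)
  convert this using 1
  ring

/-- The Araki elements agree with the coefficients of the functional equation up to sign, modulo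
the preceding ones. -/
theorem IsFunctionalEquation.araki_add_mem (H : IsFunctionalEquation i s sK u l)
    {F : FormalGroup S} (h : IsLog (F.map i) (twoTypicalSeries l)) {v : ℕ → S} (hv : IsAraki F v)
    (r : ℕ) (hr : 1 ≤ r) : v r + u r ∈ chromIdeal u r := by
  induction r using Nat.strong_induction_on with
  | _ r ih =>
    obtain ⟨b, hb, hb1, hb2, hb3⟩ := H.exists_coeff_twoSeries_eq h
    have h1 : PowerSeries.coeff 1 (twoSeries F) = 2 := by
      rw [hb 1 1 (by norm_num), Finset.sum_range_one, hb2, PowerSeries.coeff_one_X]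
      ring
    -- By induction all `v_k` with `k < r` vanish in this quotient, so `v_r` is the coefficient of
    -- `x^(2^r)` in the `2`-series there.
    let q := Ideal.Quotient.mk (chromIdeal u r)
    have hq : ∀ k < r, q (v k) = 0 := by
      intro k hk
      rw [Ideal.Quotient.eq_zero_iff_mem]
      rcases Nat.eq_zero_or_pos k with rfl | hk0
      · rw [← coeff_one_formalSum F v, ← hv, h1]
        exact two_mem_chromIdeal _ _
      · have := Ideal.sub_mem _ (chromIdeal_mono u hk.le (ih k hk hk0)) (mem_chromIdeal hk0 hk)
        rwa [add_sub_cancel_right] at this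
    have h2 := (coeff_formalSum_of_eq_zero (F.map q) hq).2
    rw [← hv.map q, ← map_twoSeries, PowerSeries.coeff_map] at h2
    have h3 := Ideal.sub_mem _ (H.coeff_twoSeries_mem h hr) (Ideal.Quotient.eq.mp h2)
    convert h3 using 1
    ring

end ChromaticIdeals

/-! ### Twisted power series and the functional equation they produce. -/

section TwistedProducts

variable {R R' : Type*} [CommRing R] [CommRing R'] (s : R →+* R)

/-- The product of twisted power series `∑ a_i V^i`, where `V a = s(a) V`. -/
def tmul (a b : ℕ → R) : ℕ → R := fun k =>
  ∑ p ∈ Finset.HasAntidiagonal.antidiagonal k, a p.1 * (s ^ p.1) (b p.2)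

/-- The twisted power series `1`. -/
def tone : ℕ → R := fun k => if k = 0 then 1 else 0

theorem tmul_apply (a b : ℕ → R) (k : ℕ) :
    tmul s a b k = ∑ p ∈ Finset.HasAntidiagonal.antidiagonal k, a p.1 * (s ^ p.1) (b p.2) := rfl

theorem tmul_zero (a b : ℕ → R) : tmul s a b 0 = a 0 * b 0 := by
  simp [tmul_apply]

theorem tmul_assoc (a b c : ℕ → R) : tmul s (tmul s a b) c = tmul s a (tmul s b c) := by
  funext k
  simp only [tmul_apply, Finset.sum_mul, map_sum, Finset.mul_sum, Finset.sum_sigma']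
  apply Finset.sum_nbij' (fun ⟨⟨_i, j⟩, ⟨k, l⟩⟩ => ⟨(k, l + j), (l, j)⟩)
    (fun ⟨⟨i, _j⟩, ⟨k, l⟩⟩ => ⟨(i + k, l), (i, k)⟩)
  · rintro ⟨⟨i, j⟩, ⟨k, l⟩⟩ h
    simp only [Finset.mem_sigma, Finset.HasAntidiagonal.mem_antidiagonal] at h ⊢
    obtain ⟨h1, rfl⟩ := h
    exact ⟨by omega, trivial⟩
  · rintro ⟨⟨i, j⟩, ⟨k, l⟩⟩ h
    simp only [Finset.mem_sigma, Finset.HasAntidiagonal.mem_antidiagonal] at h ⊢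
    obtain ⟨h1, rfl⟩ := h
    exact ⟨by omega, trivial⟩
  · rintro ⟨⟨i, j⟩, ⟨k, l⟩⟩ h
    simp only [Finset.mem_sigma, Finset.HasAntidiagonal.mem_antidiagonal] at h
    obtain ⟨h1, rfl⟩ := h
    rfl
  · rintro ⟨⟨i, j⟩, ⟨k, l⟩⟩ h
    simp only [Finset.mem_sigma, Finset.HasAntidiagonal.mem_antidiagonal] at h
    obtain ⟨h1, rfl⟩ := h
    rfl
  · rintro ⟨⟨i, j⟩, ⟨k, l⟩⟩ h
    simp only [Finset.mem_sigma, Finset.HasAntidiagonal.mem_antidiagonal] at h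
    obtain ⟨h1, rfl⟩ := h
    simp only [map_mul]
    rw [← mul_assoc, pow_add, RingHom.mul_def, RingHom.comp_apply]

theorem tone_tmul (a : ℕ → R) : tmul s tone a = a := by
  funext k
  rw [tmul_apply, Finset.sum_eq_single (0, k)]
  · simp [tone]
  · rintro ⟨i, j⟩ h hne
    rw [Finset.HasAntidiagonal.mem_antidiagonal] at h
    have : i ≠ 0 := fun h0 => hne (by simp only [Prod.mk.injEq]; omega)
    simp [tone, this]
  · intro h
    simp at h

theorem tmul_tone (a : ℕ → R) : tmul s a tone = a := by
  funext k
  rw [tmul_apply, Finset.sum_eq_single (k, 0)]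
  · simp [tone]
  · rintro ⟨i, j⟩ h hne
    rw [Finset.HasAntidiagonal.mem_antidiagonal] at h
    have : j ≠ 0 := fun h0 => hne (by simp only [Prod.mk.injEq]; omega)
    simp [tone, this]
  · intro h
    simp at h

theorem add_tmul (a b c : ℕ → R) : tmul s (a + b) c = tmul s a c + tmul s b c := by
  funext k
  simp only [tmul_apply, Pi.add_apply, add_mul, Finset.sum_add_distrib]

theorem tmul_add (a b c : ℕ → R) : tmul s a (b + c) = tmul s a b + tmul s a c := by
  funext k
  simp only [tmul_apply, Pi.add_apply, map_add, mul_add, Finset.sum_add_distrib]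

theorem map_pow_of_comm {s : R →+* R} {s' : R' →+* R'} {f : R →+* R'}
    (h : ∀ x, f (s x) = s' (f x)) (k : ℕ) (x : R) : f ((s ^ k) x) = (s' ^ k) (f x) := by
  induction k generalizing x with
  | zero => simp
  | succ k ih =>
    rw [pow_succ, pow_succ, RingHom.mul_def, RingHom.mul_def, RingHom.comp_apply,
      RingHom.comp_apply, ih, h]

theorem map_tmul {s : R →+* R} {s' : R' →+* R'} {f : R →+* R'}
    (h : ∀ x, f (s x) = s' (f x)) (a b : ℕ → R) :
    (fun k => f (tmul s a b k)) = tmul s' (fun k => f (a k)) (fun k => f (b k)) := by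
  funext k
  simp only [tmul_apply, map_sum, map_mul, map_pow_of_comm h]

theorem map_tone (f : R →+* R') : (fun k => f ((tone : ℕ → R) k)) = tone := by
  funext k
  simp only [tone]
  split_ifs <;> simp

/-- The solution `b` of the equation `a b = c` in twisted power series, where `d` is the inverse
of `a_0`. -/
def tsolve (a c : ℕ → R) (d : R) : ℕ → R
  | k => d * (c k - ∑ j : Fin k, a (k - j) * (s ^ (k - (j : ℕ))) (tsolve a c d j))
decreasing_by exact j.2

theorem tmul_tsolve (a c : ℕ → R) (d : R) (hd : a 0 * d = 1) :
    tmul s a (tsolve s a c d) = c := by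
  funext k
  rw [tmul_apply, ← Finset.Nat.sum_antidiagonal_swap,
    Finset.Nat.sum_antidiagonal_eq_sum_range_succ_mk, Finset.sum_range_succ]
  simp only [Prod.swap, Nat.sub_self, pow_zero, RingHom.one_def, RingHom.id_apply]
  have : tsolve s a c d k = d * (c k - ∑ j ∈ Finset.range k,
      a (k - j) * (s ^ (k - j)) (tsolve s a c d j)) := by
    rw [tsolve, ← Fin.sum_univ_eq_sum_range
      (fun j => a (k - j) * (s ^ (k - j)) (tsolve s a c d j)) k]
  rw [this, ← mul_assoc, hd, one_mul]
  exact add_sub_cancel _ _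

/-- The product `τ_{a-1} ⋯ τ_1 τ_0` of twisted power series. -/
def tprod (τ : ℕ → ℕ → R) : ℕ → ℕ → R
  | 0 => tone
  | a + 1 => tmul s (τ a) (tprod τ a)

theorem tprod_zero_coeff {τ : ℕ → ℕ → R} (h : ∀ a, τ a 0 = 1) (N : ℕ) : tprod s τ N 0 = 1 := by
  induction N with
  | zero => simp [tprod, tone]
  | succ N ih => rw [tprod, tmul_zero, h, ih, one_mul]

theorem map_tprod {s : R →+* R} {s' : R' →+* R'} {f : R →+* R'}
    (h : ∀ x, f (s x) = s' (f x)) (τ : ℕ → ℕ → R) (N : ℕ) :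
    (fun k => f (tprod s τ N k)) = tprod s' (fun a k => f (τ a k)) N := by
  induction N with
  | zero => exact map_tone f
  | succ N ih => rw [tprod, tprod, map_tmul h, ih]

theorem tmul_eq_zero_of_lt {a b : ℕ → R} {A B : ℕ} (ha : ∀ k, A < k → a k = 0)
    (hb : ∀ k, B < k → b k = 0) {k : ℕ} (hk : A + B < k) : tmul s a b k = 0 := by
  rw [tmul_apply]
  refine Finset.sum_eq_zero fun p hp => ?_
  rw [Finset.HasAntidiagonal.mem_antidiagonal] at hp
  by_cases h : A < p.1
  · rw [ha _ h, zero_mul]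
  · rw [hb p.2 (by omega), map_zero, mul_zero]

theorem tmul_top {a b : ℕ → R} {A B : ℕ} (ha : ∀ k, A < k → a k = 0)
    (hb : ∀ k, B < k → b k = 0) : tmul s a b (A + B) = a A * (s ^ A) (b B) := by
  rw [tmul_apply, Finset.sum_eq_single (A, B)]
  · intro p hp hne
    rw [Finset.HasAntidiagonal.mem_antidiagonal] at hp
    by_cases h : A < p.1
    · rw [ha _ h, zero_mul]
    · have : p.1 ≠ A := fun h' => hne (Prod.ext h' (by simp only; omega))
      rw [hb p.2 (by omega), map_zero, mul_zero]
  · intro h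
    simp at h

/-- An ideal containing `2` is stable under `s`, because `s x ≡ x²` modulo `2`. -/
theorem pow_mem_of_frobenius {s : R →+* R} (hs : ∀ x, s x - x ^ 2 ∈ Ideal.span {(2 : R)})
    {J : Ideal R} (h2 : (2 : R) ∈ J) {x : R} (hx : x ∈ J) (k : ℕ) : (s ^ k) x ∈ J := by
  induction k generalizing x with
  | zero => simpa using hx
  | succ k ih =>
    rw [pow_succ, RingHom.mul_def, RingHom.comp_apply]
    apply ih
    have h1 : s x - x ^ 2 ∈ J := (Ideal.span_singleton_le_iff_mem J).mpr h2 (hs x)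
    have := J.add_mem h1 (J.pow_mem_of_mem hx 2 two_pos)
    rwa [sub_add_cancel] at this

/-- If the coefficients of a logarithm satisfy `ℓ = (2 - ℓ) T` in twisted power series, with `T`
integral, then they satisfy an integral functional equation, whose coefficients agree with those
of `T` modulo the preceding ones. -/
theorem exists_isFunctionalEquation {i : R →+* R'} {s : R →+* R} {sK : R' →+* R'}
    (hi : Function.Injective i) (h2 : IsUnit (2 : R')) (h2' : (2 : R) ∈ nonunits R)
    (hs : ∀ x, s x - x ^ 2 ∈ Ideal.span {(2 : R)}) (hc : ∀ x, sK (i x) = i (s x))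
    {T : ℕ → R} (hT : T 0 = 1) {l : ℕ → R'} (hl : l 0 = 1)
    (h : l = tmul sK (tone + tone - l) (fun k => i (T k))) :
    ∃ u : ℕ → R, IsFunctionalEquation i s sK u l ∧
      ∀ k, 1 ≤ k → T k - u k ∈ chromIdeal u k := by
  -- Multiplying `ℓ = (2 - ℓ) T` on the right by `T⁻¹` gives `ℓ T⁻¹ = 2 - ℓ`, that is `ℓ u = 2` with
  -- `u = 1 + T⁻¹`.
  set T' := tsolve s T tone 1 with hT'
  have hTT' : tmul s T T' = tone := tmul_tsolve s T tone 1 (by rw [hT, one_mul])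
  have hT'0 : T' 0 = 1 := by
    have := congrFun hTT' 0
    rw [tmul_zero, hT, one_mul] at this
    rw [this, tone, if_pos rfl]
  set u : ℕ → R := tone + T' with hu
  have hu0 : u 0 = 2 := by
    rw [hu, Pi.add_apply, hT'0, tone, if_pos rfl, one_add_one_eq_two]
  let iu : ℕ → R' := fun k => i (u k)
  let iT : ℕ → R' := fun k => i (T k)
  let iT' : ℕ → R' := fun k => i (T' k)
  have hiu : iu = tone + iT' := by
    funext k
    have := congrFun (map_tone i) k
    simp only [iu, iT', hu, Pi.add_apply, map_add]
    rw [← this]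
  have hiTT' : tmul sK iT iT' = tone := by
    rw [← map_tmul (fun x => (hc x).symm), hTT', map_tone]
  have hlT' : tmul sK l iT' = tone + tone - l := by
    nth_rw 1 [h]
    rw [tmul_assoc, hiTT', tmul_tone]
  have hlu : tmul sK l iu = tone + tone := by
    rw [hiu, tmul_add, tmul_tone, hlT']
    abel
  obtain ⟨d, hd⟩ := h2
  -- The functional equation needs `u ℓ = 2` rather than `ℓ u = 2`, and the product is not
  -- commutative. A right inverse `w` of `u` over `R'` gives `ℓ = ℓ u w = 2 w`, hence `u ℓ = 2`.
  set w := tsolve sK iu tone (↑d⁻¹ : R') with hw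
  have huw : tmul sK iu w = tone := by
    refine tmul_tsolve sK iu tone _ ?_
    have : iu 0 = 2 := by simp only [iu, hu0, map_ofNat]
    rw [this, ← hd, Units.mul_inv]
  have hlw : l = w + w := by
    rw [← tmul_tone sK l, ← huw, ← tmul_assoc, hlu, add_tmul, tone_tmul]
  have hul : tmul sK iu l = tone + tone := by
    rw [hlw, tmul_add, huw]
  refine ⟨u, ⟨hi, ⟨d, hd⟩, h2', hs, hc, hu0, hl, ?_⟩, ?_⟩
  · intro k hk
    have := congrFun hul k
    rw [tmul_apply, Pi.add_apply, tone, if_neg (by omega), add_zero] at this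
    exact this
  · intro k hk
    -- In degree `k ≥ 1` of `T u = T + 1` the term with index `0` is `u_k`; the other terms involve
    -- twists of `u_j` with `j < k`, and these lie in the ideal.
    have hTu : tmul s T u = T + tone := by
      rw [hu, tmul_add, tmul_tone, hTT']
    have h1 := congrFun hTu k
    rw [Pi.add_apply, tone, if_neg (by omega), add_zero] at h1
    obtain ⟨k, rfl⟩ : ∃ k', k = k' + 1 := ⟨k - 1, by omega⟩
    rw [tmul_apply, Finset.Nat.sum_antidiagonal_succ] at h1
    simp only [hT, one_mul, pow_zero, RingHom.one_def, RingHom.id_apply] at h1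
    rw [← h1, add_sub_cancel_left]
    refine Ideal.sum_mem _ fun p hp => Ideal.mul_mem_left _ _ ?_
    rw [Finset.HasAntidiagonal.mem_antidiagonal] at hp
    refine pow_mem_of_frobenius hs (two_mem_chromIdeal _ _) ?_ _
    rcases Nat.eq_zero_or_pos p.2 with h0 | h0
    · rw [h0, hu0]; exact two_mem_chromIdeal _ _
    · exact mem_chromIdeal h0 (by omega)

end TwistedProducts

/-! ### The coefficient ring `ℤ_(2)` and the lift of Frobenius on polynomials. -/

section Rationalization

/-- The embedding `ℤ_(2) → ℚ`. -/
def zLocTwoToRat : ZLocTwo →+* ℚ :=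
  IsLocalization.lift (M := (Ideal.span {(2 : ℤ)}).primeCompl) (g := Int.castRingHom ℚ) fun y => by
    have h0 : (y : ℤ) ≠ 0 := fun h => y.2 (h ▸ Ideal.zero_mem _)
    exact IsUnit.mk0 _ (by simpa using h0)

theorem zLocTwoToRat_injective : Function.Injective zLocTwoToRat := by
  rw [zLocTwoToRat, IsLocalization.lift_injective_iff]
  intro x y
  have h1 : Function.Injective (algebraMap ℤ ZLocTwo) :=
    IsLocalization.injective (M := (Ideal.span {(2 : ℤ)}).primeCompl) _
      (Ideal.primeCompl_le_nonZeroDivisors _)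
  rw [h1.eq_iff]
  simp

theorem zLocTwo_ringHom_ext {R : Type*} [CommRing R] (f g : ZLocTwo →+* R) : f = g :=
  IsLocalization.ringHom_ext (Ideal.span {(2 : ℤ)}).primeCompl (Subsingleton.elim _ _)

/-- For `a = x/s` with `s` odd one has `s² (a - a²) = x (s - x)`, which is even whatever the parity
of `x`. -/
theorem zLocTwo_sub_sq_mem (a : ZLocTwo) : a - a ^ 2 ∈ Ideal.span {(2 : ZLocTwo)} := by
  obtain ⟨x, s, rfl⟩ := IsLocalization.exists_mk'_eq (Ideal.span {(2 : ℤ)}).primeCompl a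
  set a := IsLocalization.mk' ZLocTwo x s
  have ha : a * algebraMap ℤ ZLocTwo s = algebraMap ℤ ZLocTwo x := IsLocalization.mk'_spec _ x s
  have hu : IsUnit (algebraMap ℤ ZLocTwo s) := IsLocalization.map_units _ s
  have hs : ¬ (2 : ℤ) ∣ s := fun h => s.2 (Ideal.mem_span_singleton.mpr h)
  have h2 : (2 : ℤ) ∣ x * s - x ^ 2 := by
    rw [show x * s - x ^ 2 = x * (s - x) by ring]
    rcases Int.emod_two_eq_zero_or_one x with h | h
    · exact Dvd.dvd.mul_right (by omega) _
    · exact Dvd.dvd.mul_left (by omega) _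
  rw [Ideal.mem_span_singleton]
  have h3 := map_dvd (algebraMap ℤ ZLocTwo) h2
  rw [map_sub, map_mul, map_pow, ← ha, map_ofNat] at h3
  rw [← (hu.pow 2).dvd_mul_right]
  convert h3 using 1
  ring

/-- The reduction `ℤ_(2) → 𝔽_2`. -/
def zLocTwoToZMod : ZLocTwo →+* ZMod 2 :=
  IsLocalization.lift (M := (Ideal.span {(2 : ℤ)}).primeCompl) (g := Int.castRingHom (ZMod 2))
    fun y => by
      have h0 : ¬ (2 : ℤ) ∣ y := fun h => y.2 (Ideal.mem_span_singleton.mpr h)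
      have : ((y : ℤ) : ZMod 2) ≠ 0 := fun h => h0 ((ZMod.intCast_zmod_eq_zero_iff_dvd _ 2).mp h)
      exact IsUnit.mk0 _ this

variable (ι : Type*)

theorem expand_two_sub_sq_mem (x : MvPolynomial ι ZLocTwo) :
    (MvPolynomial.expand 2 : MvPolynomial ι ZLocTwo →ₐ[ZLocTwo] _).toRingHom x - x ^ 2 ∈
      Ideal.span {(2 : MvPolynomial ι ZLocTwo)} := by
  induction x using MvPolynomial.induction_on with
  | C a =>
    have h := Ideal.mem_map_of_mem (MvPolynomial.C (σ := ι)) (zLocTwo_sub_sq_mem a)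
    rw [Ideal.map_span, Set.image_singleton, map_sub, map_pow, map_ofNat] at h
    simpa using h
  | add x y hx hy =>
    have h := Ideal.sub_mem _ (Ideal.add_mem _ hx hy) (Ideal.mul_mem_right (x * y) _
      (Ideal.mem_span_singleton_self (2 : MvPolynomial ι ZLocTwo)))
    rw [_root_.map_add]
    convert h using 1
    ring
  | mul_X x p hx =>
    have h := Ideal.mul_mem_right (MvPolynomial.X p ^ 2) _ hx
    rw [_root_.map_mul]
    convert h using 1
    simp only [AlgHom.toRingHom_eq_coe, RingHom.coe_coe, MvPolynomial.expand_X]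
    ring

theorem two_mem_nonunits_mvPolynomial :
    (2 : MvPolynomial ι ZLocTwo) ∈ nonunits (MvPolynomial ι ZLocTwo) := by
  intro h
  have := h.map (MvPolynomial.eval₂Hom zLocTwoToZMod (fun _ : ι => (0 : ZMod 2)))
  rw [map_ofNat] at this
  exact not_isUnit_zero (M₀ := ZMod 2) (by rwa [show (2 : ZMod 2) = 0 from rfl] at this)

end Rationalization

/-! ### Two-typicality in terms of coefficients of logarithms. -/

section TensorRat

variable (S : Type*) [CommRing S]

/-- The rationalization `S ⊗ ℚ` of a commutative ring. -/
def TensorRat : Type _ := S ⊗[ℤ] ℚ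

instance : CommRing (TensorRat S) := inferInstanceAs (CommRing (S ⊗[ℤ] ℚ))

/-- The canonical map `S → S ⊗ ℚ`. -/
def toTensorRat : S →+* TensorRat S :=
  (Algebra.TensorProduct.includeLeft : S →ₐ[ℤ] S ⊗[ℤ] ℚ).toRingHom

/-- The canonical map `ℚ → S ⊗ ℚ`. -/
def ratToTensorRat : ℚ →+* TensorRat S :=
  (Algebra.TensorProduct.includeRight : ℚ →ₐ[ℤ] S ⊗[ℤ] ℚ).toRingHom

theorem isTwoTypical_iff (F : FormalGroup S) : IsTwoTypical F ↔
    ∃ l : ℕ → TensorRat S, IsLog (F.map (toTensorRat S)) (twoTypicalSeries l) := by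
  constructor
  · rintro ⟨L, hL, h⟩
    exact ⟨fun k => PowerSeries.coeff (2 ^ k) L,
      eq_twoTypicalSeries h ▸ isStrictIso_additive_iff.mp hL⟩
  · rintro ⟨l, hl⟩
    exact ⟨twoTypicalSeries l, isStrictIso_additive_iff.mpr hl,
      fun d hd => coeff_twoTypicalSeries_of_ne l hd⟩

-- Carries the logarithm over `S ⊗ ℚ` supplied by two-typicality to any `ℚ`-algebra under `S`, in
-- particular to a polynomial ring over `ℚ`.
variable {S} in
theorem exists_ofTensorRat {K : Type*} [CommRing K] [Algebra ℚ K] (i : S →+* K) :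
    ∃ ξ : TensorRat S →+* K, ξ.comp (toTensorRat S) = i := by
  refine ⟨(Algebra.TensorProduct.lift i.toIntAlgHom (algebraMap ℚ K).toIntAlgHom
    fun _ _ => Commute.all _ _).toRingHom, ?_⟩
  ext x
  refine (Algebra.TensorProduct.lift_tmul i.toIntAlgHom (algebraMap ℚ K).toIntAlgHom
    (fun _ _ => Commute.all _ _) x 1).trans (?_ : _ = i x)
  rw [map_one, mul_one]
  rfl

end TensorRat

/-! ### The rationalization of `R_n` with its action. -/

section RnRational

variable (n : ℕ)

/-- The rationalization `ℚ[γ^j t_i]` of `R_n`. -/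
abbrev RnRat : Type := MvPolynomial (Fin (2 ^ (n - 1)) × ℕ) ℚ

/-- The embedding of `R_n` into its rationalization. -/
def toRat : Rn n →+* RnRat n := MvPolynomial.map zLocTwoToRat

theorem toRat_injective : Function.Injective (toRat n) :=
  MvPolynomial.map_injective _ zLocTwoToRat_injective

/-- The action of `γ` on the rationalization of `R_n`. -/
def gammaRat : RnRat n →+* RnRat n :=
  (MvPolynomial.aeval fun p : Fin (2 ^ (n - 1)) × ℕ =>
    if hp : (p.1 : ℕ) + 1 < 2 ^ (n - 1) then
      (MvPolynomial.X (⟨(p.1 : ℕ) + 1, hp⟩, p.2) : RnRat n)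
    else
      -MvPolynomial.X (⟨0, Nat.two_pow_pos _⟩, p.2) : RnRat n →ₐ[ℚ] RnRat n).toRingHom

theorem gammaRat_toRat (x : Rn n) : gammaRat n (toRat n x) = toRat n (gamma n x) := by
  have : (gammaRat n).comp (toRat n) = (toRat n).comp (gamma n) := by
    apply MvPolynomial.ringHom_ext
    · intro a
      simp [gammaRat, toRat, gamma]
    · intro p
      simp only [gammaRat, toRat, gamma, RingHom.comp_apply, AlgHom.toRingHom_eq_coe,
        RingHom.coe_coe, MvPolynomial.aeval_X, MvPolynomial.map_X]
      split_ifs <;> simp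
  exact congrArg (fun f : Rn n →+* RnRat n => f x) this

theorem expand_toRat (x : Rn n) :
    (MvPolynomial.expand 2 : RnRat n →ₐ[ℚ] _).toRingHom (toRat n x) =
      toRat n ((MvPolynomial.expand 2 : Rn n →ₐ[ZLocTwo] _).toRingHom x) :=
  (MvPolynomial.map_expand _ _ _).symm

theorem gamma_pow_t {a i : ℕ} (ha : a < 2 ^ (n - 1)) :
    (gamma n ^ a) (t n (i + 1)) = MvPolynomial.X (⟨a, ha⟩, i) := by
  induction a with
  | zero => simp [t]
  | succ a ih =>
    rw [pow_succ', RingHom.mul_def, RingHom.comp_apply, ih (by omega)]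
    simp [gamma, ha]

theorem gamma_pow_t_top (i : ℕ) : (gamma n ^ 2 ^ (n - 1)) (t n (i + 1)) = -t n (i + 1) := by
  have h := Nat.two_pow_pos (n - 1)
  obtain ⟨N, hN⟩ : ∃ N, 2 ^ (n - 1) = N + 1 := ⟨2 ^ (n - 1) - 1, by omega⟩
  have hp : gamma n ^ 2 ^ (n - 1) = gamma n * gamma n ^ N := by
    rw [← pow_succ']
    exact congrArg (gamma n ^ ·) hN
  rw [hp, RingHom.mul_def, RingHom.comp_apply, gamma_pow_t n (show N < 2 ^ (n - 1) by omega)]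
  simp [gamma, hN, t]

theorem expand_gamma_pow_t {a : ℕ} (ha : a < 2 ^ (n - 1)) (k : ℕ) :
    (MvPolynomial.expand 2 : Rn n →ₐ[ZLocTwo] _).toRingHom ((gamma n ^ a) (t n k)) =
      ((gamma n ^ a) (t n k)) ^ 2 := by
  cases k with
  | zero => simp [t]
  | succ k => rw [gamma_pow_t n ha]; simp

/-- Carries a logarithm over `ℚ[γ^j t_i]` to `R_n ⊗ ℚ`, where two-typicality is formulated. -/
theorem exists_toTensor : ∃ ξ : RnRat n →+* TensorRat (Rn n),
    ξ.comp (toRat n) = toTensorRat (Rn n) := by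
  refine ⟨MvPolynomial.eval₂Hom (ratToTensorRat (Rn n))
    fun p => toTensorRat (Rn n) (MvPolynomial.X p), ?_⟩
  apply MvPolynomial.ringHom_ext
  · intro a
    exact congrArg (fun f : ZLocTwo →+* TensorRat (Rn n) => f a)
      (zLocTwo_ringHom_ext (((MvPolynomial.eval₂Hom (ratToTensorRat (Rn n))
        fun p => toTensorRat (Rn n) (MvPolynomial.X p)).comp (toRat n)).comp MvPolynomial.C)
        ((toTensorRat (Rn n)).comp MvPolynomial.C))
  · intro p
    simp [toRat]

end RnRational

/-! ### The canonical logarithm and the identity `ℓ = (2 - ℓ) T`. -/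

section CanonicalLog

/-- The relations between the coefficients of the logarithm of the canonical formal group law over
`R_n`. -/
structure IsCanonicalLog (n : ℕ) (l : ℕ → RnRat n) : Prop where
  zero : l 0 = 1
  rel : ∀ k, l k = ∑ p ∈ Finset.HasAntidiagonal.antidiagonal k,
    gammaRat n (l p.1) * toRat n (t n p.2) ^ 2 ^ p.1
  neg : ∀ k, 1 ≤ k → (gammaRat n ^ 2 ^ (n - 1)) (l k) = -l k

variable (n : ℕ)

/-- The part of the relation expressing `ℓ_k` that involves only the `ℓ_j` with `j < k`. -/
def logTail (l : ℕ → RnRat n) (k : ℕ) : RnRat n :=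
  ∑ j ∈ Finset.range k, gammaRat n (l j) * toRat n (t n (k - j)) ^ 2 ^ j

theorem logTail_congr {l l' : ℕ → RnRat n} {k : ℕ} (h : ∀ j < k, l j = l' j) :
    logTail n l k = logTail n l' k :=
  Finset.sum_congr rfl fun j hj => by rw [h j (Finset.mem_range.mp hj)]

theorem sum_antidiagonal_eq_logTail (l : ℕ → RnRat n) (k : ℕ) :
    ∑ p ∈ Finset.HasAntidiagonal.antidiagonal k,
      gammaRat n (l p.1) * toRat n (t n p.2) ^ 2 ^ p.1 = logTail n l k + gammaRat n (l k) := by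
  rw [Finset.Nat.sum_antidiagonal_eq_sum_range_succ_mk, Finset.sum_range_succ]
  simp [logTail, t]

theorem gammaRat_pow_toRat (a : ℕ) (x : Rn n) :
    (gammaRat n ^ a) (toRat n x) = toRat n ((gamma n ^ a) x) :=
  (map_pow_of_comm (fun x => (gammaRat_toRat n x).symm) a x).symm

theorem gammaRat_pow_succ (a : ℕ) (x : RnRat n) :
    (gammaRat n ^ a) (gammaRat n x) = (gammaRat n ^ (a + 1)) x := by
  rw [pow_succ, RingHom.mul_def, RingHom.comp_apply]

theorem gammaRat_pow_succ' (a : ℕ) (x : RnRat n) :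
    gammaRat n ((gammaRat n ^ a) x) = (gammaRat n ^ (a + 1)) x := by
  rw [pow_succ', RingHom.mul_def, RingHom.comp_apply]

/-- In the term with `j = 0` the sign comes from `t_k` itself, since `ℓ_0 = 1`. For `j ≥ 1` the
factor `t_{k-j}` occurs to an even power and the sign comes from `ℓ_j`. -/
theorem gammaRat_pow_logTail {l : ℕ → RnRat n} {k : ℕ} (h0 : l 0 = 1)
    (h : ∀ j, 1 ≤ j → j < k → (gammaRat n ^ 2 ^ (n - 1)) (l j) = -l j) :
    (gammaRat n ^ 2 ^ (n - 1)) (logTail n l k) = -logTail n l k := by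
  rw [logTail, map_sum, ← Finset.sum_neg_distrib]
  refine Finset.sum_congr rfl fun j hj => ?_
  have hj := Finset.mem_range.mp hj
  obtain ⟨i, hi⟩ : ∃ i, k - j = i + 1 := ⟨k - j - 1, by omega⟩
  rw [map_mul, gammaRat_pow_succ, ← gammaRat_pow_succ', map_pow, gammaRat_pow_toRat, hi,
    gamma_pow_t_top, map_neg]
  rcases Nat.eq_zero_or_pos j with rfl | hj0
  · simp [h0]
  · rw [h j hj0 hj, map_neg, Even.neg_pow ((Nat.even_pow' hj0.ne').mpr even_two), neg_mul]

/-- The coefficients of the logarithm of the canonical formal group law over `R_n`. -/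
def canonicalLog : ℕ → RnRat n
  | 0 => 1
  -- The relation reads `ℓ_k - γ ℓ_k = ` tail. Summing its conjugates under `γ^a` for `a < 2^(n-1)`
  -- telescopes to `ℓ_k - γ^(2^(n-1)) ℓ_k = 2 ℓ_k`, which forces this formula.
  | k + 1 => MvPolynomial.C (1 / 2) * ∑ a ∈ Finset.range (2 ^ (n - 1)), (gammaRat n ^ a)
      (∑ j : Fin (k + 1), gammaRat n (canonicalLog j) * toRat n (t n (k + 1 - j)) ^ 2 ^ (j : ℕ))
decreasing_by exact j.2

theorem C_half_mul (x : RnRat n) : MvPolynomial.C (1 / 2) * (2 * x) = x := by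
  have : (2 : RnRat n) = MvPolynomial.C 2 := (map_ofNat MvPolynomial.C 2).symm
  rw [← mul_assoc, this, ← MvPolynomial.C_mul]
  norm_num

theorem two_mul_C_half_mul (x : RnRat n) : 2 * (MvPolynomial.C (1 / 2) * x) = x := by
  rw [mul_left_comm, C_half_mul]

theorem canonicalLog_zero : canonicalLog n 0 = 1 := by rw [canonicalLog]

theorem two_mul_canonicalLog {k : ℕ} (hk : 1 ≤ k) : 2 * canonicalLog n k =
    ∑ a ∈ Finset.range (2 ^ (n - 1)), (gammaRat n ^ a) (logTail n (canonicalLog n) k) := by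
  obtain ⟨k, rfl⟩ : ∃ k', k = k' + 1 := ⟨k - 1, by omega⟩
  rw [canonicalLog, two_mul_C_half_mul, logTail, ← Fin.sum_univ_eq_sum_range
    (fun j => gammaRat n (canonicalLog n j) * toRat n (t n (k + 1 - j)) ^ 2 ^ j)]

theorem sum_gammaRat_pow_sub (x : RnRat n) (N : ℕ) :
    ∑ a ∈ Finset.range N, (gammaRat n ^ a) (x - gammaRat n x) = x - (gammaRat n ^ N) x := by
  simp_rw [map_sub, gammaRat_pow_succ]
  rw [Finset.sum_range_sub' (fun a => (gammaRat n ^ a) x)]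
  simp

theorem eq_of_two_mul {x y : RnRat n} (h : 2 * x = 2 * y) : x = y := by
  rw [← C_half_mul n x, h, C_half_mul]

theorem isCanonicalLog_canonicalLog : IsCanonicalLog n (canonicalLog n) := by
  have hneg : ∀ k, 1 ≤ k → (gammaRat n ^ 2 ^ (n - 1)) (canonicalLog n k) = -canonicalLog n k := by
    intro k
    induction k using Nat.strong_induction_on with
    | _ k ih =>
      intro hk
      apply eq_of_two_mul
      have h2 : ∀ x : RnRat n, 2 * (gammaRat n ^ 2 ^ (n - 1)) x =
        (gammaRat n ^ 2 ^ (n - 1)) (2 * x) := fun x => by rw [map_mul, map_ofNat]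
      rw [h2, mul_neg, two_mul_canonicalLog n hk, map_sum, ← Finset.sum_neg_distrib]
      refine Finset.sum_congr rfl fun a _ => ?_
      rw [← RingHom.comp_apply, ← RingHom.mul_def, ← pow_add, add_comm, pow_add, RingHom.mul_def,
        RingHom.comp_apply, gammaRat_pow_logTail n (canonicalLog_zero n) fun j h1 hj => ih j hj h1,
        map_neg]
  refine ⟨canonicalLog_zero n, ?_, hneg⟩
  intro k
  rw [sum_antidiagonal_eq_logTail]
  rcases Nat.eq_zero_or_pos k with rfl | hk
  · simp [canonicalLog_zero, logTail]
  · have hg : 2 * gammaRat n (canonicalLog n k) = ∑ a ∈ Finset.range (2 ^ (n - 1)),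
        (gammaRat n ^ (a + 1)) (logTail n (canonicalLog n) k) := by
      have := congrArg (gammaRat n) (two_mul_canonicalLog n hk)
      rw [map_mul, map_ofNat, map_sum] at this
      simpa only [gammaRat_pow_succ'] using this
    have hs := Finset.sum_range_sub' (fun a => (gammaRat n ^ a) (logTail n (canonicalLog n) k))
      (2 ^ (n - 1))
    rw [Finset.sum_sub_distrib, ← two_mul_canonicalLog n hk, ← hg,
      gammaRat_pow_logTail n (canonicalLog_zero n) fun j h1 _ => hneg j h1] at hs
    simp only [pow_zero, RingHom.one_def, RingHom.id_apply] at hs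
    apply eq_of_two_mul
    linear_combination hs

variable {n} in
theorem IsCanonicalLog.eq {l : ℕ → RnRat n} (h : IsCanonicalLog n l) : l = canonicalLog n := by
  funext k
  induction k using Nat.strong_induction_on with
  | _ k ih =>
    rcases Nat.eq_zero_or_pos k with rfl | hk
    · rw [h.zero, canonicalLog_zero]
    · apply eq_of_two_mul
      rw [two_mul_canonicalLog n hk, ← logTail_congr n ih]
      have hr := h.rel k
      rw [sum_antidiagonal_eq_logTail] at hr
      rw [← sub_eq_iff_eq_add.mpr hr, sum_gammaRat_pow_sub, h.neg k hk]
      ring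

/-- The twisted power series `∑ γ^a(t_i) V^i`. -/
def tau (a k : ℕ) : Rn n := (gamma n ^ a) (t n k)

/-- Squaring of the variables, as a lift of Frobenius to `R_n`. -/
def frob : Rn n →+* Rn n := (MvPolynomial.expand 2 : Rn n →ₐ[ZLocTwo] _).toRingHom

/-- Squaring of the variables on the rationalization of `R_n`. -/
def frobRat : RnRat n →+* RnRat n := (MvPolynomial.expand 2 : RnRat n →ₐ[ℚ] _).toRingHom

theorem frob_pow_tau {a : ℕ} (ha : a < 2 ^ (n - 1)) (j k : ℕ) :
    (frob n ^ j) (tau n a k) = tau n a k ^ 2 ^ j := by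
  induction j with
  | zero => simp
  | succ j ih =>
    rw [pow_succ', RingHom.mul_def, RingHom.comp_apply, ih, map_pow,
      show frob n (tau n a k) = tau n a k ^ 2 from expand_gamma_pow_t n ha k, ← pow_mul,
      ← pow_succ']

theorem frobRat_toRat (x : Rn n) : frobRat n (toRat n x) = toRat n (frob n x) := expand_toRat n x

-- The relation says `ℓ = γ(ℓ) τ_0`, because the lift of Frobenius squares `t_i`; applying `γ^a`
-- gives `γ^a(ℓ) = γ^(a+1)(ℓ) τ_a`. The bound on `N` keeps the coefficients of the `τ_a` among the
-- variables: `-t_i` is not sent to its square.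
variable {n} in
theorem IsCanonicalLog.eq_tmul_tprod {l : ℕ → RnRat n} (h : IsCanonicalLog n l) {N : ℕ}
    (hN : N ≤ 2 ^ (n - 1)) : l = tmul (frobRat n) (fun k => (gammaRat n ^ N) (l k))
      (fun k => toRat n (tprod (frob n) (tau n) N k)) := by
  induction N with
  | zero =>
    simp only [tprod, pow_zero, RingHom.one_def, RingHom.id_apply]
    rw [map_tone, tmul_tone]
  | succ N ih =>
    have h1 := ih (by omega)
    rw [tprod, map_tmul (fun x => (frobRat_toRat n x).symm), ← tmul_assoc]
    nth_rw 1 [h1]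
    congr 1
    funext k
    have := congrArg (gammaRat n ^ N) (h.rel k)
    rw [this, map_sum, tmul_apply]
    refine Finset.sum_congr rfl fun p _ => ?_
    rw [map_mul, gammaRat_pow_succ, map_pow, gammaRat_pow_toRat,
      ← map_pow_of_comm (fun x => (frobRat_toRat n x).symm), frob_pow_tau n (by omega), map_pow]
    rfl

/-- The coefficients of the twisted power series `T = τ_{N-1} ⋯ τ_0`, where `N = 2^(n-1)` and
`τ_a = ∑ γ^a(t_i) V^i`. -/
def bigT : ℕ → Rn n := tprod (frob n) (tau n) (2 ^ (n - 1))

theorem bigT_zero : bigT n 0 = 1 := tprod_zero_coeff _ (fun a => by simp [tau, t]) _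

/-- The element `γ^(2^(n-1))` fixes `ℓ_0 = 1` and negates every other `ℓ_k`, so it sends `ℓ` to `2 -
ℓ`. -/
theorem canonicalLog_eq_tmul : canonicalLog n = tmul (frobRat n) (tone + tone - canonicalLog n)
    (fun k => toRat n (bigT n k)) := by
  have h := isCanonicalLog_canonicalLog n
  nth_rw 1 [h.eq_tmul_tprod le_rfl]
  congr 1
  funext k
  rcases Nat.eq_zero_or_pos k with rfl | hk
  · rw [Pi.sub_apply, Pi.add_apply, canonicalLog_zero, tone, if_pos rfl, map_one]
    ring
  · rw [h.neg k hk, Pi.sub_apply, Pi.add_apply, tone, if_neg (by omega)]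
    ring

theorem exists_isFunctionalEquation_canonicalLog : ∃ u : ℕ → Rn n,
    IsFunctionalEquation (toRat n) (frob n) (frobRat n) u (canonicalLog n) ∧
      ∀ k, 1 ≤ k → bigT n k - u k ∈ chromIdeal u k := by
  refine exists_isFunctionalEquation (toRat_injective n) ?_ (two_mem_nonunits_mvPolynomial _)
    (expand_two_sub_sq_mem _) (frobRat_toRat n) (bigT_zero n) (canonicalLog_zero n)
    (canonicalLog_eq_tmul n)
  exact IsUnit.of_mul_eq_one (MvPolynomial.C (1 / 2)) (by simpa using two_mul_C_half_mul n 1)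

end CanonicalLog

/-! ### Existence and uniqueness of the canonical formal group law. -/

section CanonicalFormalGroup

theorem formalGroup_map_map {S S' S'' : Type*} [CommRing S] [CommRing S'] [CommRing S'']
    (F : FormalGroup S) (f : S →+* S') (g : S' →+* S'') : (F.map f).map g = F.map (g.comp f) := by
  apply FormalGroup.ext
  exact MvPowerSeries.ext fun e => by
    change MvPowerSeries.coeff e (MvPowerSeries.map g (MvPowerSeries.map f F.toPowerSeries)) =
      MvPowerSeries.coeff e (MvPowerSeries.map (g.comp f) F.toPowerSeries)
    simp

theorem map_subst_of_constantCoeff_zero {S K : Type*} [CommRing S] [CommRing K] (j : S →+* K)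
    {a : PowerSeries S} (ha : PowerSeries.constantCoeff a = 0) (f : PowerSeries S) :
    PowerSeries.map j (PowerSeries.subst a f) =
      PowerSeries.subst (PowerSeries.map j a) (PowerSeries.map j f) :=
  PowerSeries.map_subst (h := j) (PowerSeries.HasSubst.of_constantCoeff_zero' ha) f

/-- Among the exponents `2^k` only `2^0` is odd. -/
theorem neg_subst_neg_X_twoTypicalSeries {K : Type*} [CommRing K] (l : ℕ → K) :
    -PowerSeries.subst (-PowerSeries.X : PowerSeries K) (twoTypicalSeries l) =
      twoTypicalSeries fun k => if k = 0 then l 0 else -l k := by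
  have hX0 : PowerSeries.constantCoeff (-PowerSeries.X : PowerSeries K) = 0 := by simp
  have hpow : ∀ e : ℕ, (-PowerSeries.X : PowerSeries K) ^ e =
      PowerSeries.C ((-1) ^ e) * PowerSeries.X ^ e := fun e => by
    rw [neg_pow, map_pow, map_neg, map_one]
  ext d
  rw [map_neg, PowerSeries.coeff_subst' (PowerSeries.HasSubst.of_constantCoeff_zero hX0),
    finsum_eq_single _ d]
  · rw [hpow, PowerSeries.coeff_C_mul, PowerSeries.coeff_X_pow_self, mul_one, smul_eq_mul]
    by_cases hd : ∃ k, d = 2 ^ k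
    · obtain ⟨k, rfl⟩ := hd
      rw [coeff_twoTypicalSeries_two_pow, coeff_twoTypicalSeries_two_pow]
      rcases Nat.eq_zero_or_pos k with rfl | hk
      · simp
      · rw [if_neg hk.ne', Even.neg_one_pow ((Nat.even_pow' hk.ne').mpr even_two), mul_one]
    · push Not at hd
      rw [coeff_twoTypicalSeries_of_ne _ hd, coeff_twoTypicalSeries_of_ne _ hd, zero_mul, neg_zero]
  · intro e he
    rw [hpow, PowerSeries.coeff_C_mul, PowerSeries.coeff_X_pow, if_neg (Ne.symm he), mul_zero,
      smul_zero]

variable {n : ℕ} {F : FormalGroup (Rn n)}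

theorem gammaRat_pow_comp_toRat (a : ℕ) :
    (gammaRat n ^ a).comp (toRat n) = (toRat n).comp (gamma n ^ a) :=
  RingHom.ext fun x => gammaRat_pow_toRat n a x

theorem isLog_map_gamma_pow {l : ℕ → RnRat n} (h : IsLog (F.map (toRat n)) (twoTypicalSeries l))
    (a : ℕ) : IsLog ((F.map (gamma n ^ a)).map (toRat n))
      (twoTypicalSeries fun k => (gammaRat n ^ a) (l k)) := by
  rw [formalGroup_map_map, ← gammaRat_pow_comp_toRat, ← formalGroup_map_map, ← map_twoTypicalSeries]
  exact h.map _

theorem isLog_map_gamma {l : ℕ → RnRat n} (h : IsLog (F.map (toRat n)) (twoTypicalSeries l)) :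
    IsLog ((F.map (gamma n)).map (toRat n)) (twoTypicalSeries fun k => gammaRat n (l k)) := by
  have := isLog_map_gamma_pow h 1
  rwa [pow_one, pow_one] at this

theorem subst_psi {l : ℕ → RnRat n} (h : IsLog (F.map (toRat n)) (twoTypicalSeries l)) :
    PowerSeries.subst (PowerSeries.map (toRat n) (psi n F))
      (twoTypicalSeries fun k => gammaRat n (l k)) =
    twoTypicalSeries fun k => ∑ p ∈ Finset.HasAntidiagonal.antidiagonal k,
      gammaRat n (l p.1) * toRat n (t n p.2) ^ 2 ^ p.1 :=
  (isLog_map_gamma h).subst_formalSum (t n)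

theorem constantCoeff_psi (F : FormalGroup (Rn n)) : PowerSeries.constantCoeff (psi n F) = 0 :=
  constantCoeff_formalSum _ _

theorem constantCoeff_psiComp (F : FormalGroup (Rn n)) (a : ℕ) :
    PowerSeries.constantCoeff (psiComp n F a) = 0 := by
  induction a with
  | zero => exact PowerSeries.constantCoeff_X
  | succ a ih => exact constantCoeff_subst_zero ih (constantCoeff_map_zero (constantCoeff_psi F) _)

variable (n) in
/-- A formal group law over `R_n` whose logarithm has the canonical coefficients is canonical. -/
theorem isCanonical_of_isLog (hcomm : F.IsComm)
    (h : IsLog (F.map (toRat n)) (twoTypicalSeries (canonicalLog n))) : IsCanonical n F := by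
  have hl := isCanonicalLog_canonicalLog n
  have hψ : PowerSeries.subst (PowerSeries.map (toRat n) (psi n F))
      (twoTypicalSeries fun k => gammaRat n (canonicalLog n k)) =
      twoTypicalSeries (canonicalLog n) := by
    rw [subst_psi h]
    exact congrArg _ (funext fun k => (hl.rel k).symm)
  have hconj : (twoTypicalSeries fun k => (gammaRat n ^ 2 ^ (n - 1)) (canonicalLog n k)) =
      -PowerSeries.subst (-PowerSeries.X : PowerSeries (RnRat n))
        (twoTypicalSeries (canonicalLog n)) := by
    rw [neg_subst_neg_X_twoTypicalSeries]
    congr 1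
    funext k
    split_ifs with hk
    · rw [hk, hl.zero, map_one]
    · exact hl.neg k (Nat.pos_of_ne_zero hk)
  have hlog := isLog_map_gamma_pow h (2 ^ (n - 1))
  have hX := fun k : Fin 2 => show MvPowerSeries.constantCoeff
    (-MvPowerSeries.X k : MvPowerSeries (Fin 2) (Rn n)) = 0 by simp
  refine ⟨hcomm, ?_, ?_, ?_, ?_⟩
  · obtain ⟨ξ, hξ⟩ := exists_toTensor n
    refine (isTwoTypical_iff _ F).mpr ⟨fun k => ξ (canonicalLog n k), ?_⟩
    rw [← hξ, ← formalGroup_map_map, ← map_twoTypicalSeries]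
    exact h.map ξ
  · refine IsStrictIso.of_map (toRat_injective n) ?_
    refine isStrictIso_of_isLog (constantCoeff_map_zero (constantCoeff_psi F) _) ?_ h
      (isLog_map_gamma h) hψ
    rw [PowerSeries.coeff_map, psi, coeff_one_formalSum, t, map_one]
  · rw [hconj] at hlog
    have := conj_of_isLog h hlog
    apply map_injective (toRat_injective n)
    refine this.trans ?_
    rw [map_neg, map_formalGroup_subst F _ (hX 0) (hX 1)]
    simp only [map_neg, MvPowerSeries.map_X]
  -- The composite of the first `a` isomorphisms pulls the logarithm of `F^(γ^a)` back to that of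
  -- `F`.
  · have hcomp : ∀ a, PowerSeries.subst (PowerSeries.map (toRat n) (psiComp n F a))
        (twoTypicalSeries fun k => (gammaRat n ^ a) (canonicalLog n k)) =
        twoTypicalSeries (canonicalLog n) := by
      intro a
      induction a with
      | zero => simp [psiComp, PowerSeries.map_X, PowerSeries.X_subst]
      | succ a ih =>
        have hc0 := constantCoeff_map_zero (constantCoeff_psiComp F a) (toRat n)
        have hp0 := constantCoeff_map_zero (constantCoeff_psi F) (toRat n)
        have hmap : PowerSeries.map (toRat n) (psiComp n F (a + 1)) = PowerSeries.subst
            (PowerSeries.map (toRat n) (psiComp n F a))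
            (PowerSeries.map (gammaRat n ^ a) (PowerSeries.map (toRat n) (psi n F))) := by
          rw [psiComp, map_subst_of_constantCoeff_zero _ (constantCoeff_psiComp F a)]
          congr 1
          ext d
          simp only [PowerSeries.coeff_map, gammaRat_pow_toRat]
        have hLa : (twoTypicalSeries fun k => (gammaRat n ^ (a + 1)) (canonicalLog n k)) =
            PowerSeries.map (gammaRat n ^ a)
              (twoTypicalSeries fun k => gammaRat n (canonicalLog n k)) := by
          rw [map_twoTypicalSeries]
          simp only [gammaRat_pow_succ]
        rw [hmap, hLa, subst_subst_eq hc0 (constantCoeff_map_zero hp0 _),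
          ← map_subst_of_constantCoeff_zero _ hp0, hψ,
          map_twoTypicalSeries, ih]
    have hc0 := constantCoeff_psiComp F (2 ^ (n - 1))
    have hc0' : PowerSeries.constantCoeff (-psiComp n F (2 ^ (n - 1))) = 0 := by
      rw [map_neg, hc0, neg_zero]
    -- For `a = 2^(n-1)` the target has logarithm `-L(-x)`, so the composite `c` satisfies `L(-c) =
    -- -L`; that is, `-c` is the formal inverse of `x`.
    have h1 := h.subst_map_fadd PowerSeries.constantCoeff_X hc0'
    have h2 := hcomp (2 ^ (n - 1))
    rw [hconj] at h2
    have h3 := subst_neg_subst_neg (twoTypicalSeries (canonicalLog n))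
      (constantCoeff_map_zero hc0 (toRat n))
    have h4 : PowerSeries.subst (PowerSeries.map (toRat n) (-psiComp n F (2 ^ (n - 1))))
        (twoTypicalSeries (canonicalLog n)) = -twoTypicalSeries (canonicalLog n) := by
      rw [map_neg]
      exact (neg_eq_iff_eq_neg.mpr h3).symm.trans (congrArg _ h2)
    rw [h4, PowerSeries.map_X, PowerSeries.X_subst, add_neg_cancel] at h1
    apply map_injective (toRat_injective n)
    refine subst_injective h.constantCoeff_eq h.coeff_one_eq
      (constantCoeff_map_zero (constantCoeff_fadd F PowerSeries.constantCoeff_X hc0') _)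
      (by simp) (h1.trans ?_)
    rw [map_zero, PowerSeries.subst_zero_of_constantCoeff_zero h.constantCoeff_eq]

/-- The logarithm of a canonical formal group law over `R_n`. -/
theorem IsCanonical.isLog (h : IsCanonical n F) :
    IsLog (F.map (toRat n)) (twoTypicalSeries (canonicalLog n)) := by
  obtain ⟨l', hl'⟩ := (isTwoTypical_iff _ F).mp h.isTwoTypical
  obtain ⟨ξ, hξ⟩ := exists_ofTensorRat (toRat n)
  have hl := hl'.map ξ
  rw [formalGroup_map_map, hξ, map_twoTypicalSeries] at hl
  set l : ℕ → RnRat n := fun k => ξ (l' k)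
  suffices IsCanonicalLog n l by rwa [← this.eq]
  refine ⟨(coeff_one_twoTypicalSeries l).symm.trans hl.coeff_one_eq, ?_, ?_⟩
  -- Pulling the logarithm of `F^γ` back along `ψ_γ` gives another logarithm of `F`; uniqueness over
  -- `ℚ` turns this into the recursion. The sign relation follows in the same way from the two
  -- logarithms of the conjugate.
  · have h1 := (h.isStrictIso.map (toRat n)).isLog_subst (isLog_map_gamma hl)
    rw [subst_psi hl] at h1
    exact congrFun (twoTypicalSeries_injective (isLog_unique h1 hl))
  · have h1 := isLog_map_gamma_pow hl (2 ^ (n - 1))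
    have hX := fun k : Fin 2 => show MvPowerSeries.constantCoeff
      (-MvPowerSeries.X k : MvPowerSeries (Fin 2) (Rn n)) = 0 by simp
    have h2 := isLog_conj (G := (F.map (gamma n ^ 2 ^ (n - 1))).map (toRat n)) hl (by
      refine (congrArg (MvPowerSeries.map (toRat n)) h.conj).trans ?_
      rw [map_neg, map_formalGroup_subst F _ (hX 0) (hX 1)]
      simp only [map_neg, MvPowerSeries.map_X])
    rw [neg_subst_neg_X_twoTypicalSeries] at h2
    intro k hk
    have := congrFun (twoTypicalSeries_injective (isLog_unique h2 h1)) k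
    rwa [if_neg (by omega)] at this

variable (n) in
theorem existsUnique_isCanonical : ∃! F : FormalGroup (Rn n), IsCanonical n F := by
  obtain ⟨u, hu, -⟩ := exists_isFunctionalEquation_canonicalLog n
  obtain ⟨F, hc, hF⟩ := hu.exists_formalGroup
  refine ⟨F, isCanonical_of_isLog n hc hF, fun G hG => ?_⟩
  exact formalGroup_map_injective (toRat_injective n) (eq_of_isLog hG.isLog hF)

/-- The Araki elements of the canonical formal group law agree up to sign with the coefficients of
`T`, modulo the preceding ones. -/
theorem IsCanonical.araki_add_mem (h : IsCanonical n F) {v : ℕ → Rn n} (hv : IsAraki F v) :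
    ∀ r, 1 ≤ r → v r + bigT n r ∈ chromIdeal (bigT n) r := by
  obtain ⟨u, hu, hT⟩ := exists_isFunctionalEquation_canonicalLog n
  intro r hr
  have h1 : chromIdeal (bigT n) r = chromIdeal u r := chromIdeal_eq_of_sub_mem fun k h1 _ =>
    ⟨1, by simpa using hT k h1⟩
  rw [h1]
  have h2 := Ideal.add_mem _ (hu.araki_add_mem h.isLog hv r hr) (hT r hr)
  convert h2 using 1
  ring

end CanonicalFormalGroup

/-! ### Regular sequences modulo an ideal. -/

section RegularModulo

variable {B : Type*} [CommRing B]

/-- The list `rs` is a weakly regular sequence on `B / J`. -/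
def IsRegularModulo : Ideal B → List B → Prop
  | _, [] => True
  | J, r :: rs => (∀ x, r * x ∈ J → x ∈ J) ∧ IsRegularModulo (J ⊔ Ideal.span {r}) rs

theorem mem_sup_span_singleton_iff {J : Ideal B} {r x : B} :
    x ∈ J ⊔ Ideal.span {r} ↔ ∃ c, x - r * c ∈ J := by
  rw [Submodule.mem_sup]
  constructor
  · rintro ⟨y, hy, z, hz, rfl⟩
    obtain ⟨c, rfl⟩ := Ideal.mem_span_singleton.mp hz
    exact ⟨c, by rwa [add_sub_cancel_right]⟩
  · rintro ⟨c, hc⟩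
    exact ⟨_, hc, r * c, Ideal.mem_span_singleton.mpr (dvd_mul_right _ _), sub_add_cancel _ _⟩

theorem isRegularModulo_top (rs : List B) : IsRegularModulo ⊤ rs := by
  induction rs with
  | nil => trivial
  | cons r rs ih => exact ⟨fun _ _ => Submodule.mem_top, by rwa [top_sup_eq]⟩

/-- The hypotheses describe an exact sequence `0 → B/J₂ → B/J → B/J₁ → 0` with first map
multiplication by `x`. Regularity on the outer terms gives regularity in the middle, and the
sequence stays exact after dividing by each `r`. -/
theorem isRegularModulo_of_exact {J₁ J₂ J : Ideal B} {x : B} {rs : List B} (h₁ : IsRegularModulo J₁ rs)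
    (h₂ : IsRegularModulo J₂ rs) (hJ : J₁ = J ⊔ Ideal.span {x}) (hx : ∀ z, x * z ∈ J ↔ z ∈ J₂) :
    IsRegularModulo J rs := by
  induction rs generalizing J₁ J₂ J with
  | nil => trivial
  | cons r rs ih =>
    have key : ∀ z, r * z ∈ J₁ → ∃ w, z - x * w ∈ J := fun z hz =>
      mem_sup_span_singleton_iff.mp (hJ ▸ h₁.1 z hz)
    refine ⟨fun z hz => ?_, ih h₁.2 h₂.2 ?_ fun z => ?_⟩
    · obtain ⟨w, hw⟩ := key z (hJ ▸ Ideal.mem_sup_left hz)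
      have h3 : x * (r * w) ∈ J := by
        have := J.sub_mem hz (J.mul_mem_left r hw)
        convert this using 1
        ring
      have h4 := J.add_mem hw ((hx w).mpr (h₂.1 w ((hx _).mp h3)))
      rwa [sub_add_cancel] at h4
    · rw [hJ]
      ac_rfl
    · rw [mem_sup_span_singleton_iff, mem_sup_span_singleton_iff]
      constructor
      · rintro ⟨c, hc⟩
        have hrc : r * c ∈ J₁ := by
          rw [hJ, mem_sup_span_singleton_iff]
          refine ⟨z, ?_⟩
          rw [← neg_sub]
          exact J.neg_mem hc
        obtain ⟨w, hw⟩ := key c hrc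
        refine ⟨w, (hx _).mp ?_⟩
        have := J.add_mem hc (J.mul_mem_left r hw)
        convert this using 1
        ring
      · rintro ⟨w, hw⟩
        refine ⟨x * w, ?_⟩
        have := (hx _).mpr hw
        convert this using 1
        ring

/-- As `x` is regular modulo `J`, multiplication by `x` gives an exact sequence `0 → B/(J, y) →
B/(J, xy) → B/(J, x) → 0`. -/
theorem IsRegularModulo.mul_cons {J : Ideal B} {x y : B} {rs : List B}
    (hx : IsRegularModulo J (x :: rs)) (hy : IsRegularModulo J (y :: rs)) :
    IsRegularModulo J (x * y :: rs) := by
  refine ⟨fun z hz => hy.1 _ (hx.1 _ (by rwa [← mul_assoc])), ?_⟩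
  refine isRegularModulo_of_exact hx.2 hy.2 (x := x) ?_ fun z => ?_
  · rw [sup_assoc, sup_eq_right.mpr (Ideal.span_singleton_le_span_singleton.mpr
      (dvd_mul_right x y))]
  · rw [mem_sup_span_singleton_iff, mem_sup_span_singleton_iff]
    refine exists_congr fun c => ⟨fun h => hx.1 _ ?_, fun h => ?_⟩
    · convert h using 1
      ring
    · convert J.mul_mem_left x h using 1
      ring

theorem IsRegularModulo.one_cons (J : Ideal B) (rs : List B) : IsRegularModulo J (1 :: rs) := by
  refine ⟨fun x hx => by rwa [one_mul] at hx, ?_⟩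
  rw [Ideal.span_singleton_one, sup_top_eq]
  exact isRegularModulo_top rs

theorem IsRegularModulo.pow_cons {J : Ideal B} {x : B} {rs : List B}
    (hx : IsRegularModulo J (x :: rs)) (e : ℕ) : IsRegularModulo J (x ^ e :: rs) := by
  induction e with
  | zero => rw [pow_zero]; exact one_cons J rs
  | succ e ih => rw [pow_succ]; exact ih.mul_cons hx

theorem IsRegularModulo.prod_cons {J : Ideal B} {ι : Type*} {s : Finset ι} {f : ι → B} {rs : List B}
    (h : ∀ a ∈ s, IsRegularModulo J (f a :: rs)) : IsRegularModulo J ((∏ a ∈ s, f a) :: rs) := by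
  classical
  induction s using Finset.induction_on with
  | empty => rw [Finset.prod_empty]; exact one_cons J rs
  | insert a s ha ih =>
    rw [Finset.prod_insert ha]
    exact (h a (Finset.mem_insert_self a s)).mul_cons
      (ih fun b hb => h b (Finset.mem_insert_of_mem hb))

theorem sup_span_singleton_congr {J : Ideal B} {x y : B} (h : x - y ∈ J) :
    J ⊔ Ideal.span {x} = J ⊔ Ideal.span {y} := by
  have key : ∀ {x y : B}, x - y ∈ J → J ⊔ Ideal.span {x} ≤ J ⊔ Ideal.span {y} := fun {x y} h =>
    sup_le le_sup_left ((Ideal.span_singleton_le_iff_mem _).mpr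
      (mem_sup_span_singleton_iff.mpr ⟨1, by rwa [mul_one]⟩))
  refine le_antisymm (key h) (key ?_)
  rw [← neg_sub]
  exact J.neg_mem h

theorem IsRegularModulo.cons_congr {J : Ideal B} {x y : B} {rs : List B} (h : x - y ∈ J)
    (hx : IsRegularModulo J (x :: rs)) : IsRegularModulo J (y :: rs) := by
  refine ⟨fun z hz => hx.1 z ?_, sup_span_singleton_congr h ▸ hx.2⟩
  have := J.add_mem (J.mul_mem_right z h) hz
  convert this using 1
  ring

theorem isRegularModulo_append {J : Ideal B} {rs rs' : List B} :
    IsRegularModulo J (rs ++ rs') ↔ IsRegularModulo J rs ∧ IsRegularModulo (J ⊔ Ideal.ofList rs) rs' := by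
  induction rs generalizing J with
  | nil => simp [IsRegularModulo]
  | cons r rs ih =>
    rw [List.cons_append, IsRegularModulo, IsRegularModulo, ih, and_assoc, Ideal.ofList_cons, sup_assoc]

theorem isRegularModulo_map_range {J : Ideal B} {f : ℕ → B} {N : ℕ} :
    IsRegularModulo J ((List.range N).map f) ↔
      ∀ k < N, ∀ x, f k * x ∈ J ⊔ Ideal.ofList ((List.range k).map f) →
        x ∈ J ⊔ Ideal.ofList ((List.range k).map f) := by
  induction N with
  | zero => simp [IsRegularModulo]
  | succ N ih =>
    rw [List.range_succ, List.map_append, isRegularModulo_append, ih]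
    simp only [List.map_cons, List.map_nil, IsRegularModulo, and_true]
    constructor
    · rintro ⟨h1, h2⟩ k hk
      rcases Nat.lt_succ_iff_lt_or_eq.mp hk with hk | rfl
      · exact h1 k hk
      · exact h2
    · intro h
      exact ⟨fun k hk => h k (hk.trans (Nat.lt_succ_self N)), h N (Nat.lt_succ_self N)⟩

end RegularModulo

/-! ### Permuting regular sequences of homogeneous elements. -/

section Grading

variable {ι R : Type*} [CommRing R] (w : ι → ℕ)

theorem weightedHomogeneousComponent_mul_eq {a : MvPolynomial ι R} {k : ℕ}
    (ha : MvPolynomial.IsWeightedHomogeneous w a k) (y : MvPolynomial ι R) (d : ℕ) :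
    MvPolynomial.weightedHomogeneousComponent w d (a * y) =
      if k ≤ d then a * MvPolynomial.weightedHomogeneousComponent w (d - k) y else 0 := by
  classical
  ext e
  rw [MvPolynomial.coeff_weightedHomogeneousComponent, MvPolynomial.coeff_mul]
  split_ifs with h1 h2 h2
  · rw [MvPolynomial.coeff_mul]
    refine Finset.sum_congr rfl fun p hp => ?_
    rw [Finset.HasAntidiagonal.mem_antidiagonal] at hp
    by_cases hc : MvPolynomial.coeff p.1 a = 0
    · rw [hc, zero_mul, zero_mul]
    · have h3 := ha hc
      rw [← hp, _root_.map_add, h3] at h1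
      rw [MvPolynomial.coeff_weightedHomogeneousComponent, if_pos (by omega)]
  · refine Finset.sum_eq_zero fun p hp => ?_
    rw [Finset.HasAntidiagonal.mem_antidiagonal] at hp
    by_cases hc : MvPolynomial.coeff p.1 a = 0
    · rw [hc, zero_mul]
    · have h3 := ha hc
      rw [← hp, _root_.map_add, h3] at h1
      omega
  · rw [MvPolynomial.coeff_mul]
    refine (Finset.sum_eq_zero fun p hp => ?_).symm
    rw [Finset.HasAntidiagonal.mem_antidiagonal] at hp
    by_cases hc : MvPolynomial.coeff p.1 a = 0
    · rw [hc, zero_mul]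
    · have h3 := ha hc
      rw [← hp, _root_.map_add, h3] at h1
      rw [MvPolynomial.coeff_weightedHomogeneousComponent, if_neg (by omega), mul_zero]
  · simp

/-- The ideal `J` contains the homogeneous components of its elements. -/
def IsGraded (J : Ideal (MvPolynomial ι R)) : Prop :=
  ∀ x ∈ J, ∀ d, MvPolynomial.weightedHomogeneousComponent w d x ∈ J

variable {w}

theorem isGraded_bot : IsGraded w (⊥ : Ideal (MvPolynomial ι R)) := by
  rintro x hx d
  rw [Ideal.mem_bot] at hx ⊢
  rw [hx, map_zero]

theorem IsGraded.sup_span {J : Ideal (MvPolynomial ι R)} (hJ : IsGraded w J)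
    {a : MvPolynomial ι R} {k : ℕ} (ha : MvPolynomial.IsWeightedHomogeneous w a k) :
    IsGraded w (J ⊔ Ideal.span {a}) := by
  intro x hx d
  obtain ⟨c, hc⟩ := mem_sup_span_singleton_iff.mp hx
  have h1 := hJ _ hc d
  rw [map_sub, weightedHomogeneousComponent_mul_eq w ha] at h1
  rw [mem_sup_span_singleton_iff]
  split_ifs at h1 with h
  · exact ⟨_, h1⟩
  · exact ⟨0, by rwa [mul_zero]⟩

/-- The graded Krull intersection theorem. -/
theorem IsGraded.mem_of_forall_mem_sup {J : Ideal (MvPolynomial ι R)} (hJ : IsGraded w J)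
    {a : MvPolynomial ι R} {k : ℕ} (hk : k ≠ 0) (ha : MvPolynomial.IsWeightedHomogeneous w a k)
    {x : MvPolynomial ι R} (hx : ∀ N : ℕ, x ∈ J ⊔ Ideal.span {a ^ N}) : x ∈ J := by
  rw [← MvPolynomial.sum_weightedHomogeneousComponent w x,
    finsum_eq_sum _ (MvPolynomial.weightedHomogeneousComponent_finsupp x)]
  refine Ideal.sum_mem _ fun d _ => ?_
  -- The power `d + 1` suffices: multiples of `a^(d+1)` have no component in degree `d`, because `k
  -- (d + 1) > d`.
  obtain ⟨c, hc⟩ := mem_sup_span_singleton_iff.mp (hx (d + 1))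
  have h1 := hJ _ hc d
  rw [map_sub, weightedHomogeneousComponent_mul_eq w (ha.pow (d + 1)), if_neg, sub_zero] at h1
  · exact h1
  · rw [smul_eq_mul, not_le]
    exact Nat.lt_of_lt_of_le (Nat.lt_succ_self d) (Nat.le_mul_of_pos_right _ (Nat.pos_of_ne_zero hk))

/-- For a swap, the point is that the second element `a` is regular modulo `J`. If `a x ∈ J`, then
`x ≡ b c` modulo `J` with `a c ∈ J` again; iterating puts `x` in `J + (b^N)` for all `N`, hence in
`J` by the graded Krull theorem. Positive degrees replace the usual local hypothesis. -/
theorem IsRegularModulo.perm {rs rs' : List (MvPolynomial ι R)} (h : rs.Perm rs')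
    {J : Ideal (MvPolynomial ι R)} (hJ : IsGraded w J)
    (hrs : ∀ r ∈ rs, ∃ k, k ≠ 0 ∧ MvPolynomial.IsWeightedHomogeneous w r k)
    (hr : IsRegularModulo J rs) : IsRegularModulo J rs' := by
  induction h generalizing J with
  | nil => trivial
  | cons r h ih =>
    obtain ⟨k, -, hk⟩ := hrs r List.mem_cons_self
    exact ⟨hr.1, ih (hJ.sup_span hk) (fun r hr => hrs r (List.mem_cons_of_mem _ hr)) hr.2⟩
  | trans h1 _ ih1 ih2 =>
    exact ih2 hJ (fun r hr => hrs r (h1.mem_iff.mpr hr)) (ih1 hJ hrs hr)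
  | swap a b l =>
    obtain ⟨k, hk0, hk⟩ := hrs b List.mem_cons_self
    obtain ⟨h1, h2, h3⟩ := hr
    have key : ∀ x, a * x ∈ J → ∃ c, x - b * c ∈ J ∧ a * c ∈ J := fun x hx => by
      obtain ⟨c, hc⟩ := mem_sup_span_singleton_iff.mp (h2 x (Ideal.mem_sup_left hx))
      refine ⟨c, hc, h1 _ ?_⟩
      have := J.sub_mem hx (J.mul_mem_left a hc)
      convert this using 1
      ring
    have key' : ∀ (N : ℕ) x, a * x ∈ J → x ∈ J ⊔ Ideal.span {b ^ N} := by
      intro N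
      induction N with
      | zero => intro x _; rw [pow_zero, Ideal.span_singleton_one, sup_top_eq]; trivial
      | succ N ih =>
        intro x hx
        obtain ⟨c, hc, hac⟩ := key x hx
        obtain ⟨c', hc'⟩ := mem_sup_span_singleton_iff.mp (ih c hac)
        refine mem_sup_span_singleton_iff.mpr ⟨c', ?_⟩
        have := J.add_mem hc (J.mul_mem_left b hc')
        convert this using 1
        ring
    refine ⟨fun x hx => hJ.mem_of_forall_mem_sup hk0 hk fun N => key' N x hx, fun x hx => ?_, ?_⟩
    · obtain ⟨y, hy⟩ := mem_sup_span_singleton_iff.mp hx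
      have hay : a * y ∈ J ⊔ Ideal.span {b} := by
        refine mem_sup_span_singleton_iff.mpr ⟨x, ?_⟩
        rw [← neg_sub]
        exact J.neg_mem hy
      obtain ⟨z, hz⟩ := mem_sup_span_singleton_iff.mp (h2 y hay)
      refine mem_sup_span_singleton_iff.mpr ⟨z, h1 _ ?_⟩
      have := J.add_mem hy (J.mul_mem_left a hz)
      convert this using 1
      ring
    · rwa [sup_right_comm]

end Grading

/-! ### Degrees and top coefficients of twisted products. -/

section TopCoefficient

variable {R : Type*} [CommRing R] {s : R →+* R}

theorem map_pow_eq_pow {x : R} (h : s x = x ^ 2) (k : ℕ) : (s ^ k) x = x ^ 2 ^ k := by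
  induction k with
  | zero => simp
  | succ k ih =>
    rw [pow_succ', RingHom.mul_def, RingHom.comp_apply, ih, map_pow, h, ← pow_mul, ← pow_succ']

theorem tprod_eq_zero_of_lt {τ : ℕ → ℕ → R} {d : ℕ → ℕ} {N : ℕ}
    (h0 : ∀ a < N, ∀ k, d a < k → τ a k = 0) :
    ∀ k, ∑ a ∈ Finset.range N, d a < k → tprod s τ N k = 0 := by
  induction N with
  | zero =>
    intro k hk
    rw [tprod, tone, if_neg (by simpa using hk.ne')]
  | succ N ih =>
    intro k hk
    rw [Finset.sum_range_succ, add_comm] at hk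
    exact tmul_eq_zero_of_lt s (h0 N (Nat.lt_succ_self N))
      (ih fun a ha => h0 a (ha.trans (Nat.lt_succ_self N))) hk

/-- The top coefficient of a twisted product is the product of the top coefficients, each twisted by
the degrees of the factors to its left. Here twisting is raising to a power of two, so a new left
factor of degree `d_N` multiplies all earlier exponents by `2^(d_N)`. -/
theorem exists_tprod_eq_prod {τ : ℕ → ℕ → R} {d : ℕ → ℕ} {N : ℕ}
    (h0 : ∀ a < N, ∀ k, d a < k → τ a k = 0) (hs : ∀ a < N, ∀ k, s (τ a k) = τ a k ^ 2) :
    ∃ e : ℕ → ℕ, (∀ a, e a ≠ 0) ∧ tprod s τ N (∑ a ∈ Finset.range N, d a) =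
      ∏ a ∈ Finset.range N, τ a (d a) ^ e a := by
  induction N with
  | zero => exact ⟨1, fun _ => one_ne_zero, by simp [tprod, tone]⟩
  | succ N ih =>
    have h0' : ∀ a < N, ∀ k, d a < k → τ a k = 0 := fun a ha => h0 a (ha.trans (Nat.lt_succ_self N))
    obtain ⟨e, he0, he⟩ := ih h0' fun a ha => hs a (ha.trans (Nat.lt_succ_self N))
    refine ⟨fun a => if a = N then 1 else e a * 2 ^ d N, fun a => ?_, ?_⟩
    · simp only
      split_ifs
      · exact one_ne_zero
      · exact mul_ne_zero (he0 a) (pow_ne_zero _ two_ne_zero)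
    rw [Finset.sum_range_succ, add_comm (Finset.sum _ _), tprod, tmul_top s (h0 N (Nat.lt_succ_self N))
      (tprod_eq_zero_of_lt h0'), he, Finset.prod_range_succ, mul_comm, map_prod]
    simp only [if_true, pow_one]
    congr 1
    refine Finset.prod_congr rfl fun a ha => ?_
    have ha := Finset.mem_range.mp ha
    rw [if_neg ha.ne, map_pow, map_pow_eq_pow (hs a (by omega) _), pow_mul']

end TopCoefficient

/-! ### Homogeneity of twisted products. -/

section Homogeneous

theorem isWeightedHomogeneous_aeval {ι ι' R : Type*} [CommRing R] {w : ι → ℕ} {w' : ι' → ℕ} {c : ℕ}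
    {f : ι → MvPolynomial ι' R} (hf : ∀ i, MvPolynomial.IsWeightedHomogeneous w' (f i) (c * w i))
    {x : MvPolynomial ι R} {k : ℕ} (hx : MvPolynomial.IsWeightedHomogeneous w x k) :
    MvPolynomial.IsWeightedHomogeneous w' (MvPolynomial.aeval f x) (c * k) := by
  rw [MvPolynomial.aeval_def, MvPolynomial.eval₂_eq]
  refine MvPolynomial.IsWeightedHomogeneous.sum _ _ _ fun d hd => ?_
  refine MvPolynomial.IsWeightedHomogeneous.C_mul ?_ _
  have h1 := MvPolynomial.IsWeightedHomogeneous.prod d.support (fun i => f i ^ d i)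
    (fun i => d i * (c * w i)) fun i _ => (hf i).pow (d i)
  convert h1 using 1
  rw [← hx (MvPolynomial.mem_support_iff.mp hd), Finsupp.weight_apply, Finsupp.sum, Finset.mul_sum]
  exact Finset.sum_congr rfl fun i _ => by rw [smul_eq_mul]; ring

theorem isWeightedHomogeneous_expand_pow {ι R : Type*} [CommRing R] {w : ι → ℕ}
    {x : MvPolynomial ι R} {k : ℕ} (hx : MvPolynomial.IsWeightedHomogeneous w x k) (j : ℕ) :
    MvPolynomial.IsWeightedHomogeneous w
      (((MvPolynomial.expand 2 : MvPolynomial ι R →ₐ[R] _).toRingHom ^ j) x) (2 ^ j * k) := by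
  induction j with
  | zero => simpa using hx
  | succ j ih =>
    rw [pow_succ', RingHom.mul_def, RingHom.comp_apply, pow_succ', mul_assoc]
    exact isWeightedHomogeneous_aeval
      (fun i => by simpa using (MvPolynomial.isWeightedHomogeneous_X R w i).pow 2) ih

/-- The degrees match because `(2^i - 1) + 2^i (2^j - 1) = 2^(i+j) - 1`. -/
theorem isWeightedHomogeneous_tmul {ι R : Type*} [CommRing R] {w : ι → ℕ}
    {a b : ℕ → MvPolynomial ι R}
    (ha : ∀ k, MvPolynomial.IsWeightedHomogeneous w (a k) (2 * (2 ^ k - 1)))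
    (hb : ∀ k, MvPolynomial.IsWeightedHomogeneous w (b k) (2 * (2 ^ k - 1))) (k : ℕ) :
    MvPolynomial.IsWeightedHomogeneous w
      (tmul (MvPolynomial.expand 2 : MvPolynomial ι R →ₐ[R] _).toRingHom a b k)
      (2 * (2 ^ k - 1)) := by
  refine MvPolynomial.IsWeightedHomogeneous.sum _ _ _ fun p hp => ?_
  rw [Finset.HasAntidiagonal.mem_antidiagonal] at hp
  have := (ha p.1).mul (isWeightedHomogeneous_expand_pow (hb p.2) p.1)
  convert this using 1
  rw [← hp, pow_add]
  have h1 := Nat.one_le_two_pow (n := p.1)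
  have h2 := Nat.one_le_two_pow (n := p.2)
  have h3 := Nat.one_le_two_pow (n := p.1 + p.2)
  rw [pow_add] at h3
  zify [h1, h2, h3]
  ring

theorem isWeightedHomogeneous_tprod {ι R : Type*} [CommRing R] {w : ι → ℕ}
    {τ : ℕ → ℕ → MvPolynomial ι R} {N : ℕ}
    (h : ∀ a < N, ∀ k, MvPolynomial.IsWeightedHomogeneous w (τ a k) (2 * (2 ^ k - 1))) (k : ℕ) :
    MvPolynomial.IsWeightedHomogeneous w
      (tprod (MvPolynomial.expand 2 : MvPolynomial ι R →ₐ[R] _).toRingHom τ N k)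
      (2 * (2 ^ k - 1)) := by
  induction N generalizing k with
  | zero =>
    rw [tprod, tone]
    split_ifs with hk
    · subst hk
      exact MvPolynomial.isWeightedHomogeneous_one R w
    · exact MvPolynomial.isWeightedHomogeneous_zero R w _
  | succ N ih =>
    exact isWeightedHomogeneous_tmul (h N (Nat.lt_succ_self N))
      (ih fun a ha => h a (ha.trans (Nat.lt_succ_self N))) k

end Homogeneous

/-! ### Passage to `R_n⟨m⟩`. -/

section Truncation

variable (n m : ℕ)

/-- Squaring of the variables, as a lift of Frobenius to `R_n⟨m⟩`. -/
def frobM : Rnm n m →+* Rnm n m := (MvPolynomial.expand 2 : Rnm n m →ₐ[ZLocTwo] _).toRingHom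

/-- The image of `γ^a t_k` in `R_n⟨m⟩`. -/
def tauM (a k : ℕ) : Rnm n m := truncate n m (tau n a k)

/-- The image of the twisted power series `T` in `R_n⟨m⟩`. -/
def bigTM (k : ℕ) : Rnm n m := truncate n m (bigT n k)

theorem truncate_frob (x : Rn n) : truncate n m (frob n x) = frobM n m (truncate n m x) := by
  have : (truncate n m).comp (frob n) = (frobM n m).comp (truncate n m) := by
    apply MvPolynomial.ringHom_ext
    · intro a
      simp [truncate, frob, frobM]
    · intro p
      simp only [truncate, frob, frobM, RingHom.comp_apply, AlgHom.toRingHom_eq_coe,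
        RingHom.coe_coe, MvPolynomial.aeval_X, MvPolynomial.expand_X, map_pow]
      split_ifs <;> simp
  exact congrArg (fun f : Rn n →+* Rnm n m => f x) this

theorem tauM_zero (a : ℕ) : tauM n m a 0 = 1 := by simp [tauM, tau, t]

theorem tauM_succ {a i : ℕ} (ha : a < 2 ^ (n - 1)) (hi : i < m) :
    tauM n m a (i + 1) = MvPolynomial.X (⟨a, ha⟩, ⟨i, hi⟩) := by
  rw [tauM, tau, gamma_pow_t n ha]
  simp [truncate, hi]

theorem tauM_eq_zero {a k : ℕ} (ha : a < 2 ^ (n - 1)) (hk : m < k) : tauM n m a k = 0 := by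
  obtain ⟨k, rfl⟩ : ∃ k', k = k' + 1 := ⟨k - 1, by omega⟩
  rw [tauM, tau, gamma_pow_t n ha]
  simp [truncate, show ¬ k < m by omega]

theorem frobM_tauM {a : ℕ} (ha : a < 2 ^ (n - 1)) (k : ℕ) :
    frobM n m (tauM n m a k) = tauM n m a k ^ 2 := by
  rw [tauM, ← truncate_frob, ← map_pow]
  exact congrArg _ (expand_gamma_pow_t n ha k)

theorem bigTM_eq : bigTM n m = tprod (frobM n m) (tauM n m) (2 ^ (n - 1)) :=
  map_tprod (truncate_frob n m) _ _

theorem isWeightedHomogeneous_tauM {a : ℕ} (ha : a < 2 ^ (n - 1)) (k : ℕ) :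
    MvPolynomial.IsWeightedHomogeneous (weight n m) (tauM n m a k) (2 * (2 ^ k - 1)) := by
  rcases Nat.eq_zero_or_pos k with rfl | hk
  · rw [tauM_zero]
    exact MvPolynomial.isWeightedHomogeneous_one _ _
  · rcases lt_or_ge m k with h | h
    · rw [tauM_eq_zero n m ha h]
      exact MvPolynomial.isWeightedHomogeneous_zero _ _ _
    · obtain ⟨k, rfl⟩ : ∃ k', k = k' + 1 := ⟨k - 1, by omega⟩
      rw [tauM_succ n m ha h]
      exact MvPolynomial.isWeightedHomogeneous_X _ _ _

theorem isWeightedHomogeneous_bigTM (k : ℕ) :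
    MvPolynomial.IsWeightedHomogeneous (weight n m) (bigTM n m k) (2 * (2 ^ k - 1)) := by
  rw [bigTM_eq]
  exact isWeightedHomogeneous_tprod (fun a ha => isWeightedHomogeneous_tauM n m ha) k

theorem bigTM_eq_zero {k : ℕ} (hk : 2 ^ (n - 1) * m < k) : bigTM n m k = 0 := by
  rw [bigTM_eq]
  exact tprod_eq_zero_of_lt (d := fun _ => m) (fun a ha k hk => tauM_eq_zero n m ha hk) k
    (by simpa using hk)

end Truncation

/-! ### Regularity of `T_h, …, T_1` by killing variables one at a time. -/

section Reduction

variable (n m : ℕ)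

/-- The reduction of `R_n⟨m⟩` modulo `2` that kills the `γ^j t_i` with `i > μ_j`. -/
def reduction (μ : ℕ → ℕ) : Rnm n m →+* MvPolynomial (Fin (2 ^ (n - 1)) × Fin m) (ZMod 2) :=
  MvPolynomial.eval₂Hom (MvPolynomial.C.comp zLocTwoToZMod) fun p =>
    if (p.2 : ℕ) < μ p.1 then MvPolynomial.X p else 0

theorem reduction_X (μ : ℕ → ℕ) (p : Fin (2 ^ (n - 1)) × Fin m) :
    reduction n m μ (MvPolynomial.X p) = if (p.2 : ℕ) < μ p.1 then MvPolynomial.X p else 0 :=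
  MvPolynomial.eval₂Hom_X' _ _ _

theorem reduction_C (μ : ℕ → ℕ) (a : ZLocTwo) :
    reduction n m μ (MvPolynomial.C a) = MvPolynomial.C (zLocTwoToZMod a) :=
  MvPolynomial.eval₂Hom_C _ _ _

theorem reduction_frobM (μ : ℕ → ℕ) (x : Rnm n m) : reduction n m μ (frobM n m x) =
    (MvPolynomial.expand 2 : MvPolynomial _ (ZMod 2) →ₐ[ZMod 2] _).toRingHom
      (reduction n m μ x) := by
  have : (reduction n m μ).comp (frobM n m) =
      (MvPolynomial.expand 2 : MvPolynomial _ (ZMod 2) →ₐ[ZMod 2] _).toRingHom.comp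
        (reduction n m μ) := by
    apply MvPolynomial.ringHom_ext
    · intro a
      simp [frobM, reduction_C]
    · intro p
      simp only [frobM, RingHom.comp_apply, AlgHom.toRingHom_eq_coe, RingHom.coe_coe, reduction_X,
        MvPolynomial.expand_X, map_pow]
      split_ifs <;> simp
  exact congrArg (fun f : Rnm n m →+* MvPolynomial _ (ZMod 2) => f x) this

theorem ker_zLocTwoToZMod : RingHom.ker zLocTwoToZMod = Ideal.span {2} := by
  apply le_antisymm
  · intro a ha
    obtain ⟨x, s, rfl⟩ := IsLocalization.exists_mk'_eq (Ideal.span {(2 : ℤ)}).primeCompl a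
    rw [RingHom.mem_ker, zLocTwoToZMod, IsLocalization.lift_mk'_spec, mul_zero] at ha
    obtain ⟨y, rfl⟩ := (ZMod.intCast_zmod_eq_zero_iff_dvd x 2).mp ha
    rw [Ideal.mem_span_singleton]
    refine ⟨IsLocalization.mk' ZLocTwo y s, ?_⟩
    rw [IsLocalization.mk'_eq_iff_eq_mul, mul_assoc, IsLocalization.mk'_spec]
    simp
  · rw [Ideal.span_singleton_le_iff_mem, RingHom.mem_ker, map_ofNat]
    rfl

theorem ker_reduction {μ : ℕ → ℕ} (hμ : ∀ a < 2 ^ (n - 1), m ≤ μ a) :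
    RingHom.ker (reduction n m μ) = Ideal.span {2} := by
  have : reduction n m μ = MvPolynomial.map zLocTwoToZMod := by
    apply MvPolynomial.ringHom_ext
    · intro a
      rw [reduction_C, MvPolynomial.map_C]
    · intro p
      rw [reduction_X, MvPolynomial.map_X, if_pos (p.2.2.trans_le (hμ p.1 p.1.2))]
  rw [this, MvPolynomial.ker_map, ker_zLocTwoToZMod, Ideal.map_span, Set.image_singleton, map_ofNat]

/-- The variable `p` is the top surviving one in its row, and the update removes exactly it. Setting
`p` to zero before `reduction n m μ` gives the updated reduction and changes elements only by
multiples of `p`. -/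
theorem ker_reduction_update {μ : ℕ → ℕ} {p : Fin (2 ^ (n - 1)) × Fin m}
    (hμ : μ p.1 = p.2 + 1) : RingHom.ker (reduction n m (Function.update μ p.1 p.2)) =
      RingHom.ker (reduction n m μ) ⊔ Ideal.span {MvPolynomial.X p} := by
  have hif : ∀ q : Fin (2 ^ (n - 1)) × Fin m, q ≠ p →
      ((q.2 : ℕ) < Function.update μ p.1 p.2 q.1 ↔ (q.2 : ℕ) < μ q.1) := by
    intro q hq
    rw [Function.update_apply]
    split_ifs with h
    · have h1 : q.1 = p.1 := Fin.ext h
      have h2 : (q.2 : ℕ) ≠ p.2 := fun h2 => hq (Prod.ext h1 (Fin.ext h2))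
      rw [h, hμ]
      omega
    · rfl
  have hX : reduction n m (Function.update μ p.1 p.2) (MvPolynomial.X p) = 0 := by
    rw [reduction_X, Function.update_self, if_neg (lt_irrefl _)]
  apply le_antisymm
  · intro x hx
    let sub : Rnm n m →+* Rnm n m := (MvPolynomial.aeval fun q =>
      if q = p then 0 else MvPolynomial.X q : Rnm n m →ₐ[ZLocTwo] Rnm n m).toRingHom
    have h1 : (reduction n m μ).comp sub = reduction n m (Function.update μ p.1 p.2) := by
      apply MvPolynomial.ringHom_ext
      · intro a
        simp [sub, reduction_C]
      · intro q
        simp only [sub, RingHom.comp_apply, AlgHom.toRingHom_eq_coe, RingHom.coe_coe,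
          MvPolynomial.aeval_X]
        split_ifs with hq
        · rw [hq, hX, map_zero]
        · rw [reduction_X, reduction_X]
          exact if_congr (hif q hq).symm rfl rfl
    have h2 : (Ideal.Quotient.mk (Ideal.span {MvPolynomial.X p})).comp sub =
        Ideal.Quotient.mk (Ideal.span {(MvPolynomial.X p : Rnm n m)}) := by
      apply MvPolynomial.ringHom_ext
      · intro a
        simp [sub]
      · intro q
        simp only [sub, RingHom.comp_apply, AlgHom.toRingHom_eq_coe, RingHom.coe_coe,
          MvPolynomial.aeval_X]
        split_ifs with hq
        · rw [map_zero, hq, eq_comm, Ideal.Quotient.eq_zero_iff_mem]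
          exact Ideal.mem_span_singleton_self _
        · rfl
    have h3 : sub x ∈ RingHom.ker (reduction n m μ) := by
      rw [RingHom.mem_ker, ← RingHom.comp_apply, h1]
      exact hx
    have h4 := congrArg (fun f : Rnm n m →+* _ => f x) h2
    obtain ⟨c, hc⟩ := Ideal.mem_span_singleton.mp (Ideal.Quotient.eq.mp h4)
    refine mem_sup_span_singleton_iff.mpr ⟨-c, ?_⟩
    have h5 : x - MvPolynomial.X p * -c = sub x := by linear_combination -hc
    rwa [h5]
  · refine sup_le ?_ ((Ideal.span_singleton_le_iff_mem _).mpr hX)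
    intro x hx
    have h1 : (MvPolynomial.eval₂Hom MvPolynomial.C (fun q => if q = p then 0 else
        MvPolynomial.X q) : MvPolynomial _ (ZMod 2) →+* _).comp (reduction n m μ) =
        reduction n m (Function.update μ p.1 p.2) := by
      apply MvPolynomial.ringHom_ext
      · intro a
        simp [reduction_C]
      · intro q
        rw [RingHom.comp_apply]
        by_cases hq : q = p
        · rw [hq, hX, reduction_X, if_pos (by omega)]
          simp
        · rw [reduction_X, reduction_X, if_congr (hif q hq) rfl rfl]
          split_ifs
          · simp [hq]
          · simp
    rw [RingHom.mem_ker] at hx ⊢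
    rw [← h1, RingHom.comp_apply, hx, map_zero]

/-- Modulo the kernel, `τ_a` has degree at most `μ_a`, so `T_h` becomes a product of powers of the
elements `γ^a t_(μ_a)`. By the product lemmas each factor can be treated alone: it is `1` if `μ_a =
0`, and otherwise a variable of a polynomial domain. Killing this variable lowers `μ_a` by one, and
the induction hypothesis applies to `T_{h-1}, …, T_1`. -/
theorem isRegularModulo_ker_reduction {h : ℕ} {μ : ℕ → ℕ} (hμ : ∀ a < 2 ^ (n - 1), μ a ≤ m)
    (hh : ∑ a ∈ Finset.range (2 ^ (n - 1)), μ a = h) :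
    IsRegularModulo (RingHom.ker (reduction n m μ))
      ((List.range h).reverse.map fun k => bigTM n m (k + 1)) := by
  induction h generalizing μ with
  | zero => trivial
  | succ h ih =>
    rw [List.range_succ, List.reverse_append, List.reverse_singleton, List.singleton_append,
      List.map_cons]
    have hmap : ∀ k, reduction n m μ (bigTM n m k) = tprod
        (MvPolynomial.expand 2 : MvPolynomial _ (ZMod 2) →ₐ[ZMod 2] _).toRingHom
        (fun a k => reduction n m μ (tauM n m a k)) (2 ^ (n - 1)) k := fun k => by
      rw [bigTM_eq]
      exact congrFun (map_tprod (reduction_frobM n m μ) _ _) k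
    obtain ⟨e, -, he⟩ := exists_tprod_eq_prod
      (s := (MvPolynomial.expand 2 : MvPolynomial _ (ZMod 2) →ₐ[ZMod 2] _).toRingHom)
      (τ := fun a k => reduction n m μ (tauM n m a k)) (d := μ) (N := 2 ^ (n - 1))
      (fun a ha k hk => by
        rcases lt_or_ge m k with h1 | h1
        · rw [tauM_eq_zero n m ha h1, map_zero]
        · obtain ⟨k, rfl⟩ : ∃ k', k = k' + 1 := ⟨k - 1, by omega⟩
          rw [tauM_succ n m ha h1, reduction_X, if_neg (by simp only; omega)])
      (fun a ha k => by rw [← reduction_frobM, frobM_tauM n m ha, map_pow])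
    rw [← hmap, hh] at he
    refine IsRegularModulo.cons_congr
      (x := ∏ a ∈ Finset.range (2 ^ (n - 1)), tauM n m a (μ a) ^ e a) ?_ ?_
    · rw [RingHom.mem_ker, map_sub, he, map_prod]
      simp only [map_pow, sub_self]
    · refine IsRegularModulo.prod_cons fun a ha => IsRegularModulo.pow_cons ?_ _
      have ha' := Finset.mem_range.mp ha
      rcases Nat.eq_zero_or_pos (μ a) with h0 | h0
      · rw [h0, tauM_zero]
        exact IsRegularModulo.one_cons _ _
      · obtain ⟨i, hi⟩ : ∃ i, μ a = i + 1 := ⟨μ a - 1, by omega⟩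
        have him : i < m := by have := hμ a ha'; omega
        rw [hi, tauM_succ n m ha' him]
        refine ⟨fun x hx => ?_, ?_⟩
        · rw [RingHom.mem_ker, map_mul, reduction_X, if_pos (by simp only; omega)] at hx
          exact (mul_eq_zero.mp hx).resolve_left (MvPolynomial.X_ne_zero _)
        · rw [← ker_reduction_update n m (p := (⟨a, ha'⟩, ⟨i, him⟩)) hi]
          refine ih (fun b hb => ?_) ?_
          · rw [Function.update_apply]
            split_ifs
            · exact him.le
            · exact hμ b hb
          · rw [Finset.sum_update_of_mem ha]
            rw [Finset.sum_eq_add_sum_sdiff_singleton_of_mem ha, hi] at hh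
            simp only
            omega

end Reduction

/-! ### Translation to Mathlib's weakly regular sequences. -/

section ChromaticSequence

variable {B : Type*} [CommRing B]

theorem IsRegularModulo.isWeaklyRegular {rs : List B} (h : IsRegularModulo ⊥ rs) :
    RingTheory.Sequence.IsWeaklyRegular B rs := by
  refine ⟨fun i hi => ?_⟩
  rw [smul_eq_mul, Ideal.mul_top]
  have h1 : rs.take i ++ rs[i] :: rs.drop (i + 1) = rs := by
    rw [List.cons_getElem_drop_succ, List.take_append_drop]
  rw [← h1, isRegularModulo_append, bot_sup_eq] at h
  have h2 := h.2.1
  rw [isSMulRegular_iff_right_eq_zero_of_smul]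
  intro x
  obtain ⟨x, rfl⟩ := Ideal.Quotient.mk_surjective x
  intro hx
  rw [Ideal.Quotient.eq_zero_iff_mem]
  exact h2 x (Ideal.Quotient.eq_zero_iff_mem.mp hx)

theorem chromIdeal_succ_eq (v : ℕ → B) (k : ℕ) :
    chromIdeal v (k + 1) = Ideal.span {2} ⊔ Ideal.ofList ((List.range k).map fun i => v (i + 1)) := by
  apply le_antisymm
  · refine chromIdeal_le (Ideal.mem_sup_left (Ideal.mem_span_singleton_self 2)) fun i h1 hi => ?_
    refine Ideal.mem_sup_right (Ideal.subset_span ?_)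
    exact List.mem_map.mpr ⟨i - 1, List.mem_range.mpr (by omega), by rw [Nat.sub_add_cancel h1]⟩
  · refine sup_le ((Ideal.span_singleton_le_iff_mem _).mpr (two_mem_chromIdeal v _))
      (Ideal.span_le.mpr fun x hx => ?_)
    obtain ⟨i, hi, rfl⟩ := List.mem_map.mp hx
    exact mem_chromIdeal (by omega) (by have := List.mem_range.mp hi; omega)

/-- Regularity of the sequence `(2, v_1, …, v_r)`. -/
theorem isRegularModulo_chromSeq_iff {v : ℕ → B} {r : ℕ} :
    IsRegularModulo ⊥ (chromSeq v r) ↔ (∀ x : B, 2 * x = 0 → x = 0) ∧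
      ∀ k, 1 ≤ k → k ≤ r → ∀ x, v k * x ∈ chromIdeal v k → x ∈ chromIdeal v k := by
  rw [chromSeq, IsRegularModulo, bot_sup_eq, isRegularModulo_map_range]
  simp only [Ideal.mem_bot, ← chromIdeal_succ_eq]
  refine and_congr_right fun _ => ⟨fun h k h1 hk => ?_, fun h k hk => h (k + 1) (by omega) (by omega)⟩
  obtain ⟨k, rfl⟩ : ∃ k', k = k' + 1 := ⟨k - 1, by omega⟩
  exact h k (by omega)

end ChromaticSequence

/-! ### Regularity of `2, v_1, …, v_h` and the relations `v_r ∈ I_r`. -/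

section RegularSequence

variable (n m : ℕ)

/-- The descending sequence is regular modulo `2` by the case where all `μ_a` equal `m`. The `T_k`
have positive degree, so their order may be reversed; `2` has degree zero and stays in front. -/
theorem isRegularModulo_bigTM :
    IsRegularModulo ⊥ (chromSeq (bigTM n m) (2 ^ (n - 1) * m)) := by
  refine ⟨fun x hx => ?_, ?_⟩
  · have h2 : (2 : Rnm n m) ≠ 0 := by
      rw [← map_ofNat (MvPolynomial.C (σ := Fin (2 ^ (n - 1)) × Fin m) (R := ZLocTwo)) 2, Ne,
        MvPolynomial.C_eq_zero]
      intro h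
      have := congrArg zLocTwoToRat h
      rw [map_ofNat, map_zero] at this
      exact two_ne_zero this
    have : IsDomain ZLocTwo := Function.Injective.isDomain zLocTwoToRat zLocTwoToRat_injective
    exact (mul_eq_zero.mp hx).resolve_left h2
  · have h1 := isRegularModulo_ker_reduction n m (h := 2 ^ (n - 1) * m) (μ := fun _ => m)
      (fun _ _ => le_rfl) (by simp)
    rw [ker_reduction n m fun _ _ => le_rfl] at h1
    rw [bot_sup_eq]
    refine IsRegularModulo.perm (w := weight n m) ((List.reverse_perm _).map _) ?_ ?_ h1
    · have := (isGraded_bot (w := weight n m) (R := ZLocTwo)).sup_span (a := 2) (k := 0) (by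
        rw [← map_ofNat MvPolynomial.C 2]
        exact MvPolynomial.isWeightedHomogeneous_C _ _)
      rwa [bot_sup_eq] at this
    · intro r hr
      obtain ⟨k, -, rfl⟩ := List.mem_map.mp hr
      refine ⟨_, ?_, isWeightedHomogeneous_bigTM n m (k + 1)⟩
      have : 2 ≤ 2 ^ (k + 1) := by
        rw [pow_succ]
        have := Nat.one_le_two_pow (n := k)
        omega
      omega

variable {n m} {F : FormalGroup (Rn n)} {v : ℕ → Rn n} (hF : IsCanonical n F) (hv : IsAraki F v)

include hF hv

theorem truncate_araki_add_mem {r : ℕ} (hr : 1 ≤ r) :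
    truncate n m (v r) + bigTM n m r ∈ chromIdeal (bigTM n m) r := by
  have := Ideal.mem_map_of_mem (truncate n m) (hF.araki_add_mem hv r hr)
  rwa [map_chromIdeal, _root_.map_add] at this

theorem chromIdeal_truncate_araki (r : ℕ) :
    chromIdeal (fun i => truncate n m (v i)) r = chromIdeal (bigTM n m) r :=
  chromIdeal_eq_of_sub_mem fun k h1 _ => ⟨-1, by
    rw [Units.val_neg, Units.val_one, neg_one_mul, sub_neg_eq_add]
    exact truncate_araki_add_mem hF hv h1⟩

/-- Here `T_r = 0`, so the congruence `v_r ≡ -T_r` modulo the preceding elements puts `v_r` in their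
ideal. -/
theorem truncate_araki_mem {r : ℕ} (hr : 2 ^ (n - 1) * m < r) :
    truncate n m (v r) ∈ chromIdeal (fun i => truncate n m (v i)) r := by
  have h := truncate_araki_add_mem (m := m) hF hv (show 1 ≤ r by omega)
  rwa [bigTM_eq_zero n m hr, add_zero, ← chromIdeal_truncate_araki hF hv] at h

theorem isWeaklyRegular_truncate_araki {r : ℕ} (hr : r ≤ 2 ^ (n - 1) * m) :
    RingTheory.Sequence.IsWeaklyRegular (Rnm n m)
      (chromSeq (fun i => truncate n m (v i)) r) := by
  apply IsRegularModulo.isWeaklyRegular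
  have h := isRegularModulo_chromSeq_iff.mp (isRegularModulo_bigTM n m)
  refine isRegularModulo_chromSeq_iff.mpr ⟨h.1, fun k h1 hk x hx => ?_⟩
  rw [chromIdeal_truncate_araki hF hv] at hx ⊢
  refine h.2 k h1 (hk.trans hr) x ?_
  have := Ideal.sub_mem _ (Ideal.mul_mem_right x _ (truncate_araki_add_mem (m := m) hF hv h1)) hx
  convert this using 1
  ring

end RegularSequence

/-! ### Homogeneity of the Araki elements. -/

section HomogeneousAraki

variable (n : ℕ)

/-- The grading of `R_n` and of its rationalization. -/
def weightN (p : Fin (2 ^ (n - 1)) × ℕ) : ℕ := 2 * (2 ^ (p.2 + 1) - 1)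

theorem isWeightedHomogeneous_map_iff {ι R R' : Type*} [CommRing R] [CommRing R'] {f : R →+* R'}
    (hf : Function.Injective f) {w : ι → ℕ} {x : MvPolynomial ι R} {k : ℕ} :
    MvPolynomial.IsWeightedHomogeneous w (MvPolynomial.map f x) k ↔
      MvPolynomial.IsWeightedHomogeneous w x k := by
  refine forall_congr' fun d => ?_
  rw [MvPolynomial.coeff_map, Ne, map_eq_zero_iff f hf]

theorem isWeightedHomogeneous_gammaRat {x : RnRat n} {k : ℕ}
    (hx : MvPolynomial.IsWeightedHomogeneous (weightN n) x k) :
    MvPolynomial.IsWeightedHomogeneous (weightN n) (gammaRat n x) k := by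
  rw [← one_mul k]
  refine isWeightedHomogeneous_aeval (fun p => ?_) hx
  rw [one_mul]
  split_ifs
  · exact MvPolynomial.isWeightedHomogeneous_X ℚ (weightN n) _
  · exact (MvPolynomial.isWeightedHomogeneous_X ℚ (weightN n) _).neg

theorem isWeightedHomogeneous_gammaRat_pow {x : RnRat n} {k : ℕ}
    (hx : MvPolynomial.IsWeightedHomogeneous (weightN n) x k) (a : ℕ) :
    MvPolynomial.IsWeightedHomogeneous (weightN n) ((gammaRat n ^ a) x) k := by
  induction a with
  | zero => simpa using hx
  | succ a ih =>
    rw [← gammaRat_pow_succ']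
    exact isWeightedHomogeneous_gammaRat n ih

theorem isWeightedHomogeneous_toRat_t (k : ℕ) :
    MvPolynomial.IsWeightedHomogeneous (weightN n) (toRat n (t n k)) (2 * (2 ^ k - 1)) := by
  refine (isWeightedHomogeneous_map_iff zLocTwoToRat_injective).mpr ?_
  cases k with
  | zero => exact MvPolynomial.isWeightedHomogeneous_one _ _
  | succ k => exact MvPolynomial.isWeightedHomogeneous_X ZLocTwo (weightN n) _

theorem weight_add_eq {j k : ℕ} (h : j ≤ k) :
    2 * (2 ^ j - 1) + 2 ^ j * (2 * (2 ^ (k - j) - 1)) = 2 * (2 ^ k - 1) := by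
  obtain ⟨i, rfl⟩ := Nat.exists_eq_add_of_le h
  rw [Nat.add_sub_cancel_left]
  have h1 := Nat.one_le_two_pow (n := i)
  have h2 := Nat.one_le_two_pow (n := j)
  have h3 := Nat.one_le_two_pow (n := j + i)
  zify [h1, h2, h3]
  rw [pow_add]
  ring

theorem isWeightedHomogeneous_canonicalLog (k : ℕ) :
    MvPolynomial.IsWeightedHomogeneous (weightN n) (canonicalLog n k) (2 * (2 ^ k - 1)) := by
  induction k using Nat.strong_induction_on with
  | _ k ih =>
    rcases Nat.eq_zero_or_pos k with rfl | hk
    · rw [canonicalLog_zero]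
      exact MvPolynomial.isWeightedHomogeneous_one _ _
    · rw [← C_half_mul n (canonicalLog n k), two_mul_canonicalLog n hk]
      refine MvPolynomial.IsWeightedHomogeneous.C_mul ?_ _
      refine MvPolynomial.IsWeightedHomogeneous.sum _ _ _ fun a _ => ?_
      refine isWeightedHomogeneous_gammaRat_pow n ?_ a
      refine MvPolynomial.IsWeightedHomogeneous.sum _ _ _ fun j hj => ?_
      have hj := Finset.mem_range.mp hj
      rw [← weight_add_eq hj.le]
      exact (isWeightedHomogeneous_gammaRat n (ih j hj)).mul
        ((isWeightedHomogeneous_toRat_t n (k - j)).pow _)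

theorem isWeightedHomogeneous_arakiSeq (k : ℕ) : MvPolynomial.IsWeightedHomogeneous (weightN n)
    (arakiSeq (canonicalLog n) k) (2 * (2 ^ k - 1)) := by
  induction k using Nat.strong_induction_on with
  | _ k ih =>
    rw [arakiSeq_eq]
    refine MvPolynomial.IsWeightedHomogeneous.sub ?_ ?_
    · rw [show (2 : RnRat n) = MvPolynomial.C 2 from (map_ofNat MvPolynomial.C 2).symm]
      exact (isWeightedHomogeneous_canonicalLog n k).C_mul 2
    · refine MvPolynomial.IsWeightedHomogeneous.sum _ _ _ fun j hj => ?_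
      have hj := Finset.mem_range.mp hj
      have h1 := weight_add_eq (Nat.sub_le k j)
      rw [Nat.sub_sub_self hj.le] at h1
      rw [← h1]
      exact (isWeightedHomogeneous_canonicalLog n (k - j)).mul ((ih j hj).pow _)

variable {n} {F : FormalGroup (Rn n)} {v : ℕ → Rn n}

theorem isWeightedHomogeneous_truncate_araki (m : ℕ) (hF : IsCanonical n F) (hv : IsAraki F v)
    (k : ℕ) : MvPolynomial.IsWeightedHomogeneous (weight n m) (truncate n m (v k))
      (2 * (2 ^ k - 1)) := by
  have h1 := (araki_relation_iff (canonicalLog n) (fun k => toRat n (v k)) (canonicalLog_zero n)).mp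
    ((isAraki_iff (toRat_injective n) hF.isLog v).mp hv)
  have h2 := isWeightedHomogeneous_arakiSeq n k
  rw [← h1] at h2
  rw [← one_mul (2 * (2 ^ k - 1))]
  refine isWeightedHomogeneous_aeval (fun p => ?_)
    ((isWeightedHomogeneous_map_iff zLocTwoToRat_injective).mp h2)
  rw [one_mul]
  split_ifs with hp
  · exact MvPolynomial.isWeightedHomogeneous_X ZLocTwo (weight n m) (p.1, ⟨p.2, hp⟩)
  · exact MvPolynomial.isWeightedHomogeneous_zero _ _ _

end HomogeneousAraki

/-! ### Twisted polynomials of the form `1 + c V^h`. -/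

section TwistedMonomials

variable {R : Type*} [CommRing R] (s : R →+* R)

/-- The twisted power series `c V^k`. -/
def tsingle (k : ℕ) (c : R) : ℕ → R := fun j => if j = k then c else 0

theorem tsingle_apply_self (k : ℕ) (c : R) : tsingle k c k = c := if_pos rfl

theorem tsingle_apply_of_ne {j k : ℕ} (h : j ≠ k) (c : R) : tsingle k c j = 0 := if_neg h

theorem tmul_tsingle (a : ℕ → R) (h : ℕ) (c : R) (k : ℕ) :
    tmul s a (tsingle h c) (k + h) = a k * (s ^ k) c := by
  rw [tmul_apply, Finset.sum_eq_single (k, h)]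
  · rw [tsingle_apply_self]
  · intro p hp hne
    rw [Finset.HasAntidiagonal.mem_antidiagonal] at hp
    have : p.2 ≠ h := fun h' => hne (Prod.ext (by simp only; omega) h')
    rw [tsingle_apply_of_ne this, map_zero, mul_zero]
  · intro h
    simp at h

theorem tmul_tsingle_of_lt (a : ℕ → R) {h k : ℕ} (hk : k < h) (c : R) :
    tmul s a (tsingle h c) k = 0 := by
  refine Finset.sum_eq_zero fun p hp => ?_
  rw [Finset.HasAntidiagonal.mem_antidiagonal] at hp
  rw [tsingle_apply_of_ne (by omega), map_zero, mul_zero]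

theorem tsingle_tmul (a : ℕ → R) (h : ℕ) (c : R) (k : ℕ) :
    tmul s (tsingle h c) a (k + h) = c * (s ^ h) (a k) := by
  rw [tmul_apply, Finset.sum_eq_single (h, k)]
  · rw [tsingle_apply_self]
  · intro p hp hne
    rw [Finset.HasAntidiagonal.mem_antidiagonal] at hp
    have : p.1 ≠ h := fun h' => hne (Prod.ext h' (by simp only; omega))
    rw [tsingle_apply_of_ne this, zero_mul]
  · intro h'
    rw [Finset.HasAntidiagonal.mem_antidiagonal] at h'
    simp only at h'
    omega

theorem tsingle_tmul_tsingle (k l : ℕ) (a b : R) :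
    tmul s (tsingle k a) (tsingle l b) = tsingle (k + l) (a * (s ^ k) b) := by
  funext j
  rcases lt_or_ge j l with h | h
  · rw [tmul_tsingle_of_lt s _ h, tsingle_apply_of_ne (by omega)]
  · obtain ⟨i, rfl⟩ := Nat.exists_eq_add_of_le' h
    rw [tmul_tsingle]
    by_cases hi : i = k
    · subst hi
      rw [tsingle_apply_self, tsingle_apply_self]
    · rw [tsingle_apply_of_ne hi, tsingle_apply_of_ne (by omega), zero_mul]

theorem tmul_apply_of_eq_zero {a : ℕ → R} {h : ℕ} (ha : ∀ k < h, a k = 0) (b : ℕ → R) :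
    (∀ k < h, tmul s a b k = 0) ∧ tmul s a b h = a h * (s ^ h) (b 0) := by
  constructor
  · intro k hk
    refine Finset.sum_eq_zero fun p hp => ?_
    rw [Finset.HasAntidiagonal.mem_antidiagonal] at hp
    rw [ha _ (by omega), zero_mul]
  · rw [tmul_apply, Finset.sum_eq_single (h, 0)]
    · intro p hp hne
      rw [Finset.HasAntidiagonal.mem_antidiagonal] at hp
      have : p.1 ≠ h := fun h' => hne (Prod.ext h' (by simp only; omega))
      rw [ha _ (by omega), zero_mul]
    · intro h'
      simp at h'

theorem tprod_succ' (τ : ℕ → ℕ → R) (N : ℕ) :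
    tprod s τ (N + 1) = tmul s (tprod s (fun a => τ (a + 1)) N) (τ 0) := by
  induction N with
  | zero => rw [tprod, tprod, tprod, tmul_tone, tone_tmul]
  | succ N ih => rw [tprod, ih, ← tmul_assoc, tprod]

theorem tprod_const_add (x : ℕ → R) (M N : ℕ) : tprod s (fun _ => x) (M + N) =
    tmul s (tprod s (fun _ => x) M) (tprod s (fun _ => x) N) := by
  induction M with
  | zero => rw [Nat.zero_add, tprod, tone_tmul]
  | succ M ih => rw [Nat.succ_add, tprod, ih, ← tmul_assoc, tprod]

/-- If `x + x c V^h = T' x`, where `x` has constant term `1` and `T'` has degree at most `h`, then `T' = 1 + c V^h`. -/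
theorem eq_of_tmul_eq {x T' : ℕ → R} {h : ℕ} (hh : 0 < h) {c : R} (hx : x 0 = 1)
    (hT : ∀ k, h < k → T' k = 0) (heq : tmul s x (tone + tsingle h c) = tmul s T' x) :
    T' = tone + tsingle h c := by
  obtain ⟨x', hx'⟩ : ∃ x', tmul s x x' = tone := ⟨_, tmul_tsolve s x tone 1 (by rw [hx, one_mul])⟩
  have hx'0 : x' 0 = 1 := by
    have := congrFun hx' 0
    rwa [tmul_zero, hx, one_mul, tone, if_pos rfl] at this
  -- Conjugating by `x` gives `T' = 1 + x c V^h x⁻¹`. The second term starts with `c V^h`, and the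
  -- degree bound on `T'` removes everything above `V^h`.
  have hE : T' = tone + tmul s (tmul s x (tsingle h c)) x' := by
    rw [← tmul_tone s T', ← hx', ← tmul_assoc, ← heq, tmul_add, tmul_tone, add_tmul, hx']
  have hlow := tmul_apply_of_eq_zero s (h := h) (fun k hk => tmul_tsingle_of_lt s x (c := c) hk) x'
  funext k
  rcases lt_trichotomy k h with hk | rfl | hk
  · rw [hE, Pi.add_apply, hlow.1 k hk, Pi.add_apply, tsingle_apply_of_ne hk.ne]
  · have h1 := tmul_tsingle s x k c 0
    rw [Nat.zero_add] at h1
    rw [hE, Pi.add_apply, hlow.2, h1, hx'0, Pi.add_apply, tsingle_apply_self, hx, map_one]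
    simp
  · rw [hT k hk, Pi.add_apply, tone, if_neg (by omega), tsingle_apply_of_ne hk.ne', add_zero]

/-- If the product of a periodic family of twisted polynomials of degree at most `m` is
`1 + c V^h`, then the factors commute with `c V^h`. -/
theorem mul_pow_eq_of_tprod_eq {τ : ℕ → ℕ → R} {N m h : ℕ} (hh : h = N * m) (hh0 : 0 < h) {c : R}
    (h0 : ∀ a, τ a 0 = 1) (hτ : ∀ a k, m < k → τ a k = 0) (hper : ∀ a, τ (a + N) = τ a)
    (hT : tprod s τ N = tone + tsingle h c) (a k : ℕ) :
    τ a k * (s ^ k) c = c * (s ^ h) (τ a k) := by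
  -- Every cyclic rotation of the product is `1 + c V^h`: since `τ_(a+N) = τ_a`, conjugation by
  -- `τ_a` takes the rotation starting at `a` to the one starting at `a + 1`.
  have hrot : ∀ a, tprod s (fun b => τ (b + a)) N = tone + tsingle h c := by
    intro a
    induction a with
    | zero => exact hT
    | succ a ih =>
      refine eq_of_tmul_eq s hh0 (h0 a) (fun k hk => ?_) ?_
      · exact tprod_eq_zero_of_lt (d := fun _ => m) (fun b _ k hk => hτ _ k hk) k
          (by simpa [← hh] using hk)
      · have h1 := tprod_succ' s (fun b => τ (b + a)) N
        rw [tprod, ih, add_comm N a, hper] at h1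
        simp only [Nat.zero_add] at h1
        rw [h1]
        simp only [add_assoc, add_comm 1 a]
  have h1 := tprod_succ' s (fun b => τ (b + a)) N
  rw [tprod, hrot a, add_comm N a, hper] at h1
  have h2 := hrot (a + 1)
  simp only [Nat.zero_add, add_assoc, add_comm 1 a] at h1
  rw [h2, tmul_add, add_tmul, tmul_tone, tone_tmul] at h1
  -- The rotations at `a` and `a + 1` being equal, `τ_a c V^h = c V^h τ_a`; the assertion is the
  -- coefficient of `V^(k+h)`.
  have h3 := congrFun (add_left_cancel h1) (k + h)
  rwa [tmul_tsingle, tsingle_tmul] at h3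

/-- In characteristic two, `(1 + y V^m)^(2^j) = 1 + y^e V^(2^j m)` with
`e = (2^(2^j m) - 1) / (2^m - 1)`. -/
theorem tprod_const_two_pow (h2 : (2 : R) = 0) (hs : ∀ x, s x = x ^ 2) {m : ℕ} (hm : 1 ≤ m) (y : R)
    (j : ℕ) : tprod s (fun _ => tone + tsingle m y) (2 ^ j) =
      tone + tsingle (2 ^ j * m) (y ^ ((2 ^ (2 ^ j * m) - 1) / (2 ^ m - 1))) := by
  have hm2 : 2 ≤ 2 ^ m := by
    calc 2 = 2 ^ 1 := rfl
      _ ≤ 2 ^ m := Nat.pow_le_pow_right two_pos hm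
  have he : ∀ j, ∃ e, e * (2 ^ m - 1) = 2 ^ (2 ^ j * m) - 1 := fun j =>
    ⟨(2 ^ (2 ^ j * m) - 1) / (2 ^ m - 1), Nat.div_mul_cancel (by
      rw [mul_comm, pow_mul]
      simpa using Nat.sub_dvd_pow_sub_pow (2 ^ m) 1 (2 ^ j))⟩
  have hdiv : ∀ {j e}, e * (2 ^ m - 1) = 2 ^ (2 ^ j * m) - 1 →
      (2 ^ (2 ^ j * m) - 1) / (2 ^ m - 1) = e := fun {j e} h => by
    rw [← h, Nat.mul_div_cancel _ (by omega)]
  induction j with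
  | zero =>
    rw [hdiv (j := 0) (e := 1) (by simp), pow_zero, ← Nat.zero_add 1, tprod, tprod, tmul_tone,
      Nat.zero_add, one_mul, pow_one]
  | succ j ih =>
    obtain ⟨e, hej⟩ := he j
    rw [hdiv hej] at ih
    have he' : e * (1 + 2 ^ (2 ^ j * m)) * (2 ^ m - 1) = 2 ^ (2 ^ (j + 1) * m) - 1 := by
      have h1 : 2 ^ (2 ^ (j + 1) * m) = 2 ^ (2 ^ j * m) * 2 ^ (2 ^ j * m) := by
        rw [← pow_add]
        congr 1
        ring
      have h3 := Nat.one_le_two_pow (n := 2 ^ j * m)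
      rw [mul_right_comm, hej, h1]
      generalize 2 ^ (2 ^ j * m) = q at h3 ⊢
      obtain ⟨q, rfl⟩ := Nat.exists_eq_add_of_le' h3
      rw [Nat.add_sub_cancel]
      have : (q + 1) * (q + 1) = q * (1 + (q + 1)) + 1 := by ring
      omega
    -- Squaring `1 + z V^q`, with `q = 2^j m`, gives `1 + 2 z V^q + z^(1 + 2^q) V^(2q)`, and the
    -- middle term vanishes in characteristic two.
    rw [hdiv he', show 2 ^ (j + 1) = 2 ^ j + 2 ^ j by ring, tprod_const_add, ih, tmul_add, tmul_tone,
      add_tmul, tone_tmul, tsingle_tmul_tsingle, map_pow_eq_pow (hs _), add_mul, add_assoc,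
      ← add_assoc (tsingle _ _) (tsingle _ _)]
    have hz : ∀ z : ℕ → R, z + z = 0 := fun z => by
      funext k
      rw [Pi.add_apply, ← two_mul, h2, zero_mul, Pi.zero_apply]
    rw [hz, zero_add]
    congr 2
    ring

end TwistedMonomials

/-! ### Images of `T` in rings of characteristic two. -/

section CharacteristicTwo

variable {Q : Type*} [CommRing Q]

/-- The Frobenius endomorphism of a ring of characteristic two. -/
def sqHom (h2 : (2 : Q) = 0) : Q →+* Q where
  toFun x := x ^ 2
  map_one' := one_pow 2
  map_mul' x y := mul_pow x y 2
  map_zero' := zero_pow two_ne_zero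
  map_add' x y := by linear_combination x * y * h2

theorem sqHom_apply (h2 : (2 : Q) = 0) (x : Q) : sqHom h2 x = x ^ 2 := rfl

variable (n m : ℕ) {h : ℕ} (f : Rnm n m →+* Q) (h2 : (2 : Q) = 0)

theorem map_frobM (x : Rnm n m) : f (frobM n m x) = sqHom h2 (f x) := by
  obtain ⟨c, hc⟩ := Ideal.mem_span_singleton.mp (expand_two_sub_sq_mem _ x)
  have := congrArg f hc
  rw [map_sub, map_mul, map_ofNat, h2, zero_mul, sub_eq_zero, map_pow] at this
  exact this

theorem map_bigTM : (fun k => f (bigTM n m k)) =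
    tprod (sqHom h2) (fun a k => f (tauM n m a k)) (2 ^ (n - 1)) := by
  rw [bigTM_eq]
  exact map_tprod (map_frobM n m f h2) _ _

-- The element `γ^(2^(n-1))` acts on the `t_i` by `-1`, which is invisible in characteristic two.
-- This supplies the periodicity needed for the rotation argument.
include h2 in
theorem map_tauM_add (a : ℕ) : (fun k => f (tauM n m (a + 2 ^ (n - 1)) k)) =
    fun k => f (tauM n m a k) := by
  funext k
  rcases Nat.eq_zero_or_pos k with rfl | hk
  · rw [tauM_zero, tauM_zero]
  · obtain ⟨k, rfl⟩ : ∃ k', k = k' + 1 := ⟨k - 1, by omega⟩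
    have h1 : tau n (a + 2 ^ (n - 1)) (k + 1) = -tau n a (k + 1) := by
      rw [tau, pow_add, RingHom.mul_def, RingHom.comp_apply, gamma_pow_t_top, map_neg, tau]
    rw [tauM, h1, map_neg, map_neg, tauM]
    linear_combination -f (truncate n m (tau n a (k + 1))) * h2

include h2 in
theorem map_tauM_eq_zero (a : ℕ) {k : ℕ} (hk : m < k) : f (tauM n m a k) = 0 := by
  induction a using Nat.strong_induction_on with
  | _ a ih =>
    rcases lt_or_ge a (2 ^ (n - 1)) with ha | ha
    · rw [tauM_eq_zero n m ha hk, map_zero]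
    · have h1 := congrFun (map_tauM_add n m f h2 (a - 2 ^ (n - 1))) k
      rw [Nat.sub_add_cancel ha] at h1
      rw [h1]
      have := Nat.two_pow_pos (n - 1)
      exact ih _ (by omega)

theorem tprod_congr {R : Type*} [CommRing R] {s : R →+* R} {τ τ' : ℕ → ℕ → R} {N : ℕ}
    (h : ∀ a < N, τ a = τ' a) : tprod s τ N = tprod s τ' N := by
  induction N with
  | zero => rfl
  | succ N ih =>
    rw [tprod, tprod, h N (Nat.lt_succ_self N), ih fun a ha => h a (ha.trans (Nat.lt_succ_self N))]

include h2 in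
theorem map_bigTM_eq (hm : 1 ≤ m) {y : Q} (h : ∀ a < 2 ^ (n - 1), ∀ i, 1 ≤ i → i < m →
    f (tauM n m a i) = 0) (hy : ∀ a < 2 ^ (n - 1), f (tauM n m a m) = y) (k : ℕ) :
    f (bigTM n m k) = (tone + tsingle (2 ^ (n - 1) * m)
      (y ^ ((2 ^ (2 ^ (n - 1) * m) - 1) / (2 ^ m - 1))) : ℕ → Q) k := by
  rw [← tprod_const_two_pow (sqHom h2) h2 (sqHom_apply h2) hm, ← tprod_congr
    (τ := fun a k => f (tauM n m a k)) fun a ha => ?_]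
  · exact congrFun (map_bigTM n m f h2) k
  · funext i
    rcases Nat.eq_zero_or_pos i with rfl | hi
    · rw [tauM_zero, map_one, Pi.add_apply, tone, if_pos rfl, tsingle_apply_of_ne (by omega),
        add_zero]
    · rw [Pi.add_apply, tone, if_neg (by omega), zero_add]
      rcases lt_trichotomy i m with h1 | rfl | h1
      · rw [h a ha i hi h1, tsingle_apply_of_ne h1.ne]
      · rw [hy a ha, tsingle_apply_self]
      · rw [map_tauM_eq_zero n m f h2 a h1, tsingle_apply_of_ne h1.ne']

end CharacteristicTwo

/-! ### The element `D` and the effect of inverting it. -/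

section Periodicity

variable (n m : ℕ)

/-- The factors of `D` whose inversion kills `γ^a t_i` for `i < m`. -/
def killFactor (a i : ℕ) : Rnm n m :=
  -- With `c = T_h`, the commutation relation `x c^(2^i) = c x^(2^h)` for `x = γ^a t_i` becomes `x
  -- (x^(2^h-1) - c^(2^i-1)) = 0` once `c` is a unit; this is the second factor.
  tauM n m a i ^ (2 ^ (2 ^ (n - 1) * m) - 1) - bigTM n m (2 ^ (n - 1) * m) ^ (2 ^ i - 1)

/-- The factors of `D` whose inversion identifies `γ^a t_m` with `t_m`. -/
def identifyFactor (a : ℕ) : Rnm n m :=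
  -- The cofactor of `x - y` in `x^M - y^M`, for `x = γ^a t_m`, `y = t_m` and `M = 2^h - 1`.
  ∑ k ∈ Finset.range (2 ^ (2 ^ (n - 1) * m) - 1),
    tauM n m a m ^ k * tauM n m 0 m ^ (2 ^ (2 ^ (n - 1) * m) - 1 - 1 - k)

/-- The element `D` to be inverted, a multiple of the given element `x`. -/
def periodicityElement (x : Rnm n m) : Rnm n m :=
  x * ((∏ a ∈ Finset.range (2 ^ (n - 1)), ∏ i ∈ Finset.Ico 1 m, killFactor n m a i) *
    ∏ a ∈ Finset.range (2 ^ (n - 1)), identifyFactor n m a)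

theorem isWeightedHomogeneous_killFactor {a : ℕ} (ha : a < 2 ^ (n - 1)) (i : ℕ) :
    MvPolynomial.IsWeightedHomogeneous (weight n m) (killFactor n m a i)
      ((2 ^ (2 ^ (n - 1) * m) - 1) * (2 * (2 ^ i - 1))) := by
  have h1 := (isWeightedHomogeneous_tauM n m ha i).pow (2 ^ (2 ^ (n - 1) * m) - 1)
  have h2 := (isWeightedHomogeneous_bigTM n m (2 ^ (n - 1) * m)).pow (2 ^ i - 1)
  rw [smul_eq_mul] at h1 h2
  rw [mul_left_comm, mul_comm (2 ^ i - 1), ← mul_left_comm] at h2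
  exact h1.sub h2

theorem isWeightedHomogeneous_identifyFactor {a : ℕ} (ha : a < 2 ^ (n - 1)) :
    MvPolynomial.IsWeightedHomogeneous (weight n m) (identifyFactor n m a)
      ((2 ^ (2 ^ (n - 1) * m) - 1 - 1) * (2 * (2 ^ m - 1))) := by
  refine MvPolynomial.IsWeightedHomogeneous.sum _ _ _ fun k hk => ?_
  have hk := Finset.mem_range.mp hk
  have h1 := ((isWeightedHomogeneous_tauM n m ha m).pow k).mul
    ((isWeightedHomogeneous_tauM n m (Nat.two_pow_pos _) m).pow
      (2 ^ (2 ^ (n - 1) * m) - 1 - 1 - k))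
  convert h1 using 1
  rw [smul_eq_mul, smul_eq_mul, ← add_mul, Nat.add_sub_cancel' (by omega)]

theorem exists_isWeightedHomogeneous_periodicityElement {x : Rnm n m} {d : ℕ}
    (hx : MvPolynomial.IsWeightedHomogeneous (weight n m) x d) :
    ∃ d, MvPolynomial.IsWeightedHomogeneous (weight n m) (periodicityElement n m x) d :=
  ⟨_, hx.mul ((MvPolynomial.IsWeightedHomogeneous.prod _ _ _ fun _ ha =>
    MvPolynomial.IsWeightedHomogeneous.prod _ _ _ fun i _ =>
      isWeightedHomogeneous_killFactor n m (Finset.mem_range.mp ha) i).mul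
    (MvPolynomial.IsWeightedHomogeneous.prod _ _ _ fun _ ha =>
      isWeightedHomogeneous_identifyFactor n m (Finset.mem_range.mp ha)))⟩

variable {Q : Type*} [CommRing Q] (f : Rnm n m →+* Q)

theorem isUnit_map_killFactor {x : Rnm n m} (h : IsUnit (f (periodicityElement n m x))) {a i : ℕ}
    (ha : a < 2 ^ (n - 1)) (h1 : 1 ≤ i) (hi : i < m) : IsUnit (f (killFactor n m a i)) := by
  refine isUnit_of_dvd_unit (map_dvd f ?_) h
  refine Dvd.dvd.mul_left (Dvd.dvd.mul_right ?_ _) _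
  exact (Finset.dvd_prod_of_mem (killFactor n m a) (Finset.mem_Ico.mpr ⟨h1, hi⟩)).trans
    (Finset.dvd_prod_of_mem (fun a => ∏ i ∈ Finset.Ico 1 m, killFactor n m a i)
      (Finset.mem_range.mpr ha))

theorem isUnit_map_identifyFactor {x : Rnm n m} (h : IsUnit (f (periodicityElement n m x))) {a : ℕ}
    (ha : a < 2 ^ (n - 1)) : IsUnit (f (identifyFactor n m a)) := by
  refine isUnit_of_dvd_unit (map_dvd f ?_) h
  refine Dvd.dvd.mul_left (Dvd.dvd.mul_left ?_ _) _
  exact Finset.dvd_prod_of_mem (identifyFactor n m) (Finset.mem_range.mpr ha)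

/-- A ring under `R_n⟨m⟩` in which `2` and the coefficients of `T` of degree less than `h = 2^(n-1) m`
vanish, and in which the coefficient of degree `h` and `D` are invertible. -/
theorem map_tauM_of_isUnit (hm : 1 ≤ m) (h2 : (2 : Q) = 0)
    (hlow : ∀ k, 1 ≤ k → k < 2 ^ (n - 1) * m → f (bigTM n m k) = 0)
    (hc : IsUnit (f (bigTM n m (2 ^ (n - 1) * m)))) {x : Rnm n m}
    (hD : IsUnit (f (periodicityElement n m x))) :
    (∀ a < 2 ^ (n - 1), ∀ i, 1 ≤ i → i < m → f (tauM n m a i) = 0) ∧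
      (∀ a < 2 ^ (n - 1), f (tauM n m a m) = f (tauM n m 0 m)) ∧ IsUnit (f (tauM n m 0 m)) := by
  have hN := Nat.two_pow_pos (n - 1)
  have hh0 : 0 < 2 ^ (n - 1) * m := Nat.mul_pos hN hm
  have hT : tprod (sqHom h2) (fun a k => f (tauM n m a k)) (2 ^ (n - 1)) =
      tone + tsingle (2 ^ (n - 1) * m) (f (bigTM n m (2 ^ (n - 1) * m))) := by
    rw [← map_bigTM]
    funext k
    rw [Pi.add_apply]
    rcases Nat.eq_zero_or_pos k with rfl | hk
    · rw [tone, if_pos rfl, tsingle_apply_of_ne hh0.ne, add_zero, bigTM, bigT_zero, map_one,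
        map_one]
    · rw [tone, if_neg hk.ne', zero_add]
      rcases lt_trichotomy k (2 ^ (n - 1) * m) with h1 | rfl | h1
      · rw [hlow k hk h1, tsingle_apply_of_ne h1.ne]
      · rw [tsingle_apply_self]
      · rw [bigTM_eq_zero n m h1, map_zero, tsingle_apply_of_ne h1.ne']
  have key := mul_pow_eq_of_tprod_eq (sqHom h2) rfl hh0
    (fun a => by rw [tauM_zero, map_one]) (fun a k hk => map_tauM_eq_zero n m f h2 a hk)
    (map_tauM_add n m f h2) hT
  obtain ⟨e, he0, he⟩ := exists_tprod_eq_prod (s := sqHom h2) (τ := fun a k => f (tauM n m a k))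
    (d := fun _ => m) (N := 2 ^ (n - 1)) (fun a _ k hk => map_tauM_eq_zero n m f h2 a hk)
    (fun a _ k => sqHom_apply h2 _)
  rw [Finset.sum_const, Finset.card_range, smul_eq_mul, ← map_bigTM] at he
  simp only at he
  -- The top coefficient `c` is a product of positive powers of the `γ^a t_m`, so its invertibility
  -- makes each of them a unit.
  have hy : ∀ a < 2 ^ (n - 1), IsUnit (f (tauM n m a m)) := fun a ha => by
    rw [he] at hc
    exact (isUnit_pow_iff (he0 a)).mp (isUnit_of_dvd_unit (Finset.dvd_prod_of_mem
      (fun a => f (tauM n m a m) ^ e a) (Finset.mem_range.mpr ha)) hc)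
  set c := f (bigTM n m (2 ^ (n - 1) * m)) with hcdef
  have hkey : ∀ a k, f (tauM n m a k) *
      (f (tauM n m a k) ^ (2 ^ (2 ^ (n - 1) * m) - 1) - c ^ (2 ^ k - 1)) = 0 := by
    intro a k
    have h1 := key a k
    rw [map_pow_eq_pow (sqHom_apply h2 _), map_pow_eq_pow (sqHom_apply h2 _)] at h1
    have h3 : ∀ (x : Q) (j : ℕ), x ^ 2 ^ j = x * x ^ (2 ^ j - 1) := fun x j => by
      rw [← pow_succ', Nat.sub_add_cancel Nat.one_le_two_pow]
    rw [h3, h3] at h1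
    apply hc.mul_left_cancel
    linear_combination -h1
  refine ⟨fun a ha i h1 hi => ?_, fun a ha => ?_, hy 0 hN⟩
  · have h3 := isUnit_map_killFactor n m f hD ha h1 hi
    rw [killFactor, map_sub, map_pow, map_pow, ← hcdef] at h3
    exact (h3.mul_left_eq_zero).mp (hkey a i)
  -- As `γ^a t_m` is a unit, the relation gives `(γ^a t_m)^M = c^(2^m-1)`, independent of `a`; the
  -- invertible cofactor then forces `γ^a t_m = t_m`.
  · have h3 : ∀ a < 2 ^ (n - 1), f (tauM n m a m) ^ (2 ^ (2 ^ (n - 1) * m) - 1) =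
        c ^ (2 ^ m - 1) := fun a ha =>
      sub_eq_zero.mp (((hy a ha).mul_right_eq_zero).mp (hkey a m))
    have h4 := geom_sum₂_mul (f (tauM n m a m)) (f (tauM n m 0 m)) (2 ^ (2 ^ (n - 1) * m) - 1)
    rw [h3 a ha, h3 0 hN, sub_self] at h4
    have h5 := isUnit_map_identifyFactor n m f hD ha
    rw [identifyFactor, map_sum] at h5
    simp only [map_mul, map_pow] at h5
    exact sub_eq_zero.mp ((h5.mul_right_eq_zero).mp h4)

end Periodicity

/-! ### The map to `𝔽_2[t_m^±1]`. -/

section LaurentReduction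

variable (n m : ℕ)

/-- The exponent `(2^h - 1) / (2^m - 1)`, where `h = 2^(n-1) m`. -/
def topExponent : ℕ := (2 ^ (2 ^ (n - 1) * m) - 1) / (2 ^ m - 1)

/-- The homomorphism from `R_n⟨m⟩` to `𝔽_2[t_m^±1]` that sends all `γ^j t_m` to `t_m` and kills the
`γ^j t_i` with `i < m`. -/
def toLaurent : Rnm n m →+* LaurentPolynomial (ZMod 2) :=
  MvPolynomial.eval₂Hom (LaurentPolynomial.C.comp zLocTwoToZMod) fun p =>
    if (p.2 : ℕ) + 1 = m then LaurentPolynomial.T 1 else 0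

theorem toLaurent_X (p : Fin (2 ^ (n - 1)) × Fin m) : toLaurent n m (MvPolynomial.X p) =
    if (p.2 : ℕ) + 1 = m then LaurentPolynomial.T 1 else 0 :=
  MvPolynomial.eval₂Hom_X' _ _ _

theorem two_eq_zero_laurent : (2 : LaurentPolynomial (ZMod 2)) = 0 := by
  rw [← map_ofNat (LaurentPolynomial.C (R := ZMod 2)) 2, show (OfNat.ofNat 2 : ZMod 2) = 0 from rfl,
    map_zero]

theorem isUnit_laurent_T : IsUnit (LaurentPolynomial.T 1 : LaurentPolynomial (ZMod 2)) :=
  LaurentPolynomial.isUnit_T 1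

variable {n m}

theorem toLaurent_tauM_of_lt {a i : ℕ} (ha : a < 2 ^ (n - 1)) (h1 : 1 ≤ i) (hi : i < m) :
    toLaurent n m (tauM n m a i) = 0 := by
  obtain ⟨i, rfl⟩ : ∃ i', i = i' + 1 := ⟨i - 1, by omega⟩
  rw [tauM_succ n m ha (by omega), toLaurent_X, if_neg (by simp only; omega)]

theorem toLaurent_tauM_self {a : ℕ} (ha : a < 2 ^ (n - 1)) (hm : 1 ≤ m) :
    toLaurent n m (tauM n m a m) = LaurentPolynomial.T 1 := by
  obtain ⟨i, rfl⟩ : ∃ i', m = i' + 1 := ⟨m - 1, by omega⟩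
  rw [tauM_succ n _ ha (Nat.lt_succ_self i), toLaurent_X, if_pos rfl]

theorem toLaurent_bigTM (hm : 1 ≤ m) (k : ℕ) : toLaurent n m (bigTM n m k) =
    (tone + tsingle (2 ^ (n - 1) * m) (LaurentPolynomial.T 1 ^ topExponent n m) :
      ℕ → LaurentPolynomial (ZMod 2)) k :=
  map_bigTM_eq n m (toLaurent n m) two_eq_zero_laurent hm
    (fun _ ha _ h1 hi => toLaurent_tauM_of_lt ha h1 hi) (fun _ ha => toLaurent_tauM_self ha hm) k

theorem toLaurent_bigTM_of_lt (hm : 1 ≤ m) {k : ℕ} (h1 : 1 ≤ k) (hk : k < 2 ^ (n - 1) * m) :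
    toLaurent n m (bigTM n m k) = 0 := by
  rw [toLaurent_bigTM hm, Pi.add_apply, tone, if_neg (by omega), tsingle_apply_of_ne hk.ne, add_zero]

theorem toLaurent_bigTM_self (hm : 1 ≤ m) : toLaurent n m (bigTM n m (2 ^ (n - 1) * m)) =
    LaurentPolynomial.T 1 ^ topExponent n m := by
  have := Nat.mul_pos (Nat.two_pow_pos (n - 1)) hm
  rw [toLaurent_bigTM hm, Pi.add_apply, tone, if_neg (by omega), tsingle_apply_self, zero_add]

/-- The first kind of factor goes to minus a power of `t_m`, as `γ^a t_i` goes to `0`. The second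
goes to a sum of `2^h - 1` copies of one power of `t_m`, and this number of terms is odd. -/
theorem isUnit_toLaurent_periodicityElement (hm : 1 ≤ m) {x : Rnm n m}
    (hx : IsUnit (toLaurent n m x)) : IsUnit (toLaurent n m (periodicityElement n m x)) := by
  have hh := Nat.mul_pos (Nat.two_pow_pos (n - 1)) hm
  have hM : 2 ∣ 2 ^ (2 ^ (n - 1) * m) := dvd_pow_self 2 hh.ne'
  have hM1 : 1 ≤ 2 ^ (2 ^ (n - 1) * m) := Nat.one_le_two_pow
  rw [periodicityElement, map_mul, map_mul, map_prod, map_prod]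
  refine hx.mul (IsUnit.mul ?_ ?_)
  · rw [IsUnit.prod_iff]
    intro a ha
    rw [map_prod, IsUnit.prod_iff]
    intro i hi
    have hi := Finset.mem_Ico.mp hi
    rw [killFactor, map_sub, map_pow, map_pow,
      toLaurent_tauM_of_lt (Finset.mem_range.mp ha) hi.1 hi.2, zero_pow (by omega), zero_sub,
      toLaurent_bigTM_self hm]
    exact ((isUnit_laurent_T.pow _).pow _).neg
  · rw [IsUnit.prod_iff]
    intro a ha
    rw [identifyFactor, map_sum, Finset.sum_congr (g := fun _ => LaurentPolynomial.T 1 ^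
      (2 ^ (2 ^ (n - 1) * m) - 1 - 1)) rfl fun k hk => ?_, Finset.sum_const, Finset.card_range]
    · obtain ⟨q, hq⟩ := hM
      have hodd : 2 ^ (2 ^ (n - 1) * m) - 1 = 2 * (q - 1) + 1 := by omega
      rw [nsmul_eq_mul, hodd, Nat.cast_add, Nat.cast_mul, Nat.cast_ofNat, two_eq_zero_laurent,
        zero_mul, zero_add, Nat.cast_one, one_mul]
      exact isUnit_laurent_T.pow (2 * (q - 1) + 1 - 1)
    · have hk := Finset.mem_range.mp hk
      rw [map_mul, map_pow, map_pow, toLaurent_tauM_self (Finset.mem_range.mp ha) hm,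
        toLaurent_tauM_self (Nat.two_pow_pos _) hm, ← pow_add, Nat.add_sub_cancel' (by omega)]

theorem laurent_ringHom_ext {R Q : Type*} [CommRing R] [CommRing Q]
    {f g : LaurentPolynomial R →+* Q}
    (hC : f.comp LaurentPolynomial.C = g.comp LaurentPolynomial.C)
    (hT : f (LaurentPolynomial.T 1) = g (LaurentPolynomial.T 1)) : f = g := by
  refine IsLocalization.ringHom_ext (Submonoid.powers (Polynomial.X : Polynomial R)) ?_
  apply Polynomial.ringHom_ext
  · intro a
    simpa using congrArg (fun f : R →+* Q => f a) hC
  · simpa using hT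

variable {F : FormalGroup (Rn n)} {v : ℕ → Rn n} (hF : IsCanonical n F) (hv : IsAraki F v)
  {Q : Type*} [CommRing Q] (f : Rnm n m →+* Q) (h2 : (2 : Q) = 0)

include hF hv h2 in
theorem map_truncate_araki (hlow : ∀ k, 1 ≤ k → k < 2 ^ (n - 1) * m → f (bigTM n m k) = 0) {r : ℕ}
    (h1 : 1 ≤ r) (hr : r ≤ 2 ^ (n - 1) * m) : f (truncate n m (v r)) = f (bigTM n m r) := by
  have hker : chromIdeal (bigTM n m) r ≤ RingHom.ker f :=
    chromIdeal_le (by rw [RingHom.mem_ker, map_ofNat, h2]) fun k h1 hk => hlow k h1 (hk.trans_le hr)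
  have h3 := hker (truncate_araki_add_mem hF hv h1)
  rw [RingHom.mem_ker, _root_.map_add] at h3
  linear_combination h3 - f (bigTM n m r) * h2

include hF hv h2 in
theorem map_bigTM_eq_zero_of_map_araki
    (hlow : ∀ k, 1 ≤ k → k < 2 ^ (n - 1) * m → f (truncate n m (v k)) = 0) {k : ℕ} (h1 : 1 ≤ k)
    (hk : k < 2 ^ (n - 1) * m) : f (bigTM n m k) = 0 := by
  have hker : chromIdeal (fun i => truncate n m (v i)) (2 ^ (n - 1) * m) ≤ RingHom.ker f :=
    chromIdeal_le (by rw [RingHom.mem_ker, map_ofNat, h2]) hlow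
  rw [chromIdeal_truncate_araki hF hv] at hker
  exact hker (mem_chromIdeal h1 hk)

include hF hv in
theorem toLaurent_araki_of_lt (hm : 1 ≤ m) {k : ℕ} (h1 : 1 ≤ k) (hk : k < 2 ^ (n - 1) * m) :
    toLaurent n m (truncate n m (v k)) = 0 := by
  rw [map_truncate_araki hF hv _ two_eq_zero_laurent
    (fun _ h1 hk => toLaurent_bigTM_of_lt hm h1 hk) h1 hk.le, toLaurent_bigTM_of_lt hm h1 hk]

include hF hv in
theorem toLaurent_araki_self (hm : 1 ≤ m) : toLaurent n m (truncate n m (v (2 ^ (n - 1) * m))) =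
    LaurentPolynomial.T 1 ^ topExponent n m := by
  rw [map_truncate_araki hF hv _ two_eq_zero_laurent
    (fun _ h1 hk => toLaurent_bigTM_of_lt hm h1 hk) (Nat.mul_pos (Nat.two_pow_pos (n - 1)) hm) le_rfl,
    toLaurent_bigTM_self hm]

include hF hv in
theorem isUnit_toLaurent_araki (hm : 1 ≤ m) : IsUnit (toLaurent n m
    (periodicityElement n m (truncate n m (v (2 ^ (n - 1) * m))))) := by
  refine isUnit_toLaurent_periodicityElement hm ?_
  rw [toLaurent_araki_self hF hv hm]
  exact isUnit_laurent_T.pow _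

end LaurentReduction

/-! ### Identification of the quotient ring and the height of `F` over it. -/

section QuotientRing

variable {n m : ℕ} {F : FormalGroup (Rn n)} {v : ℕ → Rn n}

/-- The quotient of `D⁻¹ R_n⟨m⟩` by `I_h` is `𝔽_2[t_m^±1]`. -/
theorem exists_ringEquiv_laurent (hF : IsCanonical n F) (hv : IsAraki F v) (hm : 1 ≤ m)
    {A : Type*} [CommRing A] [Algebra (Rnm n m) A]
    [IsLocalization.Away (periodicityElement n m (truncate n m (v (2 ^ (n - 1) * m)))) A]
    {I : Ideal A}
    (hI : I = chromIdeal (fun i => algebraMap (Rnm n m) A (truncate n m (v i))) (2 ^ (n - 1) * m)) :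
    ∃ e : (A ⧸ I) ≃+* LaurentPolynomial (ZMod 2), ∀ x : Rnm n m,
      e (Ideal.Quotient.mk I (algebraMap (Rnm n m) A x)) = toLaurent n m x := by
  set D := periodicityElement n m (truncate n m (v (2 ^ (n - 1) * m))) with hD
  set φA : A →+* LaurentPolynomial (ZMod 2) :=
    IsLocalization.Away.lift D (isUnit_toLaurent_araki hF hv hm) with hφA
  have hφι : ∀ x, φA (algebraMap (Rnm n m) A x) = toLaurent n m x :=
    IsLocalization.Away.lift_eq D (isUnit_toLaurent_araki hF hv hm)
  have hker : I ≤ RingHom.ker φA := by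
    rw [hI]
    refine chromIdeal_le (by rw [RingHom.mem_ker, map_ofNat, two_eq_zero_laurent]) fun k h1 hk => ?_
    rw [RingHom.mem_ker, hφι, toLaurent_araki_of_lt hF hv hm h1 hk]
  set φ : A ⧸ I →+* LaurentPolynomial (ZMod 2) := Ideal.Quotient.lift I φA hker with hφ
  set g : Rnm n m →+* A ⧸ I := (Ideal.Quotient.mk I).comp (algebraMap (Rnm n m) A) with hg
  have hφg : ∀ x, φ (g x) = toLaurent n m x := fun x => (Ideal.Quotient.lift_mk I φA _).trans (hφι x)
  have h2 : (2 : A ⧸ I) = 0 := by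
    rw [← map_ofNat (Ideal.Quotient.mk I) 2, Ideal.Quotient.eq_zero_iff_mem, hI]
    exact two_mem_chromIdeal _ _
  have hv0 : ∀ k, 1 ≤ k → k < 2 ^ (n - 1) * m → g (truncate n m (v k)) = 0 := fun k h1 hk => by
    rw [hg, RingHom.comp_apply, Ideal.Quotient.eq_zero_iff_mem, hI]
    exact mem_chromIdeal (v := fun i => algebraMap (Rnm n m) A (truncate n m (v i))) h1 hk
  have hlow : ∀ k, 1 ≤ k → k < 2 ^ (n - 1) * m → g (bigTM n m k) = 0 := fun k h1 hk =>
    map_bigTM_eq_zero_of_map_araki hF hv g h2 hv0 h1 hk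
  have hDu : IsUnit (g D) := (IsLocalization.Away.algebraMap_isUnit D).map (Ideal.Quotient.mk I)
  have hc : IsUnit (g (bigTM n m (2 ^ (n - 1) * m))) := by
    rw [← map_truncate_araki hF hv g h2 hlow (Nat.mul_pos (Nat.two_pow_pos (n - 1)) hm) le_rfl]
    exact isUnit_of_dvd_unit (map_dvd g (dvd_mul_right _ _)) hDu
  obtain ⟨hkill, hident, ⟨y, hy⟩⟩ := map_tauM_of_isUnit n m g hm h2 hlow hc hDu
  have : Nontrivial (A ⧸ I) := φ.domain_nontrivial
  have : CharP (A ⧸ I) 2 := CharTwo.of_one_ne_zero_of_two_eq_zero one_ne_zero h2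
  -- The inverse sends `t_m` to its class, which is a unit. The other composite is the identity
  -- because in the quotient `γ^a t_i` vanishes for `i < m` and every `γ^a t_m` equals `t_m`.
  set ψ : LaurentPolynomial (ZMod 2) →+* A ⧸ I :=
    LaurentPolynomial.eval₂ (ZMod.castHom (dvd_refl 2) (A ⧸ I)) y with hψ
  have hψT : ψ (LaurentPolynomial.T 1) = y := by
    rw [hψ, LaurentPolynomial.eval₂_T, zpow_one]
  have h3 : φ.comp ψ = RingHom.id _ := by
    refine laurent_ringHom_ext (RingHom.ext_zmod _ _) ?_
    rw [RingHom.comp_apply, hψT, hy, hφg, toLaurent_tauM_self (Nat.two_pow_pos _) hm]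
    rfl
  have h4 : ψ.comp φ = RingHom.id _ := by
    refine Ideal.Quotient.ringHom_ext ?_
    refine IsLocalization.ringHom_ext (Submonoid.powers D) ?_
    apply MvPolynomial.ringHom_ext
    · intro a
      exact congrArg (fun f : ZLocTwo →+* A ⧸ I => f a) (zLocTwo_ringHom_ext
        (((ψ.comp φ).comp g).comp MvPolynomial.C) (g.comp MvPolynomial.C))
    · rintro ⟨⟨a, ha⟩, ⟨i, hi⟩⟩
      change ψ (φ (g (MvPolynomial.X _))) = g (MvPolynomial.X _)
      rw [hφg, toLaurent_X, ← tauM_succ n m ha hi]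
      by_cases him : i + 1 = m
      · rw [if_pos him, hψT, hy, him, hident a ha]
      · rw [if_neg him, map_zero, hkill a ha (i + 1) (by omega) (by omega)]
  exact ⟨RingEquiv.ofRingHom φ ψ h3 h4, hφg⟩

/-- The height of `F` over a ring under `R_n⟨m⟩` in which `2, v_1, …, v_{h-1}` vanish and `v_h` is
invertible. -/
theorem hasHeight_map_of_isUnit {S : Type*} [CommRing S] {G : FormalGroup (Rn n)} {h : ℕ}
    (hG : IsAraki G v) (g : Rn n →+* S) (h2 : g (v 0) = 0)
    (hlow : ∀ k, 1 ≤ k → k < h → g (v k) = 0) (hu : IsUnit (g (v h))) : HasHeight (G.map g) h := by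
  have hmap := hG.map g
  obtain ⟨u, hu⟩ := hu
  have hzero : ∀ k < h, g (v k) = 0 := fun k hk => by
    rcases Nat.eq_zero_or_pos k with rfl | h1
    · exact h2
    · exact hlow k h1 hk
  obtain ⟨h3, h4⟩ := coeff_formalSum_of_eq_zero (G.map g) (a := fun k => g (v k)) (r := h) hzero
  refine ⟨_, hmap, u, fun d hd => ?_, ?_⟩
  · rw [hmap, h3 d hd]
    exact Ideal.zero_mem _
  · rw [hmap, h4, hu, sub_self]
    exact Ideal.zero_mem _

theorem IsCanonical.araki_zero (hF : IsCanonical n F) (hv : IsAraki F v) : v 0 = 2 := by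
  have := (isAraki_iff (toRat_injective n) hF.isLog v).mp hv 0
  apply toRat_injective n
  rw [map_ofNat]
  simpa [canonicalLog_zero] using this.symm

end QuotientRing

end

end NormBP

/-! ### Assembly of the theorem. -/

open NormBP

theorem mainTheorem3 (n m : ℕ) (hn : 1 ≤ n) (hm : 1 ≤ m) :
    (∃! F : FormalGroup (Rn n), IsCanonical n F) ∧
    ∀ F : FormalGroup (Rn n), IsCanonical n F →
      (∃! v : ℕ → Rn n, IsAraki F v) ∧
      ∀ v : ℕ → Rn n, IsAraki F v →
        let h : ℕ := 2 ^ (n - 1) * m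
        let w : ℕ → Rnm n m := fun i => truncate n m (v i)
        ∃ D : Rnm n m,
          (∃ d : ℕ, MvPolynomial.IsWeightedHomogeneous (weight n m) D d) ∧
          w h ∣ D ∧
          (let A := Localization.Away D
           let ι : Rnm n m →+* A := algebraMap (Rnm n m) A
           let I : Ideal A := chromIdeal (fun i => ι (w i)) h
           RingTheory.Sequence.IsRegular A (chromSeq (fun i => ι (w i)) (h - 1)) ∧
           RingTheory.Sequence.IsWeaklyRegular A (chromSeq (fun i => ι (w i)) h) ∧
           (∃ e : (A ⧸ I) ≃+* LaurentPolynomial (ZMod 2),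
             (∀ (j : Fin (2 ^ (n - 1))) (i : Fin m),
               e (Ideal.Quotient.mk I (ι (MvPolynomial.X (j, i)))) =
                 if (i : ℕ) + 1 = m then LaurentPolynomial.T 1 else 0) ∧
             e (Ideal.Quotient.mk I (ι (w h))) =
               LaurentPolynomial.T 1 ^ ((2 ^ h - 1) / (2 ^ m - 1))) ∧
           HasHeight (F.map (((Ideal.Quotient.mk I).comp ι).comp (truncate n m))) h) ∧
          ∀ r : ℕ, h < r → w r ∈ chromIdeal w r := by
  refine ⟨existsUnique_isCanonical n, fun F hF =>
    ⟨existsUnique_isAraki (toRat_injective n) hF.isLog, fun v hv => ?_⟩⟩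
  intro h w
  refine ⟨periodicityElement n m (w h), exists_isWeightedHomogeneous_periodicityElement n m
    (isWeightedHomogeneous_truncate_araki m hF hv h), dvd_mul_right _ _, ?_,
    fun r hr => truncate_araki_mem hF hv hr⟩
  intro A ι I
  have hh : 1 ≤ h := Nat.mul_pos (Nat.two_pow_pos (n - 1)) hm
  obtain ⟨e, he⟩ := exists_ringEquiv_laurent (A := A) (I := I) hF hv hm rfl
  have hmap : ∀ r, (chromSeq w r).map ι = chromSeq (fun i => ι (w i)) r := fun r => by
    simpa [chromSeq] using map_ofNat ι 2
  have hreg : ∀ r ≤ h, RingTheory.Sequence.IsWeaklyRegular A (chromSeq (fun i => ι (w i)) r) :=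
    fun r hr => by
      rw [← hmap]
      -- Weak regularity already holds over `R_n⟨m⟩` and survives localization, which is flat; only
      -- non-triviality of the quotient depends on the choice of `D`.
      exact (isWeaklyRegular_truncate_araki hF hv hr).of_isLocalization A
        (Submonoid.powers (periodicityElement n m (w h)))
  have hew : e (Ideal.Quotient.mk I (ι (w h))) =
      LaurentPolynomial.T 1 ^ ((2 ^ h - 1) / (2 ^ m - 1)) :=
    (he (w h)).trans (toLaurent_araki_self hF hv hm)
  refine ⟨⟨hreg (h - 1) (Nat.sub_le h 1), fun htop => ?_⟩, hreg h le_rfl,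
    ⟨e, fun j i => (he _).trans (toLaurent_X n m (j, i)), hew⟩, ?_⟩
  -- The sequence ending in `v_{h-1}` generates `I_h`, and the quotient by it is non-zero because it
  -- maps to `𝔽_2[t_m^±1]`.
  · have hI : Ideal.ofList (chromSeq (fun i => ι (w i)) (h - 1)) = I := by
      have h6 := chromIdeal_succ_eq (fun i => ι (w i)) (h - 1)
      rw [Nat.sub_add_cancel hh] at h6
      exact (Ideal.ofList_cons _ _).trans h6.symm
    rw [smul_eq_mul, Ideal.mul_top, hI] at htop
    have : Nontrivial (A ⧸ I) := e.toRingHom.domain_nontrivial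
    exact Ideal.Quotient.nontrivial_iff.mp this htop.symm
  · refine hasHeight_map_of_isUnit hv _ ?_ (fun k h1 hk => ?_) ?_
    · rw [hF.araki_zero hv, map_ofNat, ← map_ofNat (Ideal.Quotient.mk I) 2,
        Ideal.Quotient.eq_zero_iff_mem]
      exact two_mem_chromIdeal _ _
    · exact Ideal.Quotient.eq_zero_iff_mem.mpr (mem_chromIdeal (v := fun i => ι (w i)) h1 hk)
    · have h5 : IsUnit (e (Ideal.Quotient.mk I (ι (w h)))) := by
        rw [hew]
        exact isUnit_laurent_T.pow _
      exact (MulEquiv.isUnit_map e).mp h5
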